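/- Let $V$ be a finite non-empty set and let $(\mathbb P_x)_{x\in V}$ be the continuous-time Markov chain on $V$ with transition rates $q(x,y)\ge 0$ ($x\ne y$), not necessarily reversible, realized on piecewise constant right-continuous paths $X=(X_t)_{t\ge 0}$. Assume that the chain is mixing: it has a unique stationary distribution $\pi$, and for every $a\in(0,1)$ there is $T\ge 0$ such that the total variation distance between the law of $X_T$ under $\mathbb P_x$ and $\pi$ is at most $a$ for all $x\in V$. Let $T_{\rm mix}$ be the smallest such $T$ for $a=1/4$, let $q_{\max}=\max_x\sum_{y\neq x}q(x,y)$, $\pi_{\max}=\max_x\pi(x)$, and $$\alpha=(1+q_{\max}T_{\rm mix})\,\pi_{\max},\qquad \varepsilon=\Big(\alpha\,\ln\tfrac1\alpha\,\ln^4|V|\Big)^{1/6}.$$ Let $m$ be the expected meeting time $\mathbb E\inf\{t\geq 0: X_t(1)=X_t(2)\}$ of two independent copies of the chain, both started from $\pi$. Let $\mathsf C$ be the full coalescence time: walkers start from all elements of $V$ (one each) and move independently according to the chain, except that walkers which meet move together from then on (the walker with the larger index follows the one with the smaller index), and $\mathsf C$ is the first time at which only one site is occupied. Let $Z_2,Z_3,\dots$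 be independent, $Z_i$ exponential with mean $1/\binom i2$. Let $d_W(\lambda_1,\lambda_2)=\int_{\mathbb R}|\lambda_1(x,\infty)-\lambda_2(x,\infty)|\,dx$ be the $L^1$ Wasserstein distance. Then there are universal constants $C,\xi>0$ such that, for every such chain with $\alpha\le 1/2$ and $\varepsilon\le\xi$, one has $0<m<\infty$, $\mathbb E[\mathsf C]<\infty$, $$d_W\Big(\mathrm{Law}(\mathsf C/m),\ \mathrm{Law}\Big(\sum_{i\ge2}Z_i\Big)\Big)\le C\,\varepsilon \qquad\text{and}\qquad \big|\mathbb E[\mathsf C]-2m\big|\le C\,\varepsilon\, m .$$ -/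

import Mathlib

open MeasureTheory ProbabilityTheory Filter Set
open scoped NNReal ENNReal Topology

noncomputable section

namespace CoalescingWalks

/-! ### Trajectories -/

/-- `ω` is constant on each `[t n, t (n+1))` for some `0 = t 0 < t 1 < ⋯` increasing to infinity. -/
def IsStepPath {V : Type*} (ω : ℝ≥0 → V) : Prop :=
  ∃ t : ℕ → ℝ≥0, t 0 = 0 ∧ StrictMono t ∧ Tendsto t atTop atTop ∧
    ∀ n, ∀ s ∈ Ico (t n) (t (n + 1)), ω s = ω (t n)

/-- The path space `𝔻([0,∞), V)`. -/
structure StepPath (V : Type*) where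
  toFun : ℝ≥0 → V
  isStepPath : IsStepPath toFun

instance {V : Type*} : CoeFun (StepPath V) (fun _ => ℝ≥0 → V) := ⟨StepPath.toFun⟩

/-- The σ-field on the path space generated by the projections `ω ↦ ω t` (`V` is discrete). -/
instance {V : Type*} : MeasurableSpace (StepPath V) :=
  ⨆ t : ℝ≥0, MeasurableSpace.comap (fun ω : StepPath V => ω t) ⊤

/-- The σ-field `ℱ_T` generated by the projections `ω ↦ ω t` with `t ≤ T`. -/
abbrev pastSigma (V : Type*) (T : ℝ≥0) : MeasurableSpace (StepPath V) :=
  ⨆ t : ℝ≥0, ⨆ _ : t ≤ T, MeasurableSpace.comap (fun ω : StepPath V => ω t) ⊤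

theorem IsStepPath.shift {V : Type*} {ω : ℝ≥0 → V} (h : IsStepPath ω) (T : ℝ≥0) :
    IsStepPath (fun s => ω (s + T)) := by
  classical
  obtain ⟨t, h0, hmono, htop, hc⟩ := h
  have hex : ∃ n, T < t n := (htop.eventually_gt_atTop T).exists
  obtain ⟨N, hN⟩ : ∃ N, Nat.find hex = N + 1 := by
    refine Nat.exists_eq_succ_of_ne_zero fun hz => ?_
    have := Nat.find_spec hex
    rw [hz, h0] at this
    exact not_lt_bot this
  have hlt : T < t (N + 1) := hN ▸ Nat.find_spec hex
  have hle : t N ≤ T := not_lt.1 (Nat.find_min hex (by omega))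
  have hT : ∀ n, T < t (N + 1 + n) := fun n => hlt.trans_le (hmono.monotone (by omega))
  refine ⟨fun n => Nat.casesOn n 0 (fun k => t (N + 1 + k) - T), rfl, ?_, ?_, ?_⟩
  · refine strictMono_nat_of_lt_succ fun n => ?_
    cases n with
    | zero => exact tsub_pos_of_lt (hT 0)
    | succ k => exact tsub_lt_tsub_right_of_le (hT k).le (hmono (by omega))
  · rw [← tendsto_add_atTop_iff_nat 1, tendsto_atTop]
    intro b
    have h1 : Tendsto (fun k => t (N + 1 + k)) atTop atTop :=
      htop.comp (tendsto_atTop_mono (fun k => Nat.le_add_left k (N + 1)) tendsto_id)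
    filter_upwards [h1.eventually_ge_atTop (b + T)] with k hk
    exact le_tsub_of_add_le_right hk
  · intro n s hs
    cases n with
    | zero =>
      have h2 : s < t (N + 1) - T := hs.2
      have h3 : s + T ∈ Ico (t N) (t (N + 1)) :=
        ⟨hle.trans le_add_self, lt_tsub_iff_right.1 h2⟩
      have h4 : (0 : ℝ≥0) + T ∈ Ico (t N) (t (N + 1)) := by
        rw [zero_add]; exact ⟨hle, hlt⟩
      exact (hc N _ h3).trans (hc N _ h4).symm
    | succ k =>
      have h1 : t (N + 1 + k) - T ≤ s := hs.1
      have h2 : s < t (N + 1 + (k + 1)) - T := hs.2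
      have h3 : s + T ∈ Ico (t (N + 1 + k)) (t (N + 1 + k + 1)) :=
        ⟨tsub_le_iff_right.1 h1, lt_tsub_iff_right.1 h2⟩
      change ω (s + T) = ω (t (N + 1 + k) - T + T)
      rw [tsub_add_cancel_of_le (hT k).le]
      exact hc _ _ h3

/-- The time shift `Θ_T`. -/
def shift {V : Type*} (T : ℝ≥0) (ω : StepPath V) : StepPath V :=
  ⟨fun s => ω (s + T), ω.isStepPath.shift T⟩

/-! ### Markov chains -/

/-- `P = (P_x)` is the continuous-time Markov chain on `V` with transition rates `q x y`, `x ≠ y`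
(the diagonal values of `q` play no role). -/
structure IsMarkovChain {V : Type*} (q : V → V → ℝ≥0) (P : V → Measure (StepPath V)) : Prop where
  prob : ∀ x, IsProbabilityMeasure (P x)
  start : ∀ x, P x {ω | ω 0 = x} = 1
  rates : ∀ x y, x ≠ y →
    Tendsto (fun ε : ℝ≥0 => (P x).real {ω | ω ε = y} / (ε : ℝ)) (𝓝[>] 0) (𝓝 (q x y : ℝ))
  /-- Given `ℱ_T`, the conditional law of `X ∘ Θ_T` under `P_x` is `P_{X_T}`. -/
  markov : ∀ (x : V) (T : ℝ≥0) (A B : Set (StepPath V)), MeasurableSet[pastSigma V T] A →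
    MeasurableSet B → P x (A ∩ shift T ⁻¹' B) = ∫⁻ ω in A, P (ω T) B ∂(P x)

section

variable {V : Type*} [Fintype V]

/-- The law `P_μ = ∑ x, μ(x) P_x` of the chain started from the distribution `μ`. -/
def startFrom (P : V → Measure (StepPath V)) (μ : V → ℝ) : Measure (StepPath V) :=
  ∑ x, ENNReal.ofReal (μ x) • P x

/-- `μ` is a probability vector that is stationary for the chain. -/
def IsStationary (P : V → Measure (StepPath V)) (μ : V → ℝ) : Prop :=
  μ ∈ stdSimplex ℝ V ∧ ∀ T : ℝ≥0, (startFrom P μ).map (shift T) = startFrom P μ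

/-- Total variation distance. -/
def tvDist (μ ν : V → ℝ) : ℝ := (1 / 2) * ∑ y, |μ y - ν y|

/-- Every `P_x` has, at time `T`, a law within total variation distance `a` of `π`. -/
def MixedAt (P : V → Measure (StepPath V)) (π : V → ℝ) (a : ℝ) (T : ℝ≥0) : Prop :=
  ∀ x, tvDist (fun y => (P x).real {ω | ω T = y}) π ≤ a

/-- The chain is mixing, with unique stationary distribution `π`. -/
structure IsMixing (P : V → Measure (StepPath V)) (π : V → ℝ) : Prop where
  stationary : IsStationary P π
  unique : ∀ μ, IsStationary P μ → μ = π
  mixes : ∀ a ∈ Ioo (0 : ℝ) 1, ∃ T, MixedAt P π a T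

/-- The `a`-mixing time; the mixing time is the case `a = 1/4`. -/
def mixingTime (P : V → Measure (StepPath V)) (π : V → ℝ) (a : ℝ) : ℝ≥0 :=
  sInf {T | MixedAt P π a T}

/-- The maximal total jump rate `max_x ∑_{y ≠ x} q(x,y)`. -/
def qMax [DecidableEq V] (q : V → V → ℝ≥0) : ℝ :=
  ⨆ x, ∑ y ∈ Finset.univ.erase x, (q x y : ℝ)

/-- `α(Q) = (1 + q_max T_mix) π_max`. -/
def alpha [DecidableEq V] (q : V → V → ℝ≥0) (P : V → Measure (StepPath V)) (π : V → ℝ) : ℝ :=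
  (1 + qMax q * (mixingTime P π (1 / 4) : ℝ)) * ⨆ x, π x

/-- `(α(Q) ln(1/α(Q)) ln⁴|V|)^{1/6}`. -/
def errorTerm [DecidableEq V] (q : V → V → ℝ≥0) (P : V → Measure (StepPath V)) (π : V → ℝ) : ℝ :=
  (alpha q P π * Real.log (1 / alpha q P π) * Real.log (Fintype.card V) ^ 4) ^ (1 / 6 : ℝ)

end

/-! ### Meeting and coalescence -/

/-- The meeting time of two trajectories (infinite if they never meet). -/
def meetingTime {V : Type*} (w w' : StepPath V) : ℝ≥0∞ :=
  ⨅ (t : ℝ≥0) (_ : w t = w' t), (t : ℝ≥0∞)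

/-- The expected meeting time of two independent walks, both started from `π`. -/
def meanMeetingTime {V : Type*} [Fintype V] (P : V → Measure (StepPath V)) (π : V → ℝ) : ℝ≥0∞ :=
  ∫⁻ w, meetingTime w.1 w.2 ∂((startFrom P π).prod (startFrom P π))

/-- The first time at which `w` meets one of the trajectories `Y i`. -/
def encounterTime {V : Type*} {k : ℕ} (Y : Fin k → ℝ≥0 → V) (w : ℝ≥0 → V) : ℝ≥0∞ :=
  ⨅ (t : ℝ≥0) (_ : ∃ i, w t = Y i t), (t : ℝ≥0∞)

open Classical in
/-- The trajectory that equals `w` before the first time `T` at which `w` meets one of the `Y i`,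
and from then on equals `Y I`, where `I` is an index with `w T = Y I T`. -/
def follow {V : Type*} {k : ℕ} (Y : Fin k → ℝ≥0 → V) (w : ℝ≥0 → V) (t : ℝ≥0) : V :=
  if h : encounterTime Y w ≤ t ∧
      ∃ i, w (encounterTime Y w).toNNReal = Y i (encounterTime Y w).toNNReal
  then Y h.2.choose t else w t

/-- The coalescing process built from `k` trajectories, walker by walker: as soon as a walker meets
a walker of smaller index, it moves along with it. -/
def coalesce {V : Type*} : (k : ℕ) → (Fin k → ℝ≥0 → V) → Fin k → ℝ≥0 → V
  | 0, _ => Fin.elim0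
  | k + 1, w =>
    Fin.snoc (α := fun _ => ℝ≥0 → V) (coalesce k (Fin.init w))
      (follow (coalesce k (Fin.init w)) (w (Fin.last k)))

/-- The first time at which the coalescing walkers occupy at most one site. -/
def coalescenceTime {V : Type*} {k : ℕ} (w : Fin k → StepPath V) : ℝ≥0∞ :=
  ⨅ (t : ℝ≥0) (_ : (range fun j => coalesce k (fun i => (w i : ℝ≥0 → V)) j t).ncard ≤ 1),
    (t : ℝ≥0∞)

/-- The law of independent walks started from `x 0, x 1, …`. -/
def walksLaw {V : Type*} {k : ℕ} (P : V → Measure (StepPath V)) (x : Fin k → V) :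
    Measure (Fin k → StepPath V) :=
  Measure.pi fun i => P (x i)

/-! ### The mean-field law and the Wasserstein distance -/

/-- The law of `∑_{i ≥ 2} Z_i`, with `Z_i` independent exponential of rate `i.choose 2`
(`i = n + 2` below). -/
def meanFieldLaw : Measure ℝ :=
  (Measure.infinitePi fun n : ℕ => expMeasure ((n + 2).choose 2 : ℝ)).map
    fun z => ∑' n, z n

/-- The `L¹` Wasserstein distance `∫ |μ(x,∞) - ν(x,∞)| dx` of probability measures on `ℝ`. -/
def wassersteinDist (μ ν : Measure ℝ) : ℝ≥0∞ :=
  ∫⁻ x : ℝ, ENNReal.ofReal |μ.real (Ioi x) - ν.real (Ioi x)|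

end CoalescingWalks

end

open CoalescingWalks

/-! Once few walkers are left and the chain mixes much faster than walks meet, every pair of walkers
meets after a nearly exponential time of mean `m`, almost independently of the other pairs. The
number of walkers then behaves like a pure death chain with rate `k.choose 2 / m` from `k` to `k -
1`, whose absorption time is `m` times a sum of independent exponential times of means `1 / k.choose
2`.

The chain is observed along a grid, which gives a stochastic matrix `K`. Let `meet x y` be the mean
meeting time in steps; one free step from distinct sites lowers its mean by exactly one. If one of
the two walks is stationary, they meet within the mixing time `R` with probability at most `β = pm *
(1 + 2 * ρ * R)`. Hence `meet z y / m` is close to `1` in `L¹(π)` as a function of `y`, uniformly in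
`z`, with an error of order `β + δ` (`sum_abs_meet_sub_one_le`).

For stationary walkers, let all walks move independently for ever and record a set `A` of survivors.
A function `α` of the number of survivors is corrected by `(α k - α (k - 1)) * ∑ (meet / m - 1)`
over the surviving pairs (`corrected`). Between meetings its drift is exactly that of the death
chain. At a meeting `meet = 0`, so that the correction produces precisely the jump from `α k` to `α
(k - 1)`, and only the corrections of the other pairs are left as an error
(`abs_corrected_prune_sub_le`). Another pair contains a walker outside the meeting pair; this walker
is still stationary at the meeting, so each such error is `η` in mean, and a pair meets only once
(`sum_tupleMean_meet_le`). With the mean-field tail at the remaining time as test function, the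
drift cancels by the backward equation, and the tail for `k` stationary walkers is approximated
within `O(k ^ 4 * η * (1 + t / m))` (`abs_avg_twoInd_sub_le`).

Starting from all of `V`, groups of `k` walkers become nearly stationary after `R` steps and lose a
fixed fraction of their number within a time `4 * m / k`; monotonicity and subadditivity of the
coalescing flow on sets extend this to any number of walkers. After `O(log |V|)` rounds fewer than
`2 * k` walkers are left (`flowOp_pow_twoInd_le`). This takes time `O(m * log |V| / k)`. With `k` of
order `log |V| / ε` the delay is `O(ε * m)`, while the error `k ^ 4 * α * log (1 / α)` is of order
`ε ^ 2`; this is the source of the exponent `1 / 6`.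

Step paths have locally finitely many jumps, so coalescence and meeting along fine dyadic grids
converge to their continuous-time versions. The resulting tail error `ε ^ 2 * (2 + x)` is not
integrable, but both tails decay exponentially, and interpolating between the two bounds gives an
integrable error of order `ε` (`IsNearMeanField.abs_sub_le`). This yields the Wasserstein bound and
the bound on the mean. -/

noncomputable section

set_option linter.unusedSectionVars false

namespace CoalescingWalks

/-! ### Product averages -/

section Avg

variable {ι κ V : Type*} [Fintype ι] [DecidableEq ι] [Fintype κ] [DecidableEq κ] [Fintype V]
  [DecidableEq V]

/-- The mean of `F` under the product of the vectors `p i`. -/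
def avg (p : ι → V → ℝ) : ((ι → V) → ℝ) →ₗ[ℝ] ℝ where
  toFun F := ∑ y, (∏ i, p i (y i)) * F y
  map_add' F G := by simp [mul_add, Finset.sum_add_distrib]
  map_smul' c F := by
    simp only [Pi.smul_apply, smul_eq_mul, RingHom.id_apply, Finset.mul_sum]
    exact Finset.sum_congr rfl fun _ _ => by ring

theorem avg_apply (p : ι → V → ℝ) (F : (ι → V) → ℝ) :
    avg p F = ∑ y, (∏ i, p i (y i)) * F y := rfl

theorem avg_prod (p c : ι → V → ℝ) :
    avg p (fun y => ∏ i, c i (y i)) = ∏ i, ∑ v, p i v * c i v := by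
  rw [Fintype.prod_sum, avg_apply]
  exact Finset.sum_congr rfl fun y _ => Finset.prod_mul_distrib.symm

theorem avg_const {p : ι → V → ℝ} (hp : ∀ i, p i ∈ stdSimplex ℝ V) (c : ℝ) :
    avg p (fun _ => c) = c := by
  have h := avg_prod p (fun _ _ => 1)
  simp only [Finset.prod_const_one, mul_one, (hp _).2] at h
  have h2 : (fun _ : ι → V => c) = c • (fun _ : ι → V => (1 : ℝ)) := by ext; simp
  rw [h2, map_smul, h]; simp

theorem avg_mono {p : ι → V → ℝ} (hp : ∀ i, p i ∈ stdSimplex ℝ V) {F G : (ι → V) → ℝ}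
    (h : ∀ y, F y ≤ G y) : avg p F ≤ avg p G :=
  Finset.sum_le_sum fun y _ =>
    mul_le_mul_of_nonneg_left (h y) (Finset.prod_nonneg fun i _ => (hp i).1 _)

theorem avg_nonneg {p : ι → V → ℝ} (hp : ∀ i, p i ∈ stdSimplex ℝ V) {F : (ι → V) → ℝ}
    (h : ∀ y, 0 ≤ F y) : 0 ≤ avg p F :=
  Finset.sum_nonneg fun y _ => mul_nonneg (Finset.prod_nonneg fun i _ => (hp i).1 _) (h y)

theorem avg_le_const {p : ι → V → ℝ} (hp : ∀ i, p i ∈ stdSimplex ℝ V) {F : (ι → V) → ℝ} {c : ℝ}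
    (h : ∀ y, F y ≤ c) : avg p F ≤ c := (avg_mono hp h).trans_eq (avg_const hp c)

theorem abs_avg_le {p : ι → V → ℝ} (hp : ∀ i, p i ∈ stdSimplex ℝ V) (F : (ι → V) → ℝ) :
    |avg p F| ≤ avg p fun y => |F y| := by
  rw [avg_apply, avg_apply]
  refine (Finset.abs_sum_le_sum_abs _ _).trans (le_of_eq (Finset.sum_congr rfl fun y _ => ?_))
  rw [abs_mul, abs_of_nonneg (Finset.prod_nonneg fun i _ => (hp i).1 _)]

/-- Coordinates outside the range of `e` integrate to one. It suffices to treat indicators of single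
points, which are products of functions of one coordinate. -/
theorem avg_comp {p : ι → V → ℝ} (hp : ∀ i, p i ∈ stdSimplex ℝ V) {e : κ → ι}
    (he : Function.Injective e) (g : (κ → V) → ℝ) :
    avg p (fun y => g (fun k => y (e k))) = avg (fun k => p (e k)) g := by
  have key : ∀ z : κ → V, avg p (fun y => if (fun k => y (e k)) = z then (1 : ℝ) else 0)
      = ∏ k, p (e k) (z k) := by
    intro z
    have h1 : (fun y : ι → V => if (fun k => y (e k)) = z then (1 : ℝ) else 0)
        = fun y => ∏ i, (fun i v => if ∀ k, e k = i → v = z k then (1 : ℝ) else 0) i (y i) := by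
      ext y
      by_cases h : (fun k => y (e k)) = z
      · rw [if_pos h, Finset.prod_eq_one]
        rintro i -
        refine if_pos ?_
        rintro k rfl
        exact congrFun h k
      · rw [if_neg h]
        obtain ⟨k, hk⟩ : ∃ k, y (e k) ≠ z k := by
          by_contra hcon; push Not at hcon; exact h (funext hcon)
        exact (Finset.prod_eq_zero (Finset.mem_univ (e k))
          (if_neg fun hc => hk (hc k rfl))).symm
    rw [h1, avg_prod p (fun i v => if ∀ k, e k = i → v = z k then (1 : ℝ) else 0)]
    symm
    refine Fintype.prod_of_injective e he _ _ ?_ ?_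
    · intro i hi
      refine Eq.trans ?_ (hp i).2
      refine Finset.sum_congr rfl fun v _ => ?_
      rw [if_pos, mul_one]
      rintro k rfl
      exact absurd ⟨k, rfl⟩ hi
    · intro k
      rw [Finset.sum_eq_single (z k)]
      · rw [if_pos, mul_one]
        intro k' hk'
        rw [he hk']
      · intro v _ hv
        rw [if_neg fun hc => hv (hc k rfl), mul_zero]
      · simp
  have h2 : (fun y : ι → V => g (fun k => y (e k)))
      = ∑ z, g z • (fun y : ι → V => if (fun k => y (e k)) = z then (1 : ℝ) else 0) := by
    ext y
    simp
  rw [h2, map_sum, avg_apply]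
  refine Finset.sum_congr rfl fun z _ => ?_
  rw [map_smul, key, smul_eq_mul, mul_comm]

/-- The mean of `f` under the product of `p` and `q`. -/
def pairAvg (p q : V → ℝ) : (V → V → ℝ) →ₗ[ℝ] ℝ where
  toFun f := ∑ a, p a * ∑ b, q b * f a b
  map_add' F G := by simp [mul_add, Finset.sum_add_distrib]
  map_smul' c F := by
    simp only [Pi.smul_apply, smul_eq_mul, RingHom.id_apply, Finset.mul_sum]
    exact Finset.sum_congr rfl fun _ _ => Finset.sum_congr rfl fun _ _ => by ring

theorem pairAvg_apply (p q : V → ℝ) (f : V → V → ℝ) :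
    pairAvg p q f = ∑ a, p a * ∑ b, q b * f a b := rfl

theorem pairAvg_swap (p q : V → ℝ) (f : V → V → ℝ) :
    pairAvg p q f = pairAvg q p (fun a b => f b a) := by
  simp only [pairAvg_apply, Finset.mul_sum]
  rw [Finset.sum_comm]
  exact Finset.sum_congr rfl fun _ _ => Finset.sum_congr rfl fun _ _ => by ring

theorem pairAvg_mono {p q : V → ℝ} (hp : p ∈ stdSimplex ℝ V) (hq : q ∈ stdSimplex ℝ V)
    {f g : V → V → ℝ} (h : ∀ a b, f a b ≤ g a b) : pairAvg p q f ≤ pairAvg p q g :=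
  Finset.sum_le_sum fun a _ => mul_le_mul_of_nonneg_left
    (Finset.sum_le_sum fun b _ => mul_le_mul_of_nonneg_left (h a b) (hq.1 b)) (hp.1 a)

theorem pairAvg_const {p q : V → ℝ} (hp : p ∈ stdSimplex ℝ V) (hq : q ∈ stdSimplex ℝ V)
    (c : ℝ) : pairAvg p q (fun _ _ => c) = c := by
  rw [pairAvg_apply, ← Finset.sum_mul, ← Finset.sum_mul, hp.2, hq.2]; ring

theorem pairAvg_nonneg {p q : V → ℝ} (hp : p ∈ stdSimplex ℝ V) (hq : q ∈ stdSimplex ℝ V)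
    {f : V → V → ℝ} (h : ∀ a b, 0 ≤ f a b) : 0 ≤ pairAvg p q f :=
  (pairAvg_const hp hq 0).symm.trans_le (pairAvg_mono hp hq h)

theorem pairAvg_le_const {p q : V → ℝ} (hp : p ∈ stdSimplex ℝ V) (hq : q ∈ stdSimplex ℝ V)
    {f : V → V → ℝ} {c : ℝ} (h : ∀ a b, f a b ≤ c) : pairAvg p q f ≤ c :=
  (pairAvg_mono hp hq h).trans_eq (pairAvg_const hp hq c)

theorem avg_pair {p : ι → V → ℝ} (hp : ∀ i, p i ∈ stdSimplex ℝ V) {i j : ι} (hij : i ≠ j)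
    (g : V → V → ℝ) : avg p (fun y => g (y i) (y j)) = pairAvg (p i) (p j) g := by
  have he : Function.Injective (![i, j] : Fin 2 → ι) := by
    intro a b
    fin_cases a <;> fin_cases b <;> simp [hij, hij.symm]
  have h := avg_comp hp he (fun z => g (z 0) (z 1))
  simp only [Matrix.cons_val_zero, Matrix.cons_val_one] at h
  rw [h, avg_apply, pairAvg_apply, ← (finTwoArrowEquiv V).symm.sum_comp, Fintype.sum_prod_type]
  refine Finset.sum_congr rfl fun a _ => ?_
  rw [Finset.mul_sum]
  refine Finset.sum_congr rfl fun b _ => ?_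
  simp [Fin.prod_univ_two]
  ring

/-- A coordinate can be averaged out first. -/
theorem avg_update {p : ι → V → ℝ} (hp : ∀ i, p i ∈ stdSimplex ℝ V) (l : ι)
    (F : (ι → V) → ℝ) :
    avg p F = avg p fun x => ∑ v, p l v * F (Function.update x l v) := by
  have hw : ∀ (x : ι → V) (v : V), (∏ i, p i (x i)) * p l v
      = (∏ i, p i (Function.update x l v i)) * p l (x l) := by
    intro x v
    rw [← Finset.mul_prod_erase _ _ (Finset.mem_univ l),
      ← Finset.mul_prod_erase _ (fun i => p i (Function.update x l v i)) (Finset.mem_univ l)]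
    rw [Function.update_self]
    have : ∏ i ∈ Finset.univ.erase l, p i (Function.update x l v i)
        = ∏ i ∈ Finset.univ.erase l, p i (x i) :=
      Finset.prod_congr rfl fun i hi => by
        rw [Function.update_of_ne (Finset.ne_of_mem_erase hi)]
    rw [this]; ring
  have h1 : avg p F = ∑ z : (ι → V) × V, (∏ i, p i (z.1 i)) * p l z.2 * F z.1 := by
    rw [Fintype.sum_prod_type, avg_apply]
    refine Finset.sum_congr rfl fun x _ => ?_
    dsimp only
    rw [← Finset.sum_mul, ← Finset.mul_sum, (hp l).2, mul_one]
  have h2 : (avg p fun x => ∑ v, p l v * F (Function.update x l v))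
      = ∑ z : (ι → V) × V, (∏ i, p i (z.1 i)) * p l z.2 * F (Function.update z.1 l z.2) := by
    rw [Fintype.sum_prod_type, avg_apply]
    refine Finset.sum_congr rfl fun x _ => ?_
    rw [Finset.mul_sum]
    exact Finset.sum_congr rfl fun v _ => by ring
  rw [h1, h2]
  -- Exchanging `x l` with the fresh value `v` is an involution that preserves the product weight.
  refine Finset.sum_nbij' (fun z => (Function.update z.1 l z.2, z.1 l))
    (fun z => (Function.update z.1 l z.2, z.1 l)) (by simp) (by simp) (by simp) (by simp) ?_
  rintro ⟨x, v⟩ -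
  simp only [Function.update_idem, Function.update_eq_self]
  rw [hw x v]

theorem avg_avg (p : ι → V → ℝ) (q : ι → V → V → ℝ) (F : (ι → V) → ℝ) :
    avg p (fun x => avg (fun i => q i (x i)) F) = avg (fun i v => ∑ u, p i u * q i u v) F := by
  simp only [avg_apply, Finset.mul_sum]
  rw [Finset.sum_comm]
  refine Finset.sum_congr rfl fun y _ => ?_
  rw [Fintype.prod_sum, Finset.sum_mul]
  refine Finset.sum_congr rfl fun x _ => ?_
  rw [Finset.prod_mul_distrib]; ring

theorem pairAvg_pairAvg (p q : V → ℝ) (P Q : V → V → ℝ) (f : V → V → ℝ) :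
    pairAvg p q (fun a b => pairAvg (P a) (Q b) f)
      = pairAvg (fun v => ∑ u, p u * P u v) (fun v => ∑ u, q u * Q u v) f := by
  simp only [pairAvg_apply, Finset.mul_sum, Finset.sum_mul]
  have : ∀ (G : V → V → V → V → ℝ), (∑ a, ∑ b, ∑ c, ∑ d, G a b c d)
      = ∑ c, ∑ d, ∑ a, ∑ b, G a b c d := by
    intro G
    calc (∑ a, ∑ b, ∑ c, ∑ d, G a b c d) = ∑ a, ∑ c, ∑ b, ∑ d, G a b c d :=
          Finset.sum_congr rfl fun _ _ => Finset.sum_comm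
      _ = ∑ c, ∑ a, ∑ b, ∑ d, G a b c d := Finset.sum_comm
      _ = ∑ c, ∑ a, ∑ d, ∑ b, G a b c d :=
          Finset.sum_congr rfl fun _ _ => Finset.sum_congr rfl fun _ _ => Finset.sum_comm
      _ = _ := Finset.sum_congr rfl fun _ _ => Finset.sum_comm
  rw [this]
  refine Finset.sum_congr rfl fun c _ => Finset.sum_congr rfl fun d _ => ?_
  refine Finset.sum_comm.trans ?_
  refine Finset.sum_congr rfl fun _ _ => Finset.sum_congr rfl fun _ _ => by ring

/-- Comparison of product averages, coordinate by coordinate. -/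
theorem abs_avg_sub_avg_le {δ B : ℝ} : ∀ {k : ℕ} {p q : Fin k → V → ℝ},
    (∀ i, p i ∈ stdSimplex ℝ V) → (∀ i, q i ∈ stdSimplex ℝ V) →
    (∀ i, ∀ f : V → ℝ, (∀ v, 0 ≤ f v ∧ f v ≤ B) → |∑ v, p i v * f v - ∑ v, q i v * f v| ≤ δ * B) →
    ∀ F : (Fin k → V) → ℝ, (∀ y, 0 ≤ F y ∧ F y ≤ B) → |avg p F - avg q F| ≤ k * δ * B := by
  intro k
  induction k with
  | zero =>
    intro p q _ _ _ F _
    simp [avg_apply]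
  | succ k ih =>
    intro p q hp hq hd F hF
    have hcons : ∀ p : Fin (k + 1) → V → ℝ, avg p F
        = ∑ v, p 0 v * avg (fun i => p i.succ) (fun y => F (Fin.cons v y)) := by
      intro p
      rw [avg_apply, ← (Fin.consEquiv fun _ => V).sum_comp, Fintype.sum_prod_type]
      refine Finset.sum_congr rfl fun v _ => ?_
      rw [avg_apply, Finset.mul_sum]
      refine Finset.sum_congr rfl fun y _ => ?_
      simp [Fin.consEquiv, Fin.prod_univ_succ, mul_assoc]
    have h1 : ∀ v, |avg (fun i => p i.succ) (fun y => F (Fin.cons v y))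
        - avg (fun i => q i.succ) (fun y => F (Fin.cons v y))| ≤ k * δ * B := fun v =>
      ih (fun i => hp _) (fun i => hq _) (fun i => hd _) _ (fun y => hF _)
    have h2 := hd 0 (fun v => avg (fun i => q i.succ) (fun y => F (Fin.cons v y)))
      (fun v => ⟨avg_nonneg (fun i => hq _) fun y => (hF _).1,
        avg_le_const (fun i => hq _) fun y => (hF _).2⟩)
    rw [hcons p, hcons q]
    have h3 : |∑ v, p 0 v * avg (fun i => p i.succ) (fun y => F (Fin.cons v y))
        - ∑ v, p 0 v * avg (fun i => q i.succ) (fun y => F (Fin.cons v y))| ≤ k * δ * B := by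
      rw [← Finset.sum_sub_distrib]
      refine (Finset.abs_sum_le_sum_abs _ _).trans ?_
      calc _ ≤ ∑ v, p 0 v * (k * δ * B) := Finset.sum_le_sum fun v _ => by
            rw [← mul_sub, abs_mul, abs_of_nonneg ((hp 0).1 v)]
            exact mul_le_mul_of_nonneg_left (h1 v) ((hp 0).1 v)
        _ = _ := by rw [← Finset.sum_mul, (hp 0).2, one_mul]
    push_cast
    calc _ ≤ _ := abs_sub_le _ _ _
      _ ≤ k * δ * B + δ * B := add_le_add h3 h2
      _ = _ := by ring

theorem abs_pairAvg_sub_le {δ B : ℝ} {p q p' q' : V → ℝ}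
    (hp : p ∈ stdSimplex ℝ V) (hq' : q' ∈ stdSimplex ℝ V)
    (h1 : ∀ f : V → ℝ, (∀ v, 0 ≤ f v ∧ f v ≤ B) → |∑ v, p v * f v - ∑ v, p' v * f v| ≤ δ * B)
    (h2 : ∀ f : V → ℝ, (∀ v, 0 ≤ f v ∧ f v ≤ B) → |∑ v, q v * f v - ∑ v, q' v * f v| ≤ δ * B)
    {f : V → V → ℝ} (hf : ∀ a b, 0 ≤ f a b ∧ f a b ≤ B) :
    |pairAvg p q f - pairAvg p' q' f| ≤ 2 * δ * B := by
  have a1 : |pairAvg p q f - pairAvg p q' f| ≤ δ * B := by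
    rw [pairAvg_apply, pairAvg_apply, ← Finset.sum_sub_distrib]
    refine (Finset.abs_sum_le_sum_abs _ _).trans ?_
    calc _ ≤ ∑ v, p v * (δ * B) := Finset.sum_le_sum fun v _ => by
          rw [← mul_sub, abs_mul, abs_of_nonneg (hp.1 v)]
          exact mul_le_mul_of_nonneg_left (h2 _ (hf v)) (hp.1 v)
      _ = _ := by rw [← Finset.sum_mul, hp.2, one_mul]
  have a2 : |pairAvg p q' f - pairAvg p' q' f| ≤ δ * B := by
    refine h1 (fun a => ∑ b, q' b * f a b) fun a => ⟨Finset.sum_nonneg fun b _ =>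
      mul_nonneg (hq'.1 b) (hf a b).1, ?_⟩
    calc _ ≤ ∑ b, q' b * B := Finset.sum_le_sum fun b _ =>
          mul_le_mul_of_nonneg_left (hf a b).2 (hq'.1 b)
      _ = B := by rw [← Finset.sum_mul, hq'.2, one_mul]
  calc _ ≤ _ := abs_sub_le _ (pairAvg p q' f) _
    _ ≤ δ * B + δ * B := add_le_add a1 a2
    _ = _ := by ring

end Avg

/-! ### Meeting of two discrete-time walks -/

section Pair

variable {V : Type*} [Fintype V] [DecidableEq V]

/-- The `n`-step transition probabilities. -/
def kpow (K : V → V → ℝ) : ℕ → V → V → ℝ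
  | 0 => fun x y => if x = y then 1 else 0
  | n + 1 => fun x y => ∑ u, K x u * kpow K n u y

/-- A stochastic matrix `K` with stationary distribution `π ≤ pm`, jump probabilities at most `ρ`,
which is `δ`-mixed after `R` steps. -/
structure IsMixingKernel (K : V → V → ℝ) (π : V → ℝ) (pm ρ δ : ℝ) (R : ℕ) : Prop where
  stoch : ∀ x, K x ∈ stdSimplex ℝ V
  prob : π ∈ stdSimplex ℝ V
  stat : ∀ y, ∑ x, π x * K x y = π y
  le_pm : ∀ y, π y ≤ pm
  jump : ∀ x, 1 - K x x ≤ ρ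
  mix : ∀ (x : V) (B : ℝ) (f : V → ℝ), (∀ v, 0 ≤ f v ∧ f v ≤ B) →
    |∑ y, (kpow K R) x y * f y - ∑ y, π y * f y| ≤ δ * B

/-- The probability that walks from `x` and `y` do not meet up to time `n`. -/
def surv (K : V → V → ℝ) : ℕ → V → V → ℝ
  | 0 => fun x y => if x = y then 0 else 1
  | n + 1 => fun x y => if x = y then 0 else pairAvg (K x) (K y) (surv K n)

/-- The mean meeting time, in steps, of walks from `x` and `y`. -/
def meet (K : V → V → ℝ) (x y : V) : ℝ := ∑' n, surv K n x y

/-- The mean meeting time, in steps, of two walks started from `π`. -/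
def meanMeet (K : V → V → ℝ) (π : V → ℝ) : ℝ := pairAvg π π (meet K)

theorem pow_stoch {K : V → V → ℝ} (hK : ∀ x, K x ∈ stdSimplex ℝ V) (n : ℕ) (x : V) :
    (kpow K n) x ∈ stdSimplex ℝ V := by
  induction n generalizing x with
  | zero =>
    refine ⟨fun y => ?_, ?_⟩
    · simp only [kpow]; split_ifs <;> norm_num
    · simp [kpow]
  | succ n ih =>
    refine ⟨fun y => ?_, ?_⟩
    · simp only [kpow]
      exact Finset.sum_nonneg fun u _ => mul_nonneg ((hK x).1 u) ((ih u).1 y)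
    · simp only [kpow]
      rw [Finset.sum_comm]
      simp only [← Finset.mul_sum, (ih _).2, mul_one, (hK x).2]

theorem pairAvg_pow_succ (K : V → V → ℝ) (n : ℕ) (x y : V) (f : V → V → ℝ) :
    pairAvg ((kpow K (n + 1)) x) ((kpow K (n + 1)) y) f
      = pairAvg (K x) (K y) (fun a b => pairAvg ((kpow K n) a) ((kpow K n) b) f) := by
  rw [pairAvg_pairAvg]; rfl

theorem pairAvg_pow_zero (K : V → V → ℝ) (x y : V) (f : V → V → ℝ) :
    pairAvg ((kpow K 0) x) ((kpow K 0) y) f = f x y := by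
  simp [pairAvg_apply, kpow]

section Stochastic

variable {K : V → V → ℝ} (hK : ∀ x, K x ∈ stdSimplex ℝ V)
include hK

theorem surv_nonneg (n : ℕ) (x y : V) : 0 ≤ surv K n x y := by
  induction n generalizing x y with
  | zero => simp only [surv]; split_ifs <;> norm_num
  | succ n ih =>
    simp only [surv]; split_ifs
    · exact le_rfl
    · exact pairAvg_nonneg (hK x) (hK y) ih

theorem surv_le_one (n : ℕ) (x y : V) : surv K n x y ≤ 1 := by
  induction n generalizing x y with
  | zero => simp only [surv]; split_ifs <;> norm_num
  | succ n ih =>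
    simp only [surv]; split_ifs
    · exact zero_le_one
    · exact pairAvg_le_const (hK x) (hK y) ih

end Stochastic

theorem surv_self (K : V → V → ℝ) (n : ℕ) (x : V) : surv K n x x = 0 := by
  cases n <;> simp [surv]

theorem surv_symm (K : V → V → ℝ) (n : ℕ) (x y : V) : surv K n x y = surv K n y x := by
  induction n generalizing x y with
  | zero => simp only [surv, eq_comm]
  | succ n ih =>
    simp only [surv, eq_comm (a := x)]
    rw [pairAvg_swap]
    simp only [ih]

theorem meet_symm (K : V → V → ℝ) (x y : V) : meet K x y = meet K y x := by
  simp only [meet, surv_symm K _ x y]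

theorem meet_self (K : V → V → ℝ) (x : V) : meet K x x = 0 := by
  simp [meet, surv_self]

theorem sum_mul_pairAvg (π p : V → ℝ) (Q : V → V → ℝ) (f : V → V → ℝ) :
    ∑ y, π y * pairAvg p (Q y) f = pairAvg p (fun b => ∑ y, π y * Q y b) f := by
  simp only [pairAvg_apply, Finset.mul_sum, Finset.sum_mul]
  rw [Finset.sum_comm]
  refine Finset.sum_congr rfl fun a _ => ?_
  rw [Finset.sum_comm]
  exact Finset.sum_congr rfl fun _ _ => Finset.sum_congr rfl fun _ _ => by ring

variable {K : V → V → ℝ} {π : V → ℝ} {pm ρ δ : ℝ} {R : ℕ}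
  (hC : IsMixingKernel K π pm ρ δ R)
include hC

namespace IsMixingKernel

theorem nonempty : Nonempty V := by
  by_contra h
  rw [not_nonempty_iff] at h
  simpa using hC.prob.2

theorem pm_nonneg : 0 ≤ pm := by
  obtain ⟨x⟩ := hC.nonempty
  exact (hC.prob.1 x).trans (hC.le_pm x)

theorem pm_pos : 0 < pm := by
  refine hC.pm_nonneg.lt_of_ne fun h => ?_
  have : ∑ x, π x ≤ 0 := Finset.sum_nonpos fun x _ => (hC.le_pm x).trans_eq h.symm
  rw [hC.prob.2] at this
  linarith

theorem rho_nonneg : 0 ≤ ρ := by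
  obtain ⟨x⟩ := hC.nonempty
  have h1 : K x x ≤ 1 := by
    rw [← (hC.stoch x).2]
    exact Finset.single_le_sum (fun y _ => (hC.stoch x).1 y) (Finset.mem_univ x)
  linarith [hC.jump x]

theorem stat_pow (n : ℕ) (y : V) : ∑ x, π x * (kpow K n) x y = π y := by
  induction n generalizing y with
  | zero => simp [kpow]
  | succ n ih =>
    simp only [kpow, Finset.mul_sum]
    rw [Finset.sum_comm]
    conv_rhs => rw [← ih y]
    refine Finset.sum_congr rfl fun u _ => ?_
    rw [← hC.stat u, Finset.sum_mul]
    exact Finset.sum_congr rfl fun _ _ => by ring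

/-- The probability that two walks meet by time `n`, one of them being stationary. -/
theorem sum_one_sub_surv_le (n : ℕ) (z : V) :
    ∑ y, π y * (1 - surv K n z y) ≤ pm * (1 + 2 * ρ * n) := by
  set D : V → V → ℝ := fun x y => if x = y then 1 else 0 with hD
  -- The probability that a pair at distinct sites meets in the next step. By a union bound, a
  -- meeting up to time `n` is a coincidence at time zero or such a step at some time `j < n`.
  set e : V → V → ℝ := fun x y => if x = y then 0 else pairAvg (K x) (K y) D with he
  have hD0 : ∀ a b, 0 ≤ D a b := fun a b => by simp only [hD]; split_ifs <;> norm_num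
  have he0 : ∀ a b, 0 ≤ e a b := fun a b => by
    simp only [he]; split_ifs
    · exact le_rfl
    · exact pairAvg_nonneg (hC.stoch _) (hC.stoch _) hD0
  have hpow := pow_stoch hC.stoch
  have h1 : ∀ n x y, 1 - surv K n x y
      ≤ D x y + ∑ j ∈ Finset.range n, pairAvg ((kpow K j) x) ((kpow K j) y) e := by
    intro n
    induction n with
    | zero =>
      intro x y
      simp only [surv, hD, Finset.range_zero, Finset.sum_empty]
      split_ifs <;> norm_num
    | succ n ih =>
      intro x y
      have hnn : 0 ≤ ∑ j ∈ Finset.range n, pairAvg ((kpow K (j + 1)) x) ((kpow K (j + 1)) y) e :=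
        Finset.sum_nonneg fun j _ => pairAvg_nonneg (hpow _ _) (hpow _ _) he0
      rw [Finset.sum_range_succ', pairAvg_pow_zero]
      by_cases hxy : x = y
      · simp only [surv, hxy, if_true, hD, sub_zero]
        rw [hxy] at hnn
        linarith [he0 y y]
      · have h2 : 1 - surv K (n + 1) x y
            = pairAvg (K x) (K y) (fun a b => 1 - surv K n a b) := by
          simp only [surv, hxy, if_false]
          conv_lhs => rw [← pairAvg_const (hC.stoch x) (hC.stoch y) 1, ← map_sub]
          rfl
        have h3 := pairAvg_mono (hC.stoch x) (hC.stoch y) ih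
        have h4 : pairAvg (K x) (K y) (fun a b => D a b
            + ∑ j ∈ Finset.range n, pairAvg ((kpow K j) a) ((kpow K j) b) e)
            = e x y + ∑ j ∈ Finset.range n, pairAvg ((kpow K (j + 1)) x) ((kpow K (j + 1)) y) e := by
          have : (fun a b => D a b + ∑ j ∈ Finset.range n, pairAvg ((kpow K j) a) ((kpow K j) b) e)
              = D + ∑ j ∈ Finset.range n, fun a b => pairAvg ((kpow K j) a) ((kpow K j) b) e := by
            ext a b; simp
          rw [this, map_add, map_sum]
          simp only [pairAvg_pow_succ, he, hxy, if_false]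
        rw [h2]
        linarith [hD0 x y]
  -- Either `x` stays and `y` jumps to it, where stationarity makes the flux into `x` equal to `π x
  -- * (1 - K x x)`, or `x` jumps to some `w` at which `y` lands, with stationary probability `π w`.
  -- Each case costs at most `ρ * pm`.
  have h2 : ∀ x, ∑ y, π y * e x y ≤ 2 * ρ * pm := by
    intro x
    have hinner : ∀ y, pairAvg (K x) (K y) D = ∑ w, K x w * K y w := by
      intro y; simp [pairAvg_apply, hD]
    have hsx : K x x + ∑ w ∈ Finset.univ.erase x, K x w = 1 := by
      rw [Finset.add_sum_erase _ _ (Finset.mem_univ x), (hC.stoch x).2]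
    have hle : ∀ y, π y * e x y ≤ (if x = y then 0 else π y * K y x)
        + ∑ w ∈ Finset.univ.erase x, K x w * (π y * K y w) := by
      intro y
      have hnn : 0 ≤ ∑ w ∈ Finset.univ.erase x, K x w * (π y * K y w) :=
        Finset.sum_nonneg fun w _ => mul_nonneg ((hC.stoch x).1 w)
          (mul_nonneg (hC.prob.1 y) ((hC.stoch y).1 w))
      by_cases hxy : x = y
      · simp only [he, hxy, if_true, mul_zero]
        rw [hxy] at hnn; simpa using hnn
      · simp only [he, hxy, if_false]
        rw [hinner, ← Finset.add_sum_erase _ _ (Finset.mem_univ x), mul_add, Finset.mul_sum]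
        refine add_le_add ?_ (le_of_eq (Finset.sum_congr rfl fun w _ => by ring))
        have hk1 : K x x ≤ 1 := by
          linarith [Finset.sum_nonneg (s := Finset.univ.erase x) fun w _ => (hC.stoch x).1 w]
        have := mul_nonneg (hC.prob.1 y) ((hC.stoch y).1 x)
        nlinarith
    calc ∑ y, π y * e x y ≤ _ := Finset.sum_le_sum fun y _ => hle y
      _ = (∑ y, if x = y then 0 else π y * K y x)
          + ∑ w ∈ Finset.univ.erase x, K x w * π w := by
        rw [Finset.sum_add_distrib, Finset.sum_comm]
        congr 1
        refine Finset.sum_congr rfl fun w _ => ?_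
        rw [← Finset.mul_sum, hC.stat]
      _ = π x * (1 - K x x) + ∑ w ∈ Finset.univ.erase x, K x w * π w := by
        congr 1
        have h5 : ∑ y, (if x = y then 0 else π y * K y x)
            = ∑ y, π y * K y x - π x * K x x := by
          rw [← Finset.add_sum_erase _ (fun y => π y * K y x) (Finset.mem_univ x),
            ← Finset.add_sum_erase _ _ (Finset.mem_univ x)]
          simp only [if_true, zero_add, add_sub_cancel_left]
          exact Finset.sum_congr rfl fun y hy => by
            rw [if_neg (Finset.ne_of_mem_erase hy).symm]
        rw [h5, hC.stat]; ring
      _ ≤ pm * ρ + ∑ w ∈ Finset.univ.erase x, K x w * pm := by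
        refine add_le_add (mul_le_mul (hC.le_pm x) (hC.jump x) ?_ hC.pm_nonneg)
          (Finset.sum_le_sum fun w _ =>
            mul_le_mul_of_nonneg_left (hC.le_pm w) ((hC.stoch x).1 w))
        linarith [Finset.sum_nonneg (s := Finset.univ.erase x) fun w _ => (hC.stoch x).1 w]
      _ ≤ 2 * ρ * pm := by
        rw [← Finset.sum_mul]
        have := mul_le_mul_of_nonneg_right (hC.jump x) hC.pm_nonneg
        rw [eq_sub_of_add_eq' hsx]
        linarith
  calc ∑ y, π y * (1 - surv K n z y)
      ≤ ∑ y, π y * (D z y + ∑ j ∈ Finset.range n, pairAvg ((kpow K j) z) ((kpow K j) y) e) :=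
        Finset.sum_le_sum fun y _ => mul_le_mul_of_nonneg_left (h1 n z y) (hC.prob.1 y)
    _ = π z + ∑ j ∈ Finset.range n, pairAvg ((kpow K j) z) π e := by
        simp only [mul_add, Finset.sum_add_distrib, Finset.mul_sum]
        rw [Finset.sum_comm]
        congr 1
        · simp [hD]
        · refine Finset.sum_congr rfl fun j _ => ?_
          rw [sum_mul_pairAvg]
          congr 2
          ext b
          exact hC.stat_pow j b
    _ ≤ pm + ∑ j ∈ Finset.range n, 2 * ρ * pm := by
        refine add_le_add (hC.le_pm z) (Finset.sum_le_sum fun j _ => ?_)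
        rw [pairAvg_apply]
        calc _ ≤ ∑ a, (kpow K j) z a * (2 * ρ * pm) := Finset.sum_le_sum fun a _ =>
              mul_le_mul_of_nonneg_left (h2 a) ((hpow j z).1 a)
          _ = _ := by rw [← Finset.sum_mul, (hpow j z).2, one_mul]
    _ = _ := by simp; ring

/-- If two walks could not be together at time `R`, their laws at that time would have disjoint
supports. The indicator of one support would then have means `1` and `0`, both within `δ < 1 / 2` of
its mean under `π`. -/
theorem surv_lt_one (hδ : δ < 1 / 2) (x y : V) : surv K R x y < 1 := by
  have hpow := pow_stoch hC.stoch
  have h1 : ∀ n x y, surv K n x y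
      ≤ pairAvg ((kpow K n) x) ((kpow K n) y) (fun a b => if a = b then 0 else 1) := by
    intro n
    induction n with
    | zero => intro x y; rw [pairAvg_pow_zero]; exact le_rfl
    | succ n ih =>
      intro x y
      rw [pairAvg_pow_succ]
      simp only [surv]
      split_ifs
      · exact pairAvg_nonneg (hC.stoch _) (hC.stoch _) fun a b =>
          pairAvg_nonneg (hpow _ _) (hpow _ _) fun a b => by split_ifs <;> norm_num
      · exact pairAvg_mono (hC.stoch _) (hC.stoch _) ih
  refine (h1 R x y).trans_lt ?_
  have h2 : pairAvg ((kpow K R) x) ((kpow K R) y) (fun a b => if a = b then 0 else 1)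
      = 1 - ∑ z, (kpow K R) x z * (kpow K R) y z := by
    have : (fun a b : V => if a = b then (0 : ℝ) else 1)
        = (fun _ _ => 1) - fun a b => if a = b then 1 else 0 := by
      ext a b; simp only [Pi.sub_apply]; split_ifs <;> norm_num
    rw [this, map_sub, pairAvg_const (hpow _ _) (hpow _ _)]
    simp [pairAvg_apply]
  rw [h2]
  have hnn : ∀ z, 0 ≤ (kpow K R) x z * (kpow K R) y z := fun z =>
    mul_nonneg ((hpow R x).1 z) ((hpow R y).1 z)
  suffices 0 < ∑ z, (kpow K R) x z * (kpow K R) y z by linarith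
  refine (Finset.sum_nonneg fun z _ => hnn z).lt_of_ne fun h0 => ?_
  have h3 : ∀ z, (kpow K R) x z * (kpow K R) y z = 0 := fun z =>
    (Finset.sum_eq_zero_iff_of_nonneg fun z _ => hnn z).1 h0.symm z (Finset.mem_univ z)
  set f : V → ℝ := fun z => if (kpow K R) x z = 0 then 0 else 1 with hf
  have hf01 : ∀ v, 0 ≤ f v ∧ f v ≤ 1 := fun v => by simp only [hf]; split_ifs <;> norm_num
  have e1 := hC.mix x 1 f hf01
  have e2 := hC.mix y 1 f hf01
  have e3 : ∑ z, (kpow K R) x z * f z = 1 := by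
    rw [← (hpow R x).2]
    refine Finset.sum_congr rfl fun z _ => ?_
    simp only [hf]; split_ifs with h
    · rw [h]; ring
    · ring
  have e4 : ∑ z, (kpow K R) y z * f z = 0 := by
    refine Finset.sum_eq_zero fun z _ => ?_
    simp only [hf]; split_ifs with h
    · ring
    · rw [(mul_eq_zero.1 (h3 z)).resolve_left h]; ring
  rw [e3] at e1
  rw [e4] at e2
  have := abs_le.1 e1
  have := abs_le.1 e2
  linarith [this.1]

/-- Every block of `R` steps multiplies the survival probability by at most `θ < 1`, the largest
value of `surv K R`. A partial sum is therefore at most `R` plus `θ` times itself. -/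
theorem summable_surv (hδ : δ < 1 / 2) (x y : V) : Summable fun n => surv K n x y := by
  have := hC.nonempty
  obtain ⟨z, hz⟩ := Finite.exists_max (fun z : V × V => surv K R z.1 z.2)
  have hpow := pow_stoch hC.stoch
  set θ := surv K R z.1 z.2 with hθ
  have hθ1 : θ < 1 := hC.surv_lt_one hδ _ _
  have hθ0 : 0 ≤ θ := surv_nonneg hC.stoch _ _ _
  have h1 : ∀ n x y, surv K (n + R) x y ≤ θ * surv K n x y := by
    intro n
    induction n with
    | zero =>
      intro x y
      rw [zero_add]
      by_cases hxy : x = y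
      · rw [hxy, surv_self, surv_self, mul_zero]
      · simpa [surv, hxy] using hz (x, y)
    | succ n ih =>
      intro x y
      rw [add_right_comm]
      simp only [surv]
      split_ifs
      · simp
      · rw [← smul_eq_mul, ← map_smul]
        exact pairAvg_mono (hC.stoch _) (hC.stoch _) ih
  refine summable_of_sum_range_le (c := R / (1 - θ)) (fun n => surv_nonneg hC.stoch _ _ _) ?_
  intro n
  rw [le_div_iff₀ (by linarith)]
  have h2 : ∑ i ∈ Finset.range n, surv K i x y ≤ ∑ i ∈ Finset.range (R + n), surv K i x y :=
    Finset.sum_le_sum_of_subset_of_nonneg (Finset.range_mono (by omega))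
      fun i _ _ => surv_nonneg hC.stoch _ _ _
  rw [Finset.sum_range_add] at h2
  have h3 : ∑ i ∈ Finset.range R, surv K i x y ≤ R := by
    calc _ ≤ ∑ i ∈ Finset.range R, (1 : ℝ) :=
          Finset.sum_le_sum fun i _ => surv_le_one hC.stoch _ _ _
      _ = R := by simp
  have h4 : ∑ i ∈ Finset.range n, surv K (R + i) x y
      ≤ θ * ∑ i ∈ Finset.range n, surv K i x y := by
    rw [Finset.mul_sum]
    exact Finset.sum_le_sum fun i _ => by rw [add_comm]; exact h1 i x y
  linarith

theorem meet_nonneg (x y : V) : 0 ≤ meet K x y := tsum_nonneg fun n => surv_nonneg hC.stoch n x y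

/-- First-step decomposition. Distinct sites are required, because `meet` vanishes on the diagonal
while its mean after a free step need not. -/
theorem pairAvg_meet (hδ : δ < 1 / 2) {x y : V} (hxy : x ≠ y) :
    pairAvg (K x) (K y) (meet K) = meet K x y - 1 := by
  have hs := hC.summable_surv hδ
  have h1 : meet K x y = surv K 0 x y + ∑' n, surv K (n + 1) x y := (hs x y).tsum_eq_zero_add
  have h2 : HasSum (fun n => pairAvg (K x) (K y) (surv K n)) (pairAvg (K x) (K y) (meet K)) := by
    simp only [pairAvg_apply]
    exact hasSum_sum fun a _ => (hasSum_sum fun b _ => (hs a b).hasSum.mul_left _).mul_left _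
  have h3 : ∀ n, surv K (n + 1) x y = pairAvg (K x) (K y) (surv K n) := fun n => by
    simp [surv, hxy]
  rw [h1]
  simp only [h3, h2.tsum_eq]
  simp [surv, hxy]

/-- Along free walks the mean of `meet` drops by exactly one in a step off the diagonal, and it
cannot drop on the diagonal, where it is zero. -/
theorem pairAvg_pow_meet_ge (hδ : δ < 1 / 2) (n : ℕ) (x y : V) :
    meet K x y - n ≤ pairAvg ((kpow K n) x) ((kpow K n) y) (meet K) := by
  induction n generalizing x y with
  | zero => rw [pairAvg_pow_zero]; simp
  | succ n ih =>
    rw [pairAvg_pow_succ]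
    by_cases hxy : x = y
    · have := pairAvg_nonneg (hC.stoch x) (hC.stoch y) fun a b =>
        pairAvg_nonneg (pow_stoch hC.stoch n a) (pow_stoch hC.stoch n b) hC.meet_nonneg
      refine le_trans ?_ this
      rw [hxy, meet_self]
      have : (0 : ℝ) ≤ ((n + 1 : ℕ) : ℝ) := Nat.cast_nonneg _
      linarith
    · have h := pairAvg_mono (hC.stoch x) (hC.stoch y) ih
      have h2 : pairAvg (K x) (K y) (fun a b => meet K a b - n) = meet K x y - 1 - n := by
        rw [← hC.pairAvg_meet hδ hxy]
        conv_rhs => rw [← pairAvg_const (hC.stoch x) (hC.stoch y) (n : ℝ), ← map_sub]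
        rfl
      rw [h2] at h
      push_cast
      linarith

/-- Before the first meeting `meet` decreases in mean, and after a meeting it is at most `B`. -/
theorem pairAvg_pow_meet_le (hδ : δ < 1 / 2) {B : ℝ} (hB : ∀ x y, meet K x y ≤ B) (n : ℕ)
    (x y : V) : pairAvg ((kpow K n) x) ((kpow K n) y) (meet K)
      ≤ meet K x y + B * (1 - surv K n x y) := by
  obtain ⟨x₀⟩ := hC.nonempty
  have hB0 : 0 ≤ B := (hC.meet_nonneg x₀ x₀).trans (hB x₀ x₀)
  induction n generalizing x y with
  | zero =>
    rw [pairAvg_pow_zero]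
    have := mul_nonneg hB0 (sub_nonneg.2 (surv_le_one hC.stoch 0 x y))
    linarith
  | succ n ih =>
    by_cases hxy : x = y
    · rw [hxy, meet_self, surv_self]
      have := pairAvg_le_const (pow_stoch hC.stoch (n + 1) y) (pow_stoch hC.stoch (n + 1) y) hB
      linarith
    · rw [pairAvg_pow_succ]
      have h := pairAvg_mono (hC.stoch x) (hC.stoch y) ih
      have h2 : pairAvg (K x) (K y) (fun a b => meet K a b + B * (1 - surv K n a b))
          = meet K x y - 1 + B * (1 - surv K (n + 1) x y) := by
        rw [← hC.pairAvg_meet hδ hxy]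
        simp only [surv, hxy, if_false]
        conv_rhs => rw [← pairAvg_const (hC.stoch x) (hC.stoch y) (1 : ℝ), ← map_sub,
          ← smul_eq_mul, ← map_smul, ← map_add]
        rfl
      rw [h2] at h
      linarith

/-- At a maximizing pair with value `B`, running the free walks for `R` steps loses at most `R` and
leads to a nearly stationary pair, so that `B ≤ R + meanMeet K π + 2 * δ * B`. -/
theorem meet_le (hδ : δ < 1 / 2) (x y : V) :
    meet K x y ≤ (meanMeet K π + R) / (1 - 2 * δ) := by
  have := hC.nonempty
  obtain ⟨z, hz⟩ := Finite.exists_max (fun z : V × V => meet K z.1 z.2)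
  set B := meet K z.1 z.2 with hB
  refine (hz (x, y)).trans ?_
  rw [le_div_iff₀ (by linarith)]
  have h1 := hC.pairAvg_pow_meet_ge hδ R z.1 z.2
  have h2 := abs_pairAvg_sub_le (δ := δ) (B := B) (f := meet K) (pow_stoch hC.stoch R z.1) hC.prob
    (hC.mix z.1 B) (hC.mix z.2 B) (fun a b => ⟨hC.meet_nonneg a b, hz (a, b)⟩)
  have h3 := (abs_le.1 h2).2
  have h4 : meanMeet K π = pairAvg π π (meet K) := rfl
  rw [← h4] at h3
  linarith

theorem meanMeet_nonneg : 0 ≤ meanMeet K π := pairAvg_nonneg hC.prob hC.prob hC.meet_nonneg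

/-- A meeting within `j` mixing periods has probability at most `j * β`, so about `1 / (2 * β)`
periods pass without a meeting with probability at least `1 / 2`. Hence the mean meeting time is at
least a multiple of `R / β`. -/
theorem le_meanMeet (hδ : δ < 1 / 2) (hβ : pm * (1 + 2 * ρ * R) ≤ 1 / 2) :
    (R : ℝ) ≤ 8 * (pm * (1 + 2 * ρ * R)) * meanMeet K π := by
  set β := pm * (1 + 2 * ρ * R) with hβdef
  have hpm := hC.pm_pos
  have hρ := hC.rho_nonneg
  have hβ0 : 0 < β := by positivity
  set j := ⌊1 / (2 * β)⌋₊ with hj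
  have hj1 : 1 ≤ j := by
    rw [hj, Nat.one_le_floor_iff, le_div_iff₀ (by positivity)]
    linarith
  have hjle : (j : ℝ) ≤ 1 / (2 * β) := Nat.floor_le (by positivity)
  have hjlt : 1 / (2 * β) < j + 1 := Nat.lt_floor_add_one _
  have hjβ : j * β ≤ 1 / 2 := by
    rw [le_div_iff₀ (by positivity)] at hjle; linarith
  have hjβ' : 1 / 4 ≤ j * β := by
    rw [div_lt_iff₀ (by positivity)] at hjlt
    have : (1 : ℝ) ≤ j := by exact_mod_cast hj1
    nlinarith
  have h1 : ∀ n ∈ Finset.range (R * j), 1 / 2 ≤ pairAvg π π (surv K n) := by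
    intro n hn
    have hn' : (n : ℝ) ≤ R * j := by exact_mod_cast (Finset.mem_range.1 hn).le
    have hz : ∀ z, 1 / 2 ≤ ∑ y, π y * surv K n z y := by
      intro z
      have h := hC.sum_one_sub_surv_le n z
      simp only [mul_sub, mul_one, Finset.sum_sub_distrib, hC.prob.2] at h
      have h' : pm * (1 + 2 * ρ * n) ≤ j * β := by
        rw [hβdef]
        have e1 : 2 * ρ * n ≤ 2 * ρ * (R * j) := mul_le_mul_of_nonneg_left hn' (by positivity)
        have e2 : (1 : ℝ) ≤ j := by exact_mod_cast hj1
        nlinarith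
      linarith
    rw [pairAvg_apply]
    calc (1 / 2 : ℝ) = ∑ a, π a * (1 / 2) := by rw [← Finset.sum_mul, hC.prob.2, one_mul]
      _ ≤ _ := Finset.sum_le_sum fun a _ => mul_le_mul_of_nonneg_left (hz a) (hC.prob.1 a)
  have h2 : ∑ n ∈ Finset.range (R * j), pairAvg π π (surv K n) ≤ meanMeet K π := by
    rw [← map_sum]
    refine pairAvg_mono hC.prob hC.prob fun a b => ?_
    rw [Finset.sum_apply, Finset.sum_apply]
    exact (hC.summable_surv hδ a b).sum_le_tsum _ fun i _ => surv_nonneg hC.stoch _ _ _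
  have h3 : (R * j : ℝ) / 2 ≤ meanMeet K π := by
    refine le_trans ?_ h2
    calc (R * j : ℝ) / 2 = ∑ n ∈ Finset.range (R * j), (1 / 2 : ℝ) := by
          rw [Finset.sum_const, Finset.card_range, nsmul_eq_mul]; push_cast; ring
      _ ≤ _ := Finset.sum_le_sum h1
  have hR : (0 : ℝ) ≤ R := Nat.cast_nonneg _
  calc (R : ℝ) ≤ R * (4 * (j * β)) := by nlinarith
    _ = 8 * β * (R * j / 2) := by ring
    _ ≤ _ := mul_le_mul_of_nonneg_left h3 (by positivity)

/-- The normalized mean meeting time is close to `1`, if one of the walks is stationary. -/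
theorem sum_abs_meet_sub_one_le (hδ0 : 0 ≤ δ) (hδ : δ ≤ 1 / 8)
    (hβ : pm * (1 + 2 * ρ * R) ≤ 1 / 16) (hm : 0 < meanMeet K π) (z : V) :
    ∑ y, π y * |meet K z y / meanMeet K π - 1| ≤ 35 * (pm * (1 + 2 * ρ * R)) + 11 * δ := by
  set β := pm * (1 + 2 * ρ * R) with hβdef
  set m := meanMeet K π with hmdef
  have hpm := hC.pm_pos
  have hρ := hC.rho_nonneg
  have hβ0 : 0 < β := by positivity
  have hδ' : δ < 1 / 2 := by linarith
  have hRm : (R : ℝ) ≤ 8 * β * m := hC.le_meanMeet hδ' (by rw [← hβdef]; linarith)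
  -- The bound of `meet_le`: here `R ≤ 8 * β * m`, and `(1 + 8 * β) / (1 - 2 * δ) ≤ 1 + 16 * β + 4 *
  -- δ` for small `β` and `δ`.
  set B := m * (1 + 16 * β + 4 * δ) with hBdef
  have hB : ∀ x y, meet K x y ≤ B := by
    intro x y
    refine (hC.meet_le hδ' x y).trans ?_
    rw [div_le_iff₀ (by linarith), ← hmdef]
    have e1 : m + R ≤ m * (1 + 8 * β) := by nlinarith
    have e2 : 1 + 8 * β ≤ (1 + 16 * β + 4 * δ) * (1 - 2 * δ) := by nlinarith
    calc m + R ≤ m * (1 + 8 * β) := e1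
      _ ≤ m * ((1 + 16 * β + 4 * δ) * (1 - 2 * δ)) := mul_le_mul_of_nonneg_left e2 hm.le
      _ = _ := by rw [hBdef]; ring
  have hB3 : B ≤ 3 * m := by rw [hBdef]; nlinarith
  -- After `R` steps the walk from `z` is `δ`-mixed and its partner is still stationary, so the mean
  -- of `meet` is at least `m - δ * B`. It exceeds its initial value by at most `B` times the
  -- probability `β` of having met.
  have hlow : m - 3 * (δ + β) * m ≤ ∑ y, π y * meet K z y := by
    have h1 : ∑ y, π y * pairAvg ((kpow K R) z) ((kpow K R) y) (meet K)
        ≤ ∑ y, π y * (meet K z y + B * (1 - surv K R z y)) := Finset.sum_le_sum fun y _ =>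
      mul_le_mul_of_nonneg_left (hC.pairAvg_pow_meet_le hδ' hB R z y) (hC.prob.1 y)
    have h2 : ∑ y, π y * (meet K z y + B * (1 - surv K R z y))
        = ∑ y, π y * meet K z y + B * ∑ y, π y * (1 - surv K R z y) := by
      rw [Finset.mul_sum, ← Finset.sum_add_distrib]
      exact Finset.sum_congr rfl fun _ _ => by ring
    have hB0 : 0 ≤ B := (hC.meet_nonneg z z).trans (hB z z)
    have h3 := mul_le_mul_of_nonneg_left (hC.sum_one_sub_surv_le R z) hB0
    rw [sum_mul_pairAvg] at h1
    simp only [hC.stat_pow] at h1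
    have h4 := hC.mix z B (fun a => ∑ b, π b * meet K a b) fun a =>
      ⟨Finset.sum_nonneg fun b _ => mul_nonneg (hC.prob.1 b) (hC.meet_nonneg a b), by
        calc _ ≤ ∑ b, π b * B := Finset.sum_le_sum fun b _ =>
              mul_le_mul_of_nonneg_left (hB a b) (hC.prob.1 b)
          _ = B := by rw [← Finset.sum_mul, hC.prob.2, one_mul]⟩
    have h5 := (abs_le.1 h4).1
    have h6 : meanMeet K π = ∑ a, π a * ∑ b, π b * meet K a b := rfl
    have h7 : pairAvg ((kpow K R) z) (fun b => π b) (meet K)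
      = ∑ a, (kpow K R) z a * ∑ b, π b * meet K a b := rfl
    rw [← h6, ← h7] at h5
    nlinarith
  -- If `u ≤ c` with `c ≥ 0`, then `|u| ≤ 2 * c - u`. Thus a uniform upper bound and a lower bound
  -- on the mean control the `L¹` norm.
  have habs : ∀ y, |meet K z y / m - 1| ≤ 2 * (16 * β + 4 * δ) - (meet K z y / m - 1) := by
    intro y
    have h1 : meet K z y / m - 1 ≤ 16 * β + 4 * δ := by
      rw [sub_le_iff_le_add, div_le_iff₀ hm]
      refine (hB z y).trans_eq ?_
      rw [hBdef]; ring
    rw [abs_le]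
    constructor <;> linarith
  calc ∑ y, π y * |meet K z y / m - 1|
      ≤ ∑ y, π y * (2 * (16 * β + 4 * δ) - (meet K z y / m - 1)) :=
        Finset.sum_le_sum fun y _ => mul_le_mul_of_nonneg_left (habs y) (hC.prob.1 y)
    _ = 2 * (16 * β + 4 * δ) + 1 - (∑ y, π y * meet K z y) / m := by
        rw [Finset.sum_div]
        have : ∀ y, π y * (2 * (16 * β + 4 * δ) - (meet K z y / m - 1))
            = π y * (2 * (16 * β + 4 * δ) + 1) - π y * meet K z y / m := fun y => by ring
        simp only [this, Finset.sum_sub_distrib, ← Finset.sum_mul, hC.prob.2, one_mul]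
    _ ≤ 35 * β + 11 * δ := by
        have : 1 - 3 * (δ + β) ≤ (∑ y, π y * meet K z y) / m := by
          rw [le_div_iff₀ hm]; linarith
        linarith

end IsMixingKernel

end Pair

/-! ### Coalescing walks as independent walks with a set of survivors -/

section Tuple

variable {ι V : Type*} [Fintype ι] [LinearOrder ι] [Fintype V] [DecidableEq V]

/-- The walkers of `A` that survive when those at the site of a smaller one are removed. -/
def prune (x : ι → V) (A : Finset ι) : Finset ι := A.filter fun i => ∀ j ∈ A, j < i → x j ≠ x i

theorem prune_subset (x : ι → V) (A : Finset ι) : prune x A ⊆ A := Finset.filter_subset _ _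

theorem prune_injOn (x : ι → V) (A : Finset ι) : InjOn x (prune x A) := by
  intro i hi j hj hij
  simp only [prune, Finset.coe_filter, mem_ofPred_eq] at hi hj
  rcases lt_trichotomy i j with h | h | h
  · exact absurd hij (hj.2 i hi.1 h)
  · exact h
  · exact absurd hij.symm (hi.2 j hj.1 h)

theorem exists_mem_prune (x : ι → V) (A : Finset ι) {i : ι} (hi : i ∈ A) :
    ∃ j ∈ prune x A, j ≤ i ∧ x j = x i := by
  have hne : (A.filter fun j => x j = x i).Nonempty := ⟨i, by simp [hi]⟩
  have hmem := Finset.min'_mem _ hne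
  rw [Finset.mem_filter] at hmem
  refine ⟨_, ?_, Finset.min'_le _ _ (by simp [hi]), hmem.2⟩
  refine Finset.mem_filter.2 ⟨hmem.1, fun l hl hlt heq => ?_⟩
  exact absurd (Finset.min'_le _ l (Finset.mem_filter.2 ⟨hl, heq.trans hmem.2⟩)) (not_le.2 hlt)

theorem image_prune (x : ι → V) (A : Finset ι) : (prune x A).image x = A.image x := by
  refine subset_antisymm (Finset.image_subset_image (prune_subset x A)) fun v hv => ?_
  obtain ⟨i, hi, rfl⟩ := Finset.mem_image.1 hv
  obtain ⟨j, hj, -, h⟩ := exists_mem_prune x A hi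
  exact Finset.mem_image.2 ⟨j, hj, h⟩

theorem prune_eq_self {x : ι → V} {A : Finset ι} (h : InjOn x A) : prune x A = A :=
  Finset.filter_true_of_mem fun _ hi _ hj hlt heq => hlt.ne (h hj hi heq)

/-- One step of the walks with survivors. -/
def tupleOp (K : V → V → ℝ) :
    ((ι → V) → Finset ι → ℝ) →ₗ[ℝ] ((ι → V) → Finset ι → ℝ) where
  toFun f x A := avg (fun i => K (x i)) fun y => f y (prune y A)
  map_add' f g := by ext x A; exact map_add (avg _) _ _
  map_smul' c f := by ext x A; exact map_smul (avg _) _ _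

theorem tupleOp_apply (K : V → V → ℝ) (f : (ι → V) → Finset ι → ℝ) (x : ι → V) (A : Finset ι) :
    tupleOp K f x A = avg (fun i => K (x i)) fun y => f y (prune y A) := rfl

/-- The mean at time `n` for walks started independently from `π`. -/
def tupleMean (K : V → V → ℝ) (π : V → ℝ) (n : ℕ) : ((ι → V) → Finset ι → ℝ) →ₗ[ℝ] ℝ where
  toFun f := avg (fun _ => π) fun x => (tupleOp K ^ n) f x (prune x Finset.univ)
  map_add' f g := by rw [map_add]; exact map_add (avg _) _ _
  map_smul' c f := by rw [map_smul]; exact map_smul (avg _) _ _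

theorem tupleMean_apply (K : V → V → ℝ) (π : V → ℝ) (n : ℕ) (f : (ι → V) → Finset ι → ℝ) :
    tupleMean K π n f
      = avg (fun _ => π) fun x => (tupleOp K ^ n) f x (prune x Finset.univ) := rfl

theorem tupleMean_succ (K : V → V → ℝ) (π : V → ℝ) (n : ℕ) (f : (ι → V) → Finset ι → ℝ) :
    tupleMean K π (n + 1) f = tupleMean K π n (tupleOp K f) := by
  simp only [tupleMean_apply, pow_succ, Module.End.mul_apply]

section

variable {K : V → V → ℝ} (hK : ∀ x, K x ∈ stdSimplex ℝ V)
include hK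

theorem tupleOp_pow_mono {f g : (ι → V) → Finset ι → ℝ}
    (h : ∀ (x : ι → V) (A : Finset ι), InjOn x A → f x A ≤ g x A) (n : ℕ) (x : ι → V) (A : Finset ι)
    (hA : InjOn x A) : (tupleOp K ^ n) f x A ≤ (tupleOp K ^ n) g x A := by
  induction n generalizing x A with
  | zero => simpa using h x A hA
  | succ n ih =>
    rw [pow_succ', Module.End.mul_apply, Module.End.mul_apply]
    exact avg_mono (fun i => hK _) fun y => ih y _ (prune_injOn y A)

variable {π : V → ℝ} (hπ : π ∈ stdSimplex ℝ V)
include hπ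

theorem tupleMean_mono {f g : (ι → V) → Finset ι → ℝ}
    (h : ∀ (x : ι → V) (A : Finset ι), InjOn x A → f x A ≤ g x A) (n : ℕ) :
    tupleMean K π n f ≤ tupleMean K π n g :=
  avg_mono (fun _ => hπ) fun x => tupleOp_pow_mono hK h n x _ (prune_injOn x _)

theorem tupleMean_const (n : ℕ) (c : ℝ) : tupleMean (ι := ι) K π n (fun _ _ => c) = c := by
  induction n with
  | zero => simp [tupleMean_apply, avg_const fun _ => hπ]
  | succ n ih =>
    rw [tupleMean_succ]
    refine Eq.trans (congrArg _ ?_) ih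
    ext x A
    exact avg_const (fun i => hK _) c

theorem abs_tupleMean_le {f g : (ι → V) → Finset ι → ℝ}
    (h : ∀ (x : ι → V) (A : Finset ι), InjOn x A → |f x A| ≤ g x A) (n : ℕ) :
    |tupleMean K π n f| ≤ tupleMean K π n g := by
  rw [abs_le]
  constructor
  · rw [← map_neg]
    exact tupleMean_mono hK hπ (fun x A hA => (abs_le.1 (h x A hA)).1) n
  · exact tupleMean_mono hK hπ (fun x A hA => (abs_le.1 (h x A hA)).2) n

/-- Removed walkers keep moving, so forgetting the survivors leaves independent stationary walks at
every time. -/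
theorem tupleMean_fst (hs : ∀ y, ∑ x, π x * K x y = π y) (n : ℕ) (F : (ι → V) → ℝ) :
    tupleMean K π n (fun x _ => F x) = avg (fun _ => π) F := by
  induction n generalizing F with
  | zero => simp [tupleMean_apply]
  | succ n ih =>
    rw [tupleMean_succ]
    have : tupleOp K (fun (x : ι → V) (_ : Finset ι) => F x)
        = fun x _ => avg (fun i => K (x i)) F := rfl
    rw [this, ih, avg_avg (fun _ => π) (fun _ => K) F]
    simp only [hs]

end

/-! #### A given pair of walkers -/

/-- One step of independent walks, killed when `i` and `j` meet. -/
def killOp (K : V → V → ℝ) (i j : ι) : ((ι → V) → ℝ) →ₗ[ℝ] ((ι → V) → ℝ) where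
  toFun f x := avg (fun i => K (x i)) fun y => if y i = y j then 0 else f y
  map_add' f g := by
    ext x
    rw [Pi.add_apply, ← map_add]
    congr 1; ext y; simp only [Pi.add_apply]; split_ifs <;> simp
  map_smul' c f := by
    ext x
    rw [Pi.smul_apply, RingHom.id_apply, ← map_smul]
    congr 1; ext y; simp only [Pi.smul_apply]; split_ifs <;> simp

theorem killOp_apply (K : V → V → ℝ) (i j : ι) (f : (ι → V) → ℝ) (x : ι → V) :
    killOp K i j f x = avg (fun i => K (x i)) fun y => if y i = y j then 0 else f y := rfl

section

variable {K : V → V → ℝ} (hK : ∀ x, K x ∈ stdSimplex ℝ V)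
include hK

theorem killOp_pow_nonneg (i j : ι) {f : (ι → V) → ℝ} (h : ∀ x, 0 ≤ f x) (n : ℕ) (x : ι → V) :
    0 ≤ (killOp K i j ^ n) f x := by
  induction n generalizing x with
  | zero => simpa using h x
  | succ n ih =>
    rw [pow_succ', Module.End.mul_apply]
    refine avg_nonneg (fun i => hK _) fun y => ?_
    split_ifs
    · exact le_rfl
    · exact ih y

/-- When `i` and `j` are both present at one site, the larger index is removed; as long as both
survive, the pair has never met. -/
theorem tupleOp_pow_mem_le {i j : ι} (hij : i < j) {F : (ι → V) → ℝ} (hF : ∀ x, 0 ≤ F x)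
    (n : ℕ) (x : ι → V) (A : Finset ι) :
    (tupleOp K ^ n) (fun x A => if i ∈ A ∧ j ∈ A then F x else 0) x A
      ≤ if i ∈ A ∧ j ∈ A then (killOp K i j ^ n) F x else 0 := by
  induction n generalizing x A with
  | zero => simp
  | succ n ih =>
    rw [pow_succ', Module.End.mul_apply, pow_succ', Module.End.mul_apply, tupleOp_apply,
      killOp_apply]
    have h1 := avg_mono (fun i => hK (x i)) fun y => ih y (prune y A)
    refine h1.trans ?_
    by_cases hA : i ∈ A ∧ j ∈ A
    · rw [if_pos hA]
      refine avg_mono (fun i => hK _) fun y => ?_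
      have hnn := killOp_pow_nonneg hK i j hF n y
      split_ifs with h2 h3 h3
      · exact absurd h3 ((Finset.mem_filter.1 h2.2).2 i hA.1 hij)
      · exact le_rfl
      · exact le_rfl
      · exact hnn
    · rw [if_neg hA]
      refine avg_le_const (fun i => hK _) fun y => ?_
      rw [if_neg fun h2 => hA ⟨prune_subset y A h2.1, prune_subset y A h2.2⟩]

variable {π : V → ℝ} (hπ : π ∈ stdSimplex ℝ V) (hs : ∀ y, ∑ x, π x * K x y = π y)
include hπ hs

/-- A stationary walker `l` that is independent of the others stays so after a step. -/
theorem sum_update_avg (l : ι) (F : (ι → V) → ℝ) (x : ι → V) :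
    ∑ v, π v * avg (fun i => K (Function.update x l v i)) F
      = avg (Function.update (fun i => K (x i)) l π) F := by
  simp only [avg_apply, Finset.mul_sum]
  rw [Finset.sum_comm]
  refine Finset.sum_congr rfl fun y _ => ?_
  rw [← Finset.mul_prod_erase _ _ (Finset.mem_univ l), Function.update_self, ← hs (y l),
    Finset.sum_mul, Finset.sum_mul]
  refine Finset.sum_congr rfl fun v _ => ?_
  rw [← Finset.mul_prod_erase _ _ (Finset.mem_univ l), Function.update_self]
  have : ∏ i ∈ Finset.univ.erase l, K (Function.update x l v i) (y i)
      = ∏ i ∈ Finset.univ.erase l, Function.update (fun i => K (x i)) l π i (y i) :=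
    Finset.prod_congr rfl fun i hi => by
      rw [Function.update_of_ne (Finset.ne_of_mem_erase hi),
        Function.update_of_ne (Finset.ne_of_mem_erase hi)]
  rw [this]; ring

/-- The relation compares averages over a stationary coordinate `l`, all others being frozen. A step
moves `l` independently of the rest and preserves `π`, so the relation is transported. -/
theorem avg_rel {l : ι} {η : ℝ} {F G : (ι → V) → ℝ}
    (h : ∀ x, ∑ v, π v * F (Function.update x l v) ≤ η * ∑ v, π v * G (Function.update x l v))
    (x : ι → V) :
    ∑ v, π v * avg (fun i => K (Function.update x l v i)) F
      ≤ η * ∑ v, π v * avg (fun i => K (Function.update x l v i)) G := by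
  rw [sum_update_avg hK hπ hs, sum_update_avg hK hπ hs]
  have hp : ∀ i, Function.update (fun i => K (x i)) l π i ∈ stdSimplex ℝ V := by
    intro i
    by_cases h : i = l
    · rw [h, Function.update_self]; exact hπ
    · rw [Function.update_of_ne h]; exact hK _
  rw [avg_update hp l F, avg_update hp l G, Function.update_self, ← smul_eq_mul, ← map_smul]
  exact avg_mono hp h

theorem killOp_pow_rel {i j l : ι} (hi : l ≠ i) (hj : l ≠ j) {η : ℝ} {F G : (ι → V) → ℝ}
    (h : ∀ x, ∑ v, π v * F (Function.update x l v) ≤ η * ∑ v, π v * G (Function.update x l v))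
    (n : ℕ) (x : ι → V) :
    ∑ v, π v * (killOp K i j ^ n) F (Function.update x l v)
      ≤ η * ∑ v, π v * (killOp K i j ^ n) G (Function.update x l v) := by
  induction n generalizing x with
  | zero => simpa using h x
  | succ n ih =>
    rw [pow_succ', Module.End.mul_apply, Module.End.mul_apply]
    refine avg_rel hK hπ hs (fun y => ?_) x
    simp only [Function.update_of_ne hi.symm, Function.update_of_ne hj.symm]
    by_cases hy : y i = y j
    · simp [hy]
    · simpa [hy] using ih y

/-- When `i` and `j` meet, a quantity that is at most `η` after averaging over a third walker
contributes at most `η`. -/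
theorem sum_tupleMean_meet_le {i j l : ι} (hij : i < j) (hi : l ≠ i) (hj : l ≠ j) {η : ℝ}
    (hη : 0 ≤ η) {b : (ι → V) → ℝ} (hb : ∀ x, 0 ≤ b x)
    (h : ∀ x, ∑ v, π v * b (Function.update x l v) ≤ η) (t : ℕ) :
    ∑ n ∈ Finset.range t, tupleMean K π n (fun x A => if i ∈ A ∧ j ∈ A then
      avg (fun i => K (x i)) (fun y => if y i = y j then b y else 0) else 0) ≤ η := by
  set F : (ι → V) → ℝ := fun x => avg (fun i => K (x i)) fun y => if y i = y j then b y else 0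
    with hF
  set G : (ι → V) → ℝ := fun x => avg (fun i => K (x i)) fun y => if y i = y j then 1 else 0
    with hG
  have hF0 : ∀ x, 0 ≤ F x := fun x => avg_nonneg (fun i => hK _) fun y => by
    split_ifs
    · exact hb y
    · exact le_rfl
  -- At the moment when `i` and `j` meet, `b` averages to at most `η` over walker `l`. The meeting
  -- rate weighted by `b` is thus at most `η` times the bare meeting rate `G`, after averaging over
  -- `l`.
  have hrel : ∀ x, ∑ v, π v * F (Function.update x l v)
      ≤ η * ∑ v, π v * G (Function.update x l v) := by
    refine avg_rel hK hπ hs fun x => ?_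
    simp only [Function.update_of_ne hi.symm, Function.update_of_ne hj.symm]
    by_cases hx : x i = x j
    · simp only [hx, if_true, mul_one, hπ.2]
      exact h x
    · simp [hx]
  -- The meeting rate is the mass lost by the killed walk in one step, so its sum over time
  -- telescopes to a probability.
  have hG1 : G = (fun _ => 1) - killOp K i j (fun _ => 1) := by
    ext x
    have h0 : (fun y : ι → V => if y i = y j then (1 : ℝ) else 0)
        = (fun _ => 1) - fun y => if y i = y j then 0 else 1 := by
      ext y; rw [Pi.sub_apply]; split_ifs <;> norm_num
    rw [Pi.sub_apply, killOp_apply, hG]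
    dsimp only
    rw [h0, map_sub, avg_const fun i => hK (x i)]
  have h1 : ∀ n, tupleMean K π n (fun x A => if i ∈ A ∧ j ∈ A then F x else 0)
      ≤ η * avg (fun _ => π) (fun x => if x i = x j then 0 else (killOp K i j ^ n) G x) := by
    intro n
    rw [tupleMean_apply]
    calc _ ≤ avg (fun _ => π) (fun x => if x i = x j then 0 else (killOp K i j ^ n) F x) := by
          refine avg_mono (fun _ => hπ) fun x => ?_
          refine (tupleOp_pow_mem_le hK hij hF0 n x _).trans ?_
          have hnn := killOp_pow_nonneg hK i j hF0 n x
          split_ifs with h2 h3 h3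
          · exact absurd h3 ((Finset.mem_filter.1 h2.2).2 i (Finset.mem_univ i) hij)
          · exact le_rfl
          · exact le_rfl
          · exact hnn
      _ ≤ _ := by
          rw [avg_update (fun _ => hπ) l,
            avg_update (fun _ => hπ) l (fun x => if x i = x j then 0 else (killOp K i j ^ n) G x),
            ← smul_eq_mul, ← map_smul]
          refine avg_mono (fun _ => hπ) fun x => ?_
          simp only [Function.update_of_ne hi.symm, Function.update_of_ne hj.symm, Pi.smul_apply,
            smul_eq_mul]
          by_cases hx : x i = x j
          · simp [hx]
          · simpa [hx] using killOp_pow_rel hK hπ hs hi hj hrel n x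
  have h2 : ∑ n ∈ Finset.range t, (killOp K i j ^ n) G
      = (fun _ => 1) - (killOp K i j ^ t) (fun _ => 1) := by
    have : ∀ n, (killOp K i j ^ n) G
        = (killOp K i j ^ n) (fun _ => 1) - (killOp K i j ^ (n + 1)) (fun _ => 1) := by
      intro n
      rw [hG1, map_sub, pow_succ, Module.End.mul_apply]
    simp only [this]
    rw [Finset.sum_range_sub']
    simp
  calc _ ≤ ∑ n ∈ Finset.range t,
        η * avg (fun _ => π) (fun x => if x i = x j then 0 else (killOp K i j ^ n) G x) :=
        Finset.sum_le_sum fun n _ => h1 n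
    _ = η * avg (fun _ => π) (fun x => if x i = x j then 0
          else (∑ n ∈ Finset.range t, (killOp K i j ^ n) G) x) := by
        rw [← Finset.mul_sum, ← map_sum]
        congr 2
        ext x
        rw [Finset.sum_apply]
        split_ifs
        · simp
        · simp
    _ ≤ η * 1 := by
        refine mul_le_mul_of_nonneg_left (avg_le_const (fun _ => hπ) fun x => ?_) hη
        split_ifs
        · exact zero_le_one
        · rw [h2, Pi.sub_apply]
          linarith [killOp_pow_nonneg hK i j (fun _ => zero_le_one) t x]
    _ = η := mul_one η

end

end Tuple

/-! ### The corrected test functions -/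

section Evolution

variable {ι V : Type*} [Fintype ι] [LinearOrder ι] [Fintype V] [DecidableEq V]

/-- The ordered pairs of elements of `A`. -/
def pairs (A : Finset ι) : Finset (ι × ι) := (A ×ˢ A).filter fun p => p.1 < p.2

theorem mem_pairs {A : Finset ι} {p : ι × ι} : p ∈ pairs A ↔ (p.1 ∈ A ∧ p.2 ∈ A) ∧ p.1 < p.2 := by
  rw [pairs, Finset.mem_filter, Finset.mem_product]

theorem pairs_mono {A B : Finset ι} (h : A ⊆ B) : pairs A ⊆ pairs B := fun _ hp =>
  mem_pairs.2 ⟨⟨h (mem_pairs.1 hp).1.1, h (mem_pairs.1 hp).1.2⟩, (mem_pairs.1 hp).2⟩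

theorem card_pairs (A : Finset ι) : (pairs A).card = A.card.choose 2 := by
  have h1 : A.offDiag = pairs A ∪ (pairs A).map (Equiv.prodComm ι ι).toEmbedding := by
    ext p
    simp only [Finset.mem_offDiag, Finset.mem_union, mem_pairs, Finset.mem_map_equiv,
      Equiv.prodComm_symm, Equiv.prodComm_apply, Prod.fst_swap, Prod.snd_swap]
    constructor
    · rintro ⟨ha, hb, hne⟩
      rcases lt_or_gt_of_ne hne with h | h
      · exact Or.inl ⟨⟨ha, hb⟩, h⟩
      · exact Or.inr ⟨⟨hb, ha⟩, h⟩
    · rintro (⟨⟨ha, hb⟩, h⟩ | ⟨⟨hb, ha⟩, h⟩)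
      · exact ⟨ha, hb, h.ne⟩
      · exact ⟨ha, hb, h.ne'⟩
  have h2 : Disjoint (pairs A) ((pairs A).map (Equiv.prodComm ι ι).toEmbedding) := by
    rw [Finset.disjoint_left]
    intro p hp hp'
    simp only [mem_pairs, Finset.mem_map_equiv, Equiv.prodComm_symm, Equiv.prodComm_apply,
      Prod.fst_swap, Prod.snd_swap] at hp hp'
    exact absurd hp.2 (not_lt.2 hp'.2.le)
  have h3 := congrArg Finset.card h1
  rw [Finset.card_union_of_disjoint h2, Finset.card_map, Finset.offDiag_card] at h3
  rw [Nat.choose_two_right, Nat.mul_sub, mul_one]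
  omega

/-- The number of survivors tested with `α`, corrected by the normalized mean meeting times `h`. -/
def corrected (α : ℕ → ℝ) (h : V → V → ℝ) (x : ι → V) (A : Finset ι) : ℝ :=
  α A.card + (α A.card - α (A.card - 1)) * ∑ p ∈ pairs A, (h (x p.1) (x p.2) - 1)

theorem abs_sub_le_of_abs_diff_le {α : ℕ → ℝ} (hα : ∀ k, |α k - α (k - 1)| ≤ 1) {a b : ℕ}
    (hab : a ≤ b) : |α a - α b| ≤ (b - a : ℕ) := by
  induction b, hab using Nat.le_induction with
  | base => simp
  | succ b hb ih =>
    have h1 := hα (b + 1)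
    rw [Nat.add_sub_cancel] at h1
    calc |α a - α (b + 1)| ≤ |α a - α b| + |α b - α (b + 1)| := abs_sub_le _ _ _
      _ ≤ (b - a : ℕ) + 1 := add_le_add ih (by rwa [abs_sub_comm])
      _ = (b + 1 - a : ℕ) := by rw [Nat.succ_sub hb]; push_cast; ring

/-- A single meeting has no cost of leading order: since `h = 0` there, the correction of the
meeting pair is `-(α k - α (k - 1))`, which is exactly the change of `α` when one walker disappears.
Only the corrections of the other pairs, before and after, remain. If `c ≥ 2` pairs coincide and `S`
is the total correction of the pairs that do not, the crude bound `2 * c + 2 * S` suffices, because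
the right side is `2 * c * (c - 1 + S)`: coinciding pairs have `|h - 1| = 1`. -/
theorem abs_corrected_prune_sub_le {α : ℕ → ℝ} (hα : ∀ k, |α k - α (k - 1)| ≤ 1)
    {h : V → V → ℝ} (hd : ∀ z, h z z = 0) (x : ι → V) (A : Finset ι) :
    |corrected α h x (prune x A) - corrected α h x A|
      ≤ 2 * ∑ p ∈ pairs A, ∑ p' ∈ (pairs A).erase p,
        if x p.1 = x p.2 then |h (x p'.1) (x p'.2) - 1| else 0 := by
  set b : ι × ι → ℝ := fun p => |h (x p.1) (x p.2) - 1| with hb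
  set Q := (pairs A).filter fun p => x p.1 = x p.2 with hQ
  set N := (pairs A).filter fun p => ¬ x p.1 = x p.2 with hN
  set c := Q.card with hc
  have hb0 : ∀ p, 0 ≤ b p := fun p => abs_nonneg _
  have hbQ : ∀ p ∈ Q, b p = 1 := fun p hp => by
    simp only [hb, (Finset.mem_filter.1 hp).2, hd]; norm_num
  have hsplit : ∀ f : ι × ι → ℝ, ∑ p ∈ pairs A, f p = ∑ p ∈ Q, f p + ∑ p ∈ N, f p := fun f =>
    (Finset.sum_filter_add_sum_filter_not _ _ _).symm
  have hsumQ : ∑ p ∈ Q, b p = c := by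
    rw [Finset.sum_congr rfl hbQ]; simp [hc]
  set S := ∑ p ∈ N, b p with hS
  have hS0 : 0 ≤ S := Finset.sum_nonneg fun p _ => hb0 p
  have hR : ∑ p ∈ pairs A, ∑ p' ∈ (pairs A).erase p, (if x p.1 = x p.2 then b p' else 0)
      = c * (c - 1 + S) := by
    have : ∀ p ∈ pairs A, ∑ p' ∈ (pairs A).erase p, (if x p.1 = x p.2 then b p' else 0)
        = if x p.1 = x p.2 then (c - 1 + S) else 0 := by
      intro p hp
      split_ifs with hx
      · have h1 := Finset.add_sum_erase (pairs A) b hp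
        rw [hsplit b, hsumQ, hbQ p (Finset.mem_filter.2 ⟨hp, hx⟩)] at h1
        linarith
      · simp
    rw [Finset.sum_congr rfl this, ← Finset.sum_filter, Finset.sum_const, nsmul_eq_mul]
  have hNsub : pairs (prune x A) ⊆ N := by
    intro p hp
    have hp' := mem_pairs.1 hp
    refine Finset.mem_filter.2 ⟨pairs_mono (prune_subset x A) hp, fun hx => ?_⟩
    exact hp'.2.ne (prune_injOn x A hp'.1.1 hp'.1.2 hx)
  have habsD : ∀ B : Finset ι, |(α B.card - α (B.card - 1)) *
      ∑ p ∈ pairs B, (h (x p.1) (x p.2) - 1)| ≤ ∑ p ∈ pairs B, b p := by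
    intro B
    rw [abs_mul]
    calc _ ≤ 1 * ∑ p ∈ pairs B, b p := mul_le_mul (hα _) (Finset.abs_sum_le_sum_abs _ _)
          (abs_nonneg _) zero_le_one
      _ = _ := one_mul _
  have hP : ∑ p ∈ pairs (prune x A), b p ≤ S :=
    Finset.sum_le_sum_of_subset_of_nonneg hNsub fun p _ _ => hb0 p
  have hrc : A.card - (prune x A).card ≤ c := by
    rw [← Finset.card_sdiff_of_subset (prune_subset x A)]
    have : ∀ i ∈ A \ prune x A, ∃ j, (j, i) ∈ Q := by
      intro i hi
      rw [Finset.mem_sdiff] at hi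
      have : ¬ ∀ j ∈ A, j < i → x j ≠ x i := fun hh => hi.2 (Finset.mem_filter.2 ⟨hi.1, hh⟩)
      push Not at this
      obtain ⟨j, hj, hlt, heq⟩ := this
      exact ⟨j, Finset.mem_filter.2 ⟨mem_pairs.2 ⟨⟨hj, hi.1⟩, hlt⟩, heq⟩⟩
    calc (A \ prune x A).card ≤ (Q.image Prod.snd).card := by
          refine Finset.card_le_card fun i hi => ?_
          obtain ⟨j, hj⟩ := this i hi
          exact Finset.mem_image.2 ⟨_, hj, rfl⟩
      _ ≤ c := Finset.card_image_le
  have hcard : (prune x A).card ≤ A.card := Finset.card_le_card (prune_subset x A)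
  rw [hR]
  rcases Nat.lt_or_ge c 2 with hc2 | hc2
  · rcases Nat.eq_zero_or_pos c with hc0 | hc0
    · have : prune x A = A := Finset.eq_of_subset_of_card_le (prune_subset x A) (by omega)
      rw [this, hc0]; simp
    · have hc1 : c = 1 := by omega
      obtain ⟨q, hq⟩ := Finset.card_eq_one.1 (hc.symm.trans hc1)
      have hqQ : q ∈ Q := by rw [hq]; exact Finset.mem_singleton_self q
      have hqA := Finset.mem_filter.1 hqQ
      have hq' := mem_pairs.1 hqA.1
      have hne : q.2 ∉ prune x A := fun hmem =>
        (Finset.mem_filter.1 hmem).2 q.1 hq'.1.1 hq'.2 hqA.2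
      have hlt : (prune x A).card < A.card := Finset.card_lt_card
        ⟨prune_subset x A, fun hsub => hne (hsub hq'.1.2)⟩
      have hk : (prune x A).card = A.card - 1 := by omega
      have e1 : ∑ p ∈ pairs A, (h (x p.1) (x p.2) - 1)
          = -1 + ∑ p ∈ N, (h (x p.1) (x p.2) - 1) := by
        rw [hsplit, hq, Finset.sum_singleton, hqA.2, hd]; ring
      have e2 : corrected α h x (prune x A) - corrected α h x A
          = (α (prune x A).card - α ((prune x A).card - 1)) *
              ∑ p ∈ pairs (prune x A), (h (x p.1) (x p.2) - 1)
            - (α A.card - α (A.card - 1)) * ∑ p ∈ N, (h (x p.1) (x p.2) - 1) := by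
        simp only [corrected, e1, hk]; ring
      rw [e2]
      have e3 : |(α A.card - α (A.card - 1)) * ∑ p ∈ N, (h (x p.1) (x p.2) - 1)| ≤ S := by
        rw [abs_mul]
        calc _ ≤ 1 * S := mul_le_mul (hα _) (Finset.abs_sum_le_sum_abs _ _)
              (abs_nonneg _) zero_le_one
          _ = _ := one_mul _
      have e4 := (habsD (prune x A)).trans hP
      rw [hc1]
      calc _ ≤ _ := abs_sub _ _
        _ ≤ S + S := add_le_add e4 e3
        _ = _ := by push_cast; ring
  · have e1 : |α (prune x A).card - α A.card| ≤ c :=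
      (abs_sub_le_of_abs_diff_le hα hcard).trans (by exact_mod_cast hrc)
    have e2 := (habsD (prune x A)).trans hP
    have e3 := habsD A
    rw [hsplit b, hsumQ] at e3
    have hc2' : (2 : ℝ) ≤ c := by exact_mod_cast hc2
    have e4 : corrected α h x (prune x A) - corrected α h x A
        = (α (prune x A).card - α A.card) + (α (prune x A).card - α ((prune x A).card - 1)) *
              ∑ p ∈ pairs (prune x A), (h (x p.1) (x p.2) - 1)
          - (α A.card - α (A.card - 1)) * ∑ p ∈ pairs A, (h (x p.1) (x p.2) - 1) := by
      simp only [corrected]; ring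
    rw [e4]
    have e5 := abs_sub ((α (prune x A).card - α A.card) + (α (prune x A).card
        - α ((prune x A).card - 1)) * ∑ p ∈ pairs (prune x A), (h (x p.1) (x p.2) - 1))
      ((α A.card - α (A.card - 1)) * ∑ p ∈ pairs A, (h (x p.1) (x p.2) - 1))
    have e6 := abs_add_le (α (prune x A).card - α A.card) ((α (prune x A).card
        - α ((prune x A).card - 1)) * ∑ p ∈ pairs (prune x A), (h (x p.1) (x p.2) - 1))
    nlinarith

variable {K : V → V → ℝ} {π : V → ℝ} {pm ρ δ : ℝ} {R : ℕ}
  (hC : IsMixingKernel K π pm ρ δ R)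
include hC

namespace IsMixingKernel

/-- Without coalescence, the corrected test function has the mean-field drift. -/
theorem avg_corrected (hδ : δ < 1 / 2) (hm : 0 < meanMeet K π) (α : ℕ → ℝ) {x : ι → V}
    {A : Finset ι} (hA : InjOn x A) :
    avg (fun i => K (x i))
        (fun y => corrected α (fun a b => meet K a b / meanMeet K π) y A)
      = α A.card + (α A.card - α (A.card - 1)) *
        (∑ p ∈ pairs A, (meet K (x p.1) (x p.2) / meanMeet K π - 1)
          - (A.card.choose 2 : ℕ) / meanMeet K π) := by
  set m := meanMeet K π with hmdef
  have hst : ∀ i, K (x i) ∈ stdSimplex ℝ V := fun i => hC.stoch _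
  have h1 : (fun y => corrected α (fun a b => meet K a b / m) y A)
      = (fun _ => α A.card) + (α A.card - α (A.card - 1)) •
        ∑ p ∈ pairs A, (m⁻¹ • (fun y : ι → V => meet K (y p.1) (y p.2)) - fun _ => 1) := by
    ext y
    simp only [corrected, Pi.add_apply, Pi.smul_apply, Finset.sum_apply, Pi.sub_apply,
      smul_eq_mul, div_eq_inv_mul]
  rw [h1, map_add, map_smul, map_sum, avg_const hst, smul_eq_mul]
  congr 2
  have h0 : ((pairs A).card : ℝ) / m = ∑ _p ∈ pairs A, 1 / m := by
    rw [Finset.sum_const, nsmul_eq_mul]; ring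
  rw [← card_pairs, h0, ← Finset.sum_sub_distrib]
  refine Finset.sum_congr rfl fun p hp => ?_
  have hp' := mem_pairs.1 hp
  rw [map_sub, map_smul, avg_const hst, avg_pair hst hp'.2.ne, smul_eq_mul]
  have h2 := hC.pairAvg_meet hδ (x := x p.1) (y := x p.2)
    fun h => hp'.2.ne (hA hp'.1.1 hp'.1.2 h)
  rw [show (pairAvg (K (x p.1)) (K (x p.2)) fun a b => meet K a b)
    = pairAvg (K (x p.1)) (K (x p.2)) (meet K) from rfl, h2]
  field_simp
  ring

theorem avg_abs_pair_le {η : ℝ}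
    (hη : ∀ z, ∑ y, π y * |meet K z y / meanMeet K π - 1| ≤ η) {p : ι × ι} (hp : p.1 < p.2) :
    avg (fun _ => π) (fun x : ι → V => |meet K (x p.1) (x p.2) / meanMeet K π - 1|) ≤ η := by
  rw [avg_update (fun _ => hC.prob) p.2]
  refine avg_le_const (fun _ => hC.prob) fun x => ?_
  simp only [Function.update_self, Function.update_of_ne hp.ne]
  exact hη _

/-- The evolution of the mean of a corrected test function for stationary walkers. -/
theorem abs_evolution_le (hδ : δ < 1 / 2) (hm : 0 < meanMeet K π) {η : ℝ}
    (hη : ∀ z, ∑ y, π y * |meet K z y / meanMeet K π - 1| ≤ η) {a : ℕ → ℕ → ℝ} {θ : ℝ}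
    (ha : ∀ n k, |a n k - a n (k - 1)| ≤ 1)
    (hθ : ∀ n k, k ≤ Fintype.card ι →
      |(a (n + 1) k - a (n + 1) (k - 1)) - (a n k - a n (k - 1))| ≤ θ) (t : ℕ) :
    |tupleMean (ι := ι) K π t (corrected (a t) fun x y => meet K x y / meanMeet K π)
      - tupleMean (ι := ι) K π 0 (corrected (a 0) fun x y => meet K x y / meanMeet K π)
      - ∑ n ∈ Finset.range t, tupleMean (ι := ι) K π n (fun _ A =>
          a (n + 1) A.card - (A.card.choose 2 : ℕ) / meanMeet K π
            * (a (n + 1) A.card - a (n + 1) (A.card - 1)) - a n A.card)|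
      ≤ t * (θ * (((Fintype.card ι).choose 2 : ℕ) : ℝ) * η)
        + 2 * ((((Fintype.card ι).choose 2 : ℕ) : ℝ) ^ 2 * η) := by
  set m := meanMeet K π with hmdef
  set h : V → V → ℝ := fun x y => meet K x y / m with hh
  set Λ : ℝ := (((Fintype.card ι).choose 2 : ℕ) : ℝ) with hΛ
  obtain ⟨x₀⟩ := hC.nonempty
  have hη0 : 0 ≤ η := le_trans (Finset.sum_nonneg fun y _ =>
    mul_nonneg (hC.prob.1 y) (abs_nonneg _)) (hη x₀)
  have hθ0 : 0 ≤ θ := le_trans (abs_nonneg _) (hθ 0 0 (Nat.zero_le _))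
  have hd : ∀ z, h z z = 0 := fun z => by simp [hh, meet_self]
  set U : Finset (ι × ι) := pairs Finset.univ with hU
  have hUcard : (U.card : ℝ) = Λ := by rw [hU, card_pairs, Finset.card_univ]
  set err : ι × ι → ι × ι → (ι → V) → Finset ι → ℝ := fun p p' x A =>
    if p.1 ∈ A ∧ p.2 ∈ A then avg (fun i => K (x i)) (fun y => if y p.1 = y p.2 then
      |h (y p'.1) (y p'.2) - 1| else 0) else 0 with herr
  have herr0 : ∀ p p' x A, 0 ≤ err p p' x A := by
    intro p p' x A
    simp only [herr]
    split_ifs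
    · refine avg_nonneg (fun i => hC.stoch _) fun y => ?_
      split_ifs
      · exact abs_nonneg _
      · exact le_rfl
    · exact le_rfl
  set res : ℕ → (ι → V) → Finset ι → ℝ := fun n _ A =>
    a (n + 1) A.card - (A.card.choose 2 : ℕ) / m
      * (a (n + 1) A.card - a (n + 1) (A.card - 1)) - a n A.card with hres
  set bsum : (ι → V) → ℝ := fun x => ∑ p ∈ U, |h (x p.1) (x p.2) - 1| with hbsum
  -- A step has two sources of error: pruning, controlled by meetings of `p` weighted with the
  -- correction of another pair `p'`, and the change in time of the factor in front of the
  -- correction.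
  have hstep : ∀ n (x : ι → V) (A : Finset ι), InjOn x A →
      |(tupleOp K (corrected (a (n + 1)) h) - corrected (a n) h - res n :
        (ι → V) → Finset ι → ℝ) x A|
        ≤ (θ • (fun x (_ : Finset ι) => bsum x) + (2 : ℝ) • ∑ p ∈ U, ∑ p' ∈ U.erase p, err p p' :
          (ι → V) → Finset ι → ℝ) x A := by
    intro n x A hA
    have e1 : |tupleOp K (corrected (a (n + 1)) h) x A
        - avg (fun i => K (x i)) (fun y => corrected (a (n + 1)) h y A)|
        ≤ 2 * ∑ p ∈ U, ∑ p' ∈ U.erase p, err p p' x A := by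
      rw [tupleOp_apply, ← map_sub]
      refine (abs_avg_le (fun i => hC.stoch _) _).trans ?_
      have e2 := avg_mono (fun i => hC.stoch (x i)) fun y =>
        abs_corrected_prune_sub_le (ha (n + 1)) hd y A
      refine e2.trans ?_
      have e3 : (fun y : ι → V => 2 * ∑ p ∈ pairs A, ∑ p' ∈ (pairs A).erase p,
          if y p.1 = y p.2 then |h (y p'.1) (y p'.2) - 1| else 0)
          = (2 : ℝ) • ∑ p ∈ pairs A, ∑ p' ∈ (pairs A).erase p, fun y : ι → V =>
            if y p.1 = y p.2 then |h (y p'.1) (y p'.2) - 1| else 0 := by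
        ext y; simp [Finset.sum_apply]
      rw [e3, map_smul, smul_eq_mul, map_sum]
      refine mul_le_mul_of_nonneg_left ?_ zero_le_two
      calc _ = ∑ p ∈ pairs A, ∑ p' ∈ (pairs A).erase p, err p p' x A := by
            refine Finset.sum_congr rfl fun p hp => ?_
            rw [map_sum]
            refine Finset.sum_congr rfl fun p' _ => ?_
            simp only [herr]
            rw [if_pos (mem_pairs.1 hp).1]
        _ ≤ ∑ p ∈ pairs A, ∑ p' ∈ U.erase p, err p p' x A :=
            Finset.sum_le_sum fun p _ => Finset.sum_le_sum_of_subset_of_nonneg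
              (Finset.erase_subset_erase _ (pairs_mono (Finset.subset_univ A)))
              fun _ _ _ => herr0 _ _ _ _
        _ ≤ _ := Finset.sum_le_sum_of_subset_of_nonneg (pairs_mono (Finset.subset_univ A))
            fun _ _ _ => Finset.sum_nonneg fun _ _ => herr0 _ _ _ _
    rw [hC.avg_corrected hδ hm _ hA] at e1
    have e4 : |((a (n + 1) A.card - a (n + 1) (A.card - 1)) - (a n A.card - a n (A.card - 1)))
        * ∑ p ∈ pairs A, (h (x p.1) (x p.2) - 1)| ≤ θ * bsum x := by
      rw [abs_mul]
      refine mul_le_mul (hθ n _ (Finset.card_le_univ A)) ?_ (abs_nonneg _) hθ0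
      refine (Finset.abs_sum_le_sum_abs _ _).trans ?_
      exact Finset.sum_le_sum_of_subset_of_nonneg (pairs_mono (Finset.subset_univ A))
        fun _ _ _ => abs_nonneg _
    simp only [Pi.sub_apply, Pi.add_apply, Pi.smul_apply, smul_eq_mul, Finset.sum_apply]
    have e5 : tupleOp K (corrected (a (n + 1)) h) x A - corrected (a n) h x A - res n x A
        = (tupleOp K (corrected (a (n + 1)) h) x A - (a (n + 1) A.card
          + (a (n + 1) A.card - a (n + 1) (A.card - 1)) *
            (∑ p ∈ pairs A, (h (x p.1) (x p.2) - 1) - (A.card.choose 2 : ℕ) / m)))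
          + ((a (n + 1) A.card - a (n + 1) (A.card - 1)) - (a n A.card - a n (A.card - 1)))
            * ∑ p ∈ pairs A, (h (x p.1) (x p.2) - 1) := by
      simp only [corrected, hres]; ring
    rw [e5]
    calc _ ≤ _ := abs_add_le _ _
      _ ≤ _ := add_le_add e1 e4
      _ = _ := add_comm _ _
  have hstep2 : ∀ n, |tupleMean (ι := ι) K π (n + 1) (corrected (a (n + 1)) h)
      - tupleMean (ι := ι) K π n (corrected (a n) h) - tupleMean (ι := ι) K π n (res n)|
      ≤ θ * Λ * η + 2 * ∑ p ∈ U, ∑ p' ∈ U.erase p, tupleMean (ι := ι) K π n (err p p') := by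
    intro n
    rw [tupleMean_succ, ← map_sub, ← map_sub]
    refine (abs_tupleMean_le hC.stoch hC.prob (hstep n) n).trans ?_
    rw [map_add, map_smul, map_smul, map_sum, smul_eq_mul, smul_eq_mul]
    simp only [map_sum]
    refine add_le_add_left ?_ _
    rw [mul_assoc]
    refine mul_le_mul_of_nonneg_left ?_ hθ0
    rw [tupleMean_fst hC.stoch hC.prob hC.stat]
    have : bsum = ∑ p ∈ U, fun x : ι → V => |h (x p.1) (x p.2) - 1| := by
      ext x; simp [hbsum, Finset.sum_apply]
    rw [this, map_sum, ← hUcard]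
    calc _ ≤ ∑ p ∈ U, η := Finset.sum_le_sum fun p hp =>
          hC.avg_abs_pair_le hη (mem_pairs.1 hp).2
      _ = _ := by rw [Finset.sum_const, nsmul_eq_mul]
  have herrsum : ∀ p ∈ U, ∀ p' ∈ U.erase p,
      ∑ n ∈ Finset.range t, tupleMean (ι := ι) K π n (err p p') ≤ η := by
    intro p hp p' hp'
    have hp1 := (mem_pairs.1 hp).2
    have hp2 := (mem_pairs.1 (Finset.mem_of_mem_erase hp')).2
    have hne := Finset.ne_of_mem_erase hp'
    -- Since `p' ≠ p`, some index of `p'` lies outside `p`. That walker plays the role of the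
    -- stationary third walker, whose average makes the correction of `p'` at most `η`.
    by_cases hl : p'.2 ≠ p.1 ∧ p'.2 ≠ p.2
    · refine sum_tupleMean_meet_le hC.stoch hC.prob hC.stat hp1 hl.1 hl.2 hη0
        (fun x => abs_nonneg _) (fun x => ?_) t
      simp only [Function.update_self, Function.update_of_ne hp2.ne]
      exact hη _
    · have hl2 : p'.1 ≠ p.1 ∧ p'.1 ≠ p.2 := by
        rw [not_and_or, not_ne_iff, not_ne_iff] at hl
        rcases hl with hl | hl
        · rw [hl] at hp2
          exact ⟨hp2.ne, (hp2.trans hp1).ne⟩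
        · refine ⟨fun h1 => hne (Prod.ext h1 hl), fun h1 => ?_⟩
          rw [hl, h1] at hp2
          exact lt_irrefl _ hp2
      refine sum_tupleMean_meet_le hC.stoch hC.prob hC.stat hp1 hl2.1 hl2.2 hη0
        (fun x => abs_nonneg _) (fun x => ?_) t
      simp only [Function.update_self, Function.update_of_ne hp2.ne', hh, meet_symm K _ (x p'.2)]
      exact hη _
  have htel : tupleMean (ι := ι) K π t (corrected (a t) h)
      - tupleMean (ι := ι) K π 0 (corrected (a 0) h)
      - ∑ n ∈ Finset.range t, tupleMean (ι := ι) K π n (res n)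
      = ∑ n ∈ Finset.range t, (tupleMean (ι := ι) K π (n + 1) (corrected (a (n + 1)) h)
        - tupleMean (ι := ι) K π n (corrected (a n) h) - tupleMean (ι := ι) K π n (res n)) := by
    rw [Finset.sum_sub_distrib,
      Finset.sum_range_sub fun n => tupleMean (ι := ι) K π n (corrected (a n) h)]
  rw [htel]
  refine (Finset.abs_sum_le_sum_abs _ _).trans ((Finset.sum_le_sum fun n _ => hstep2 n).trans ?_)
  rw [Finset.sum_add_distrib, Finset.sum_const, Finset.card_range, nsmul_eq_mul, ← Finset.mul_sum]
  refine add_le_add_right (mul_le_mul_of_nonneg_left ?_ zero_le_two) _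
  rw [Finset.sum_comm]
  calc _ = ∑ p ∈ U, ∑ p' ∈ U.erase p,
        ∑ n ∈ Finset.range t, tupleMean (ι := ι) K π n (err p p') :=
        Finset.sum_congr rfl fun p _ => Finset.sum_comm
    _ ≤ ∑ p ∈ U, ∑ p' ∈ U.erase p, η :=
        Finset.sum_le_sum fun p hp => Finset.sum_le_sum fun p' hp' => herrsum p hp p' hp'
    _ ≤ ∑ p ∈ U, ∑ p' ∈ U, η := Finset.sum_le_sum fun p _ =>
        Finset.sum_le_sum_of_subset_of_nonneg (Finset.erase_subset _ _) fun _ _ _ => hη0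
    _ = _ := by simp only [Finset.sum_const, nsmul_eq_mul, hUcard]; ring

end IsMixingKernel

end Evolution

/-! ### The coalescing flow on sets of sites -/

section Flow

variable {V : Type*} [Fintype V] [DecidableEq V]

/-- One step of the coalescing walks: every site is moved independently. -/
def flowOp (K : V → V → ℝ) : (Finset V → ℝ) →ₗ[ℝ] (Finset V → ℝ) where
  toFun f S := avg K fun φ => f (S.image φ)
  map_add' f g := by ext S; exact map_add (avg _) _ _
  map_smul' c f := by ext S; exact map_smul (avg _) _ _

theorem flowOp_apply (K : V → V → ℝ) (f : Finset V → ℝ) (S : Finset V) :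
    flowOp K f S = avg K fun φ => f (S.image φ) := rfl

theorem flowOp_pow_succ (K : V → V → ℝ) (n : ℕ) (f : Finset V → ℝ) :
    (flowOp K ^ (n + 1)) f = flowOp K ((flowOp K ^ n) f) := by
  rw [pow_succ', Module.End.mul_apply]

theorem flowOp_pow_add (K : V → V → ℝ) (n k : ℕ) (f : Finset V → ℝ) :
    (flowOp K ^ (n + k)) f = (flowOp K ^ n) ((flowOp K ^ k) f) := by
  rw [pow_add, Module.End.mul_apply]

/-- The indicator that two sites are occupied. -/
def twoInd (S : Finset V) : ℝ := if 2 ≤ S.card then 1 else 0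

theorem twoInd_mono : Monotone (twoInd (V := V)) := by
  intro S T h
  have := Finset.card_le_card h
  simp only [twoInd]
  split_ifs
  · exact le_rfl
  · omega
  · exact zero_le_one
  · exact le_rfl

theorem twoInd_nonneg (S : Finset V) : 0 ≤ twoInd S := by
  simp only [twoInd]; split_ifs <;> norm_num

theorem twoInd_le_one (S : Finset V) : twoInd S ≤ 1 := by
  simp only [twoInd]; split_ifs <;> norm_num

variable {K : V → V → ℝ} (hK : ∀ x, K x ∈ stdSimplex ℝ V)
include hK

theorem flowOp_pow_le {f g : Finset V → ℝ} (h : ∀ S, f S ≤ g S) (n : ℕ) (S : Finset V) :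
    (flowOp K ^ n) f S ≤ (flowOp K ^ n) g S := by
  induction n generalizing S with
  | zero => simpa using h S
  | succ n ih =>
    rw [flowOp_pow_succ, flowOp_pow_succ]
    exact avg_mono hK fun φ => ih _

theorem flowOp_pow_const (c : ℝ) (n : ℕ) (S : Finset V) :
    (flowOp K ^ n) (fun _ => c) S = c := by
  induction n generalizing S with
  | zero => simp
  | succ n ih =>
    rw [flowOp_pow_succ, flowOp_apply]
    simp only [ih]
    exact avg_const hK c

theorem flowOp_pow_monotone {f : Finset V → ℝ} (h : Monotone f) (n : ℕ) :
    Monotone ((flowOp K ^ n) f) := by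
  induction n with
  | zero => simpa using h
  | succ n ih =>
    intro S T hST
    rw [flowOp_pow_succ]
    exact avg_mono hK fun φ => ih (Finset.image_subset_image hST)

/-- The same random map moves both sets, and images commute with unions. -/
theorem flowOp_pow_subadditive {f : Finset V → ℝ} (h : ∀ S T, f (S ∪ T) ≤ f S + f T) (n : ℕ)
    (S T : Finset V) : (flowOp K ^ n) f (S ∪ T) ≤ (flowOp K ^ n) f S + (flowOp K ^ n) f T := by
  induction n generalizing S T with
  | zero => simpa using h S T
  | succ n ih =>
    rw [flowOp_pow_succ, flowOp_apply, flowOp_apply, flowOp_apply, ← map_add]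
    refine avg_mono hK fun φ => ?_
    rw [Finset.image_union]
    exact ih _ _

theorem flowOp_pow_eq_zero {f : Finset V → ℝ} {k : ℕ} (h : ∀ S : Finset V, S.card < k → f S = 0)
    (n : ℕ) (S : Finset V) (hS : S.card < k) : (flowOp K ^ n) f S = 0 := by
  induction n generalizing S with
  | zero => simpa using h S hS
  | succ n ih =>
    rw [flowOp_pow_succ, flowOp_apply]
    have : (fun φ : V → V => (flowOp K ^ n) f (S.image φ)) = fun _ => 0 := by
      ext φ; exact ih _ (Finset.card_image_le.trans_lt hS)
    rw [this, avg_const hK]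

theorem flowOp_pow_card_le (n : ℕ) (S : Finset V) :
    (flowOp K ^ n) (fun S => (S.card : ℝ)) S ≤ S.card := by
  induction n generalizing S with
  | zero => simp
  | succ n ih =>
    rw [flowOp_pow_succ]
    refine avg_le_const hK fun φ => (ih _).trans ?_
    exact_mod_cast Finset.card_image_le

theorem flowOp_pow_twoInd_nonneg (n : ℕ) (S : Finset V) : 0 ≤ (flowOp K ^ n) twoInd S :=
  (flowOp_pow_const hK 0 n S).symm.trans_le (flowOp_pow_le hK twoInd_nonneg n S)

theorem flowOp_pow_twoInd_le_one (n : ℕ) (S : Finset V) : (flowOp K ^ n) twoInd S ≤ 1 :=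
  (flowOp_pow_le hK twoInd_le_one n S).trans_eq (flowOp_pow_const hK 1 n S)

/-- The non-coalescence probabilities are submultiplicative in time. -/
theorem flowOp_pow_add_twoInd_le (n k : ℕ) (S : Finset V) :
    (flowOp K ^ (n + k)) twoInd S
      ≤ (flowOp K ^ k) twoInd Finset.univ * (flowOp K ^ n) twoInd S := by
  rw [flowOp_pow_add, ← smul_eq_mul, ← Pi.smul_apply, ← map_smul]
  refine flowOp_pow_le hK (fun T => ?_) n S
  rw [Pi.smul_apply, smul_eq_mul]
  -- By monotonicity, restarting from all of `V` after `n` steps can only increase the probability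
  -- of not having coalesced; a set with at most one site stays so.
  by_cases hT : 2 ≤ T.card
  · have : twoInd T = 1 := if_pos hT
    rw [this, mul_one]
    exact flowOp_pow_monotone hK twoInd_mono k (Finset.subset_univ T)
  · rw [flowOp_pow_eq_zero hK (f := twoInd) (k := 2) (fun S hS => if_neg (by omega)) k T (not_le.1 hT)]
    exact mul_nonneg (flowOp_pow_twoInd_nonneg hK k _) (twoInd_nonneg T)

/-! ### Surviving walkers and the flow on occupied sets -/

section Tuple

variable {ι : Type*} [Fintype ι] [LinearOrder ι]

/-- Walkers at distinct sites read distinct coordinates of the random map, so moving walkers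
independently is the same as moving sites independently. -/
theorem avg_image {x : ι → V} {A : Finset ι} (hA : InjOn x A) (f : Finset V → ℝ) :
    avg (fun i => K (x i)) (fun y => f (A.image y)) = flowOp K f (A.image x) := by
  set g : (A → V) → ℝ := fun z => f (Finset.univ.image z) with hg
  have h1 : (fun y : ι → V => f (A.image y)) = fun y => g (fun k : A => y k) := by
    ext y
    simp only [hg]
    congr 1
    ext v
    simp
  have h2 : (fun φ : V → V => f ((A.image x).image φ)) = fun φ => g (fun k : A => φ (x k)) := by
    ext y
    simp only [hg]
    congr 1
    ext v
    simp
  rw [flowOp_apply, h1, h2, avg_comp (fun i => hK (x i)) Subtype.val_injective g,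
    avg_comp hK (e := fun k : A => x k) (fun a b hab => Subtype.ext (hA a.2 b.2 hab)) g]

theorem tupleOp_pow_image (f : Finset V → ℝ) (n : ℕ) {x : ι → V} {A : Finset ι}
    (hA : InjOn x A) :
    (tupleOp K ^ n) (fun x A => f (A.image x)) x A = (flowOp K ^ n) f (A.image x) := by
  induction n generalizing x A with
  | zero => simp
  | succ n ih =>
    rw [pow_succ', Module.End.mul_apply, tupleOp_apply, flowOp_pow_succ, ← avg_image hK hA]
    congr 1
    ext y
    rw [ih (prune_injOn y A), image_prune]

theorem tupleMean_card {π : V → ℝ} (hπ : π ∈ stdSimplex ℝ V) (φ : ℕ → ℝ) (n : ℕ) :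
    tupleMean (ι := ι) K π n (fun _ A => φ A.card)
      = avg (fun _ => π) fun x : ι → V =>
        (flowOp K ^ n) (fun S => φ S.card) (Finset.univ.image x) := by
  have h1 : tupleMean (ι := ι) K π n (fun _ A => φ A.card)
      = tupleMean (ι := ι) K π n (fun x A => φ (A.image x).card) := by
    refine le_antisymm ?_ ?_ <;> refine tupleMean_mono hK hπ (fun x A hA => ?_) n <;>
      rw [Finset.card_image_of_injOn hA]
  rw [h1, tupleMean_apply]
  congr 1
  ext x
  rw [tupleOp_pow_image hK (fun S => φ S.card) n (prune_injOn x _), image_prune]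

/-- Survivors occupy a subset of the sites of the independent walks, and `u` is monotone; removals
may therefore be ignored. -/
theorem flowOp_pow_image_le {u : Finset V → ℝ} (hu : Monotone u) (n : ℕ) (x : ι → V) :
    (flowOp K ^ n) u (Finset.univ.image x)
      ≤ avg (fun i => kpow K n (x i)) fun y => u (Finset.univ.image y) := by
  induction n generalizing x with
  | zero =>
    rw [avg_apply, Finset.sum_eq_single x]
    · simp [kpow]
    · intro y _ hy
      obtain ⟨i, hi⟩ := Function.ne_iff.1 hy
      rw [Finset.prod_eq_zero (Finset.mem_univ i) (by simp [kpow, hi.symm]), zero_mul]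
    · simp
  | succ n ih =>
    rw [flowOp_pow_succ, ← image_prune x Finset.univ, ← avg_image hK (prune_injOn x _)]
    calc _ ≤ avg (fun i => K (x i)) fun y => (flowOp K ^ n) u (Finset.univ.image y) :=
          avg_mono (fun i => hK _) fun y => flowOp_pow_monotone hK hu n
            (Finset.image_subset_image (Finset.subset_univ _))
      _ ≤ avg (fun i => K (x i)) fun y =>
            avg (fun i => kpow K n (y i)) fun y => u (Finset.univ.image y) :=
          avg_mono (fun i => hK _) ih
      _ = _ := avg_avg (fun i => K (x i)) (fun _ => kpow K n) _

end Tuple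

omit hK in
theorem exists_subset_image [Nonempty V] {k : ℕ} {S : Finset V} (hS : S.card ≤ k) :
    ∃ x : Fin k → V, S ⊆ Finset.univ.image x := by
  refine ⟨fun i => if h : (i : ℕ) < S.card then S.equivFin.symm ⟨i, h⟩ else Classical.arbitrary V,
    fun v hv => ?_⟩
  have hlt := (S.equivFin ⟨v, hv⟩).2
  refine Finset.mem_image.2 ⟨⟨S.equivFin ⟨v, hv⟩, hlt.trans_le hS⟩, Finset.mem_univ _, ?_⟩
  simp

end Flow

/-! ### The initial stage: reducing the number of walkers -/

namespace IsMixingKernel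

variable {V : Type*} [Fintype V] [DecidableEq V] {K : V → V → ℝ} {π : V → ℝ} {pm ρ δ : ℝ} {R : ℕ}
  (hC : IsMixingKernel K π pm ρ δ R)
include hC

/-- After the mixing time, few coalescing walkers are dominated by stationary ones. -/
theorem flowOp_pow_le_stationary {u : Finset V → ℝ} (hu : Monotone u) {k : ℕ} {B : ℝ}
    (hB : ∀ y : Fin k → V, 0 ≤ u (Finset.univ.image y) ∧ u (Finset.univ.image y) ≤ B)
    {S : Finset V} (hS : S.card ≤ k) :
    (flowOp K ^ R) u S ≤ avg (fun _ : Fin k => π) (fun y => u (Finset.univ.image y))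
      + k * δ * B := by
  have := hC.nonempty
  obtain ⟨x, hx⟩ := exists_subset_image hS
  have h1 := (flowOp_pow_monotone hC.stoch hu R hx).trans (flowOp_pow_image_le hC.stoch hu R x)
  have h2 := abs_avg_sub_avg_le (δ := δ) (B := B) (p := fun i => kpow K R (x i))
    (q := fun _ : Fin k => π) (fun i => pow_stoch hC.stoch R _) (fun _ => hC.prob)
    (fun i => hC.mix (x i) B) (fun y => u (Finset.univ.image y)) hB
  linarith [(abs_le.1 h2).2]

theorem avg_twoInd_le (k n : ℕ) :
    avg (fun _ : Fin k => π) (fun y => (flowOp K ^ n) twoInd (Finset.univ.image y))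
      ≤ (flowOp K ^ n) twoInd Finset.univ :=
  avg_le_const (fun _ => hC.prob) fun _ =>
    flowOp_pow_monotone hC.stoch twoInd_mono n (Finset.subset_univ _)

/-- Contraction of the number of walkers over a time `R + t`. -/
theorem flowOp_pow_card_contract {κ t : ℕ} (hκ : 0 < κ)
    (ht : tupleMean (ι := Fin κ) K π t (fun _ A => (A.card : ℝ)) ≤ 3 / 4 * κ)
    (hδ : κ * δ ≤ 1 / 8) (S : Finset V) :
    (flowOp K ^ (R + t)) (fun S => (S.card : ℝ)) S ≤ 7 / 8 * S.card + κ / 8 := by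
  -- After `R` steps at most `κ` walkers are nearly stationary, and `t` further steps leave at most
  -- `3 / 4 * κ` in mean. The mixing defect `κ * δ * κ` is at most `κ / 8`.
  have hsmall : ∀ S : Finset V, S.card ≤ κ →
      (flowOp K ^ (R + t)) (fun S => (S.card : ℝ)) S ≤ 7 / 8 * κ := by
    intro S hS
    rw [flowOp_pow_add]
    have hmono : Monotone fun S : Finset V => (S.card : ℝ) := fun S T h =>
      Nat.cast_le.2 (Finset.card_le_card h)
    have h0 : ∀ T : Finset V, 0 ≤ (flowOp K ^ t) (fun S => (S.card : ℝ)) T := fun T =>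
      (flowOp_pow_const hC.stoch 0 t T).symm.trans_le
        (flowOp_pow_le hC.stoch (fun S => Nat.cast_nonneg _) t T)
    have h1 := hC.flowOp_pow_le_stationary (flowOp_pow_monotone hC.stoch hmono t) (k := κ)
      (B := κ) (fun y => ⟨h0 _, (flowOp_pow_card_le hC.stoch t _).trans (by
        have := Finset.card_image_le (s := (Finset.univ : Finset (Fin κ))) (f := y)
        rw [Finset.card_univ, Fintype.card_fin] at this
        exact_mod_cast this)⟩) hS
    rw [← tupleMean_card hC.stoch hC.prob (fun k => (k : ℝ)) t] at h1
    have hκ' : (0 : ℝ) < κ := by exact_mod_cast hκ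
    nlinarith
  induction hc : S.card using Nat.strong_induction_on generalizing S with
  | _ c ih =>
    by_cases hlt : S.card < κ
    · refine (flowOp_pow_card_le hC.stoch _ S).trans ?_
      have : (c : ℝ) ≤ κ := by exact_mod_cast (hc ▸ hlt.le)
      rw [hc]; linarith
    -- Blocks of `κ` walkers are split off, and subadditivity allows each to be treated alone. The
    -- incomplete last block is not contracted, which accounts for the term `κ / 8`.
    · obtain ⟨T, hTS, hT⟩ := Finset.exists_subset_card_eq (not_lt.1 hlt)
      have hcard : (S \ T).card = c - κ := by rw [Finset.card_sdiff_of_subset hTS, hc, hT]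
      have hle : κ ≤ c := hc ▸ not_lt.1 hlt
      have h1 := ih (c - κ) (by omega) (S \ T) hcard
      have h2 := hsmall T hT.le
      have h3 := flowOp_pow_subadditive hC.stoch (f := fun S : Finset V => (S.card : ℝ))
        (fun S T => by exact_mod_cast Finset.card_union_le S T) (R + t) T (S \ T)
      rw [Finset.union_sdiff_of_subset hTS] at h3
      rw [Nat.cast_sub hle] at h1
      linarith

/-- After `r` rounds, at least `2 κ` walkers are left only with small probability. -/
theorem flowOp_pow_many_le {κ t : ℕ} (hκ : 0 < κ)
    (ht : tupleMean (ι := Fin κ) K π t (fun _ A => (A.card : ℝ)) ≤ 3 / 4 * κ)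
    (hδ : κ * δ ≤ 1 / 8) (r : ℕ) (S : Finset V) :
    (flowOp K ^ ((R + t) * r)) (fun S => if 2 * κ ≤ S.card then 1 else 0) S
      ≤ (15 / 16) ^ r * S.card := by
  -- With at least `2 * κ` walkers, `7 / 8 * c + κ / 8 ≤ 15 / 16 * c`. Truncating the count below `2
  -- * κ` gives a contraction everywhere, since the number of walkers never grows.
  set v : Finset V → ℝ := fun S => if 2 * κ ≤ S.card then (S.card : ℝ) else 0 with hv
  have hv0 : ∀ S, 0 ≤ v S := fun S => by simp only [hv]; split_ifs <;> positivity
  have h1 : ∀ S, (flowOp K ^ (R + t)) v S ≤ 15 / 16 * v S := by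
    intro S
    by_cases hS : 2 * κ ≤ S.card
    · have e1 := flowOp_pow_le hC.stoch (f := v) (g := fun S => (S.card : ℝ)) (fun S => by
        simp only [hv]; split_ifs
        · exact le_rfl
        · positivity) (R + t) S
      have e2 := hC.flowOp_pow_card_contract hκ ht hδ S
      have e3 : v S = S.card := if_pos hS
      have e4 : (2 * κ : ℝ) ≤ S.card := by exact_mod_cast hS
      rw [e3]; linarith
    · rw [flowOp_pow_eq_zero hC.stoch (k := 2 * κ) (fun T hT => if_neg (not_le.2 hT)) _ S
        (not_le.1 hS)]
      linarith [hv0 S]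
  have h2 : ∀ r S, (flowOp K ^ ((R + t) * r)) v S ≤ (15 / 16) ^ r * v S := by
    intro r
    induction r with
    | zero => intro S; simp
    | succ r ih =>
      intro S
      rw [Nat.mul_succ, flowOp_pow_add]
      calc _ ≤ (flowOp K ^ ((R + t) * r)) ((15 / 16 : ℝ) • v) S := flowOp_pow_le hC.stoch h1 _ S
        _ = 15 / 16 * (flowOp K ^ ((R + t) * r)) v S := by rw [map_smul]; rfl
        _ ≤ 15 / 16 * ((15 / 16) ^ r * v S) := mul_le_mul_of_nonneg_left (ih S) (by norm_num)
        _ = _ := by ring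
  calc _ ≤ (flowOp K ^ ((R + t) * r)) v S := flowOp_pow_le hC.stoch (fun S => by
        simp only [hv]; split_ifs with h
        · have : 1 ≤ S.card := by omega
          exact_mod_cast this
        · exact le_rfl) _ S
    _ ≤ (15 / 16) ^ r * v S := h2 r S
    _ ≤ _ := mul_le_mul_of_nonneg_left (by
        simp only [hv]; split_ifs
        · exact le_rfl
        · positivity) (by positivity)

/-- In `r` rounds the number of walkers falls below `2 * κ`, except with the last probability on the
right; `R` steps then replace the remaining walkers by `2 * κ` stationary ones, at the cost `2 * κ *
δ`, and these have `n` steps left to coalesce. -/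
theorem flowOp_pow_twoInd_le {κ t : ℕ} (hκ : 0 < κ)
    (ht : tupleMean (ι := Fin κ) K π t (fun _ A => (A.card : ℝ)) ≤ 3 / 4 * κ)
    (hδ : κ * δ ≤ 1 / 8) (hδ0 : 0 ≤ δ) (r n : ℕ) :
    (flowOp K ^ ((R + t) * r + R + n)) twoInd Finset.univ
      ≤ avg (fun _ : Fin (2 * κ) => π)
          (fun y => (flowOp K ^ n) twoInd (Finset.univ.image y))
        + 2 * κ * δ + (15 / 16) ^ r * Fintype.card V := by
  set F := avg (fun _ : Fin (2 * κ) => π)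
    (fun y => (flowOp K ^ n) twoInd (Finset.univ.image y)) with hF
  have hF0 : 0 ≤ F := avg_nonneg (fun _ => hC.prob) fun y => flowOp_pow_twoInd_nonneg hC.stoch n _
  have h1 : ∀ S, (flowOp K ^ R) ((flowOp K ^ n) twoInd) S
      ≤ ((fun _ => F + 2 * κ * δ) + fun S => if 2 * κ ≤ S.card then 1 else 0 :
        Finset V → ℝ) S := by
    intro S
    simp only [Pi.add_apply]
    split_ifs with hS
    · rw [← flowOp_pow_add]
      have := flowOp_pow_twoInd_le_one hC.stoch (R + n) S
      have : 0 ≤ 2 * κ * δ := by positivity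
      linarith
    · have := hC.flowOp_pow_le_stationary
        (flowOp_pow_monotone hC.stoch twoInd_mono n) (k := 2 * κ) (B := 1)
        (fun y => ⟨flowOp_pow_twoInd_nonneg hC.stoch n _, flowOp_pow_twoInd_le_one hC.stoch n _⟩)
        (not_le.1 hS).le
      push_cast at this
      linarith
  rw [add_assoc, flowOp_pow_add, flowOp_pow_add]
  refine (flowOp_pow_le hC.stoch h1 _ _).trans ?_
  rw [map_add, Pi.add_apply, flowOp_pow_const hC.stoch]
  have := hC.flowOp_pow_many_le hκ ht hδ r Finset.univ
  rw [Finset.card_univ] at this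
  linarith

end IsMixingKernel

/-! ### Stationary walkers and the mean-field tails -/

/-- The properties of the tails `g k x` of the mean-field coalescence times of `k` walkers. -/
structure IsMeanFieldTail (g : ℕ → ℝ → ℝ) : Prop where
  nonneg : ∀ k x, 0 ≤ g k x
  le_one : ∀ k x, g k x ≤ 1
  mono : ∀ k x, g (k - 1) x ≤ g k x
  one : ∀ k x, k ≤ 1 → 0 ≤ x → g k x = 0
  zero : ∀ k, 2 ≤ k → g k 0 = 1
  lipschitz : ∀ k u s, 0 ≤ u → 0 ≤ s → |g k (u + s) - g k u| ≤ (k.choose 2 : ℕ) * s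
  backward : ∀ k u s, 0 ≤ u → 0 ≤ s →
    |g k (u + s) - g k u + s * (k.choose 2 : ℕ) * (g k u - g (k - 1) u)|
      ≤ 2 * ((k.choose 2 : ℕ) * s) ^ 2

namespace IsMixingKernel

variable {ι V : Type*} [Fintype ι] [LinearOrder ι] [Fintype V] [DecidableEq V]
  {K : V → V → ℝ} {π : V → ℝ} {pm ρ δ : ℝ} {R : ℕ} (hC : IsMixingKernel K π pm ρ δ R)
include hC

/-- The underlying walks are stationary at every time, so each pair contributes at most `η`; the sum
over surviving pairs is bounded by the sum over all pairs. -/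
theorem abs_tupleMean_corrected_sub_le {η : ℝ}
    (hη : ∀ z, ∑ y, π y * |meet K z y / meanMeet K π - 1| ≤ η) {α : ℕ → ℝ}
    (hα : ∀ k, |α k - α (k - 1)| ≤ 1) (n : ℕ) :
    |tupleMean (ι := ι) K π n (corrected α fun x y => meet K x y / meanMeet K π)
      - tupleMean (ι := ι) K π n (fun _ A => α A.card)|
      ≤ (((Fintype.card ι).choose 2 : ℕ) : ℝ) * η := by
  set h : V → V → ℝ := fun x y => meet K x y / meanMeet K π with hh
  set U : Finset (ι × ι) := pairs Finset.univ with hU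
  have hUcard : (U.card : ℝ) = (((Fintype.card ι).choose 2 : ℕ) : ℝ) := by
    rw [hU, card_pairs, Finset.card_univ]
  rw [← map_sub]
  have h1 : ∀ (x : ι → V) (A : Finset ι), InjOn x A →
      |(corrected α h - fun _ A => α A.card : (ι → V) → Finset ι → ℝ) x A|
        ≤ (∑ p ∈ U, fun (x : ι → V) (_ : Finset ι) => |h (x p.1) (x p.2) - 1| :
          (ι → V) → Finset ι → ℝ) x A := by
    intro x A _
    simp only [Pi.sub_apply, corrected, add_sub_cancel_left, abs_mul, Finset.sum_apply]
    calc _ ≤ 1 * ∑ p ∈ pairs A, |h (x p.1) (x p.2) - 1| :=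
          mul_le_mul (hα _) (Finset.abs_sum_le_sum_abs _ _) (abs_nonneg _) zero_le_one
      _ = ∑ p ∈ pairs A, |h (x p.1) (x p.2) - 1| := one_mul _
      _ ≤ _ := Finset.sum_le_sum_of_subset_of_nonneg (pairs_mono (Finset.subset_univ A))
          fun _ _ _ => abs_nonneg _
  refine (abs_tupleMean_le hC.stoch hC.prob h1 n).trans ?_
  rw [map_sum, ← hUcard]
  calc _ ≤ ∑ p ∈ U, η := Finset.sum_le_sum fun p hp => by
        rw [tupleMean_fst hC.stoch hC.prob hC.stat]
        exact hC.avg_abs_pair_le hη (mem_pairs.1 hp).2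
    _ = _ := by rw [Finset.sum_const, nsmul_eq_mul]

/-- Nobody is removed at time zero unless some pair starts at a common site, which has probability
`∑ π a ^ 2 ≤ pm` for each pair. -/
theorem abs_tupleMean_zero_sub_le {α : ℕ → ℝ} (h0 : ∀ k, 0 ≤ α k) (h1 : ∀ k, α k ≤ 1) :
    |tupleMean (ι := ι) K π 0 (fun _ A => α A.card) - α (Fintype.card ι)|
      ≤ (((Fintype.card ι).choose 2 : ℕ) : ℝ) * pm := by
  set U : Finset (ι × ι) := pairs Finset.univ with hU
  have hUcard : (U.card : ℝ) = (((Fintype.card ι).choose 2 : ℕ) : ℝ) := by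
    rw [hU, card_pairs, Finset.card_univ]
  rw [tupleMean_apply]
  have e1 : (avg (fun _ : ι => π) fun x => (tupleOp K ^ 0) (fun _ A => α A.card) x
      (prune x Finset.univ)) - α (Fintype.card ι)
      = avg (fun _ : ι => π) fun x =>
        α (prune x Finset.univ).card - α (Fintype.card ι) := by
    have : (fun x : ι → V => α (prune x Finset.univ).card - α (Fintype.card ι))
        = (fun x => α (prune x Finset.univ).card) - fun _ => α (Fintype.card ι) := rfl
    rw [this, map_sub, avg_const fun _ => hC.prob]
    simp
  rw [e1]
  refine (abs_avg_le (fun _ => hC.prob) _).trans ?_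
  calc _ ≤ avg (fun _ : ι => π)
        (∑ p ∈ U, fun x : ι → V => if x p.1 = x p.2 then (1 : ℝ) else 0) := by
        refine avg_mono (fun _ => hC.prob) fun x => ?_
        rw [Finset.sum_apply]
        have hnn : ∀ p ∈ U, (0 : ℝ) ≤ if x p.1 = x p.2 then 1 else 0 := fun p _ => by
          split_ifs <;> norm_num
        by_cases hx : InjOn x (Finset.univ : Finset ι)
        · rw [prune_eq_self hx, Finset.card_univ, sub_self, abs_zero]
          exact Finset.sum_nonneg hnn
        · have : ∃ p ∈ U, x p.1 = x p.2 := by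
            simp only [InjOn, not_forall] at hx
            obtain ⟨i, _, j, _, hij, hne⟩ := hx
            rcases lt_or_gt_of_ne hne with h | h
            · exact ⟨(i, j), mem_pairs.2 ⟨⟨Finset.mem_univ _, Finset.mem_univ _⟩, h⟩, hij⟩
            · exact ⟨(j, i), mem_pairs.2 ⟨⟨Finset.mem_univ _, Finset.mem_univ _⟩, h⟩, hij.symm⟩
          obtain ⟨p, hp, hpx⟩ := this
          have e2 := Finset.single_le_sum hnn hp
          rw [if_pos hpx] at e2
          refine le_trans ?_ e2
          rw [abs_le]
          constructor <;>
            linarith [h0 (prune x Finset.univ).card, h1 (prune x Finset.univ).card,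
              h0 (Fintype.card ι), h1 (Fintype.card ι)]
    _ = ∑ p ∈ U, ∑ a, π a * π a := by
        rw [map_sum]
        refine Finset.sum_congr rfl fun p hp => ?_
        have := avg_pair (fun _ : ι => hC.prob) (mem_pairs.1 hp).2.ne
          (fun a b => if a = b then (1 : ℝ) else 0)
        rw [this, pairAvg_apply]
        simp
    _ ≤ ∑ p ∈ U, pm := Finset.sum_le_sum fun p _ => by
        calc _ ≤ ∑ a, π a * pm := Finset.sum_le_sum fun a _ =>
              mul_le_mul_of_nonneg_left (hC.le_pm a) (hC.prob.1 a)
          _ = pm := by rw [← Finset.sum_mul, hC.prob.2, one_mul]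
    _ = _ := by rw [Finset.sum_const, nsmul_eq_mul, hUcard]

/-- The coalescence time of stationary walkers has nearly the mean-field tail. -/
theorem abs_avg_twoInd_sub_le {g : ℕ → ℝ → ℝ} (hg : IsMeanFieldTail g) (hδ : δ < 1 / 2)
    (hm : 0 < meanMeet K π) {η : ℝ}
    (hη : ∀ z, ∑ y, π y * |meet K z y / meanMeet K π - 1| ≤ η) (hpm : pm ≤ η)
    (hmη : 1 ≤ η * meanMeet K π) {k : ℕ} (hk : 2 ≤ k) (t : ℕ) :
    |avg (fun _ : Fin k => π) (fun y => (flowOp K ^ t) twoInd (Finset.univ.image y))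
      - g k (t / meanMeet K π)|
      ≤ 5 * ((k.choose 2 : ℕ) : ℝ) ^ 2 * η * (1 + t / meanMeet K π) := by
  set m := meanMeet K π with hmdef
  set Λ : ℝ := ((k.choose 2 : ℕ) : ℝ) with hΛ
  have hΛ1 : 1 ≤ Λ := by
    have : 1 ≤ k.choose 2 := Nat.choose_pos hk
    rw [hΛ]; exact_mod_cast this
  have hη0 : 0 < η := hC.pm_pos.trans_le hpm
  -- The test function at step `n` is the mean-field tail at the remaining time, so that the
  -- backward equation nearly cancels its drift. For `n ≥ t` the truncated subtraction makes it
  -- constant in `n`.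
  set a : ℕ → ℕ → ℝ := fun n k => g k (((t - n : ℕ) : ℝ) / m) with ha
  have hxn : ∀ n, 0 ≤ ((t - n : ℕ) : ℝ) / m := fun n => by positivity
  have hx1 : ∀ n, n < t → ((t - n : ℕ) : ℝ) / m = ((t - (n + 1) : ℕ) : ℝ) / m + 1 / m := by
    intro n hn
    rw [← add_div, show t - n = t - (n + 1) + 1 by omega]; push_cast; ring
  have hs : 0 ≤ 1 / m := by positivity
  have hD : ∀ n k, |a n k - a n (k - 1)| ≤ 1 := by
    intro n k
    rw [abs_le]
    have h1 := hg.mono k (((t - n : ℕ) : ℝ) / m)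
    have h2 := hg.le_one k (((t - n : ℕ) : ℝ) / m)
    have h3 := hg.nonneg (k - 1) (((t - n : ℕ) : ℝ) / m)
    simp only [ha]
    constructor <;> linarith
  have hchoose : ∀ j, j ≤ k → ((j.choose 2 : ℕ) : ℝ) ≤ Λ := fun j hj => by
    rw [hΛ]; exact_mod_cast Nat.choose_le_choose 2 hj
  have hθ : ∀ n j, j ≤ Fintype.card (Fin k) →
      |(a (n + 1) j - a (n + 1) (j - 1)) - (a n j - a n (j - 1))| ≤ 2 * Λ / m := by
    intro n j hj
    rw [Fintype.card_fin] at hj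
    rcases Nat.lt_or_ge n t with hn | hn
    · have e1 := hg.lipschitz j _ _ (hxn (n + 1)) hs
      have e2 := hg.lipschitz (j - 1) _ _ (hxn (n + 1)) hs
      rw [← hx1 n hn] at e1 e2
      have e3 := mul_le_mul_of_nonneg_right (hchoose j hj) hs
      have e4 := mul_le_mul_of_nonneg_right (hchoose (j - 1) (by omega)) hs
      have e5 : 2 * Λ / m = Λ * (1 / m) + Λ * (1 / m) := by ring
      rw [e5]
      have e6 : (a (n + 1) j - a (n + 1) (j - 1)) - (a n j - a n (j - 1))
          = (a n (j - 1) - a (n + 1) (j - 1)) - (a n j - a (n + 1) j) := by ring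
      rw [e6]
      refine (abs_sub _ _).trans (add_le_add (e2.trans e4) (e1.trans e3))
    · have e1 : t - (n + 1) = t - n := by omega
      simp only [ha, e1, sub_self, abs_zero]
      positivity
  have hev := hC.abs_evolution_le (ι := Fin k) hδ hm hη hD hθ t
  rw [Fintype.card_fin, ← hΛ, ← hmdef] at hev
  have hfin := hC.abs_tupleMean_corrected_sub_le (ι := Fin k) hη (hD t) t
  have hini := hC.abs_tupleMean_corrected_sub_le (ι := Fin k) hη (hD 0) 0
  have hini2 := hC.abs_tupleMean_zero_sub_le (ι := Fin k) (α := a 0) (fun _ => hg.nonneg _ _)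
    (fun _ => hg.le_one _ _)
  rw [Fintype.card_fin, ← hΛ, ← hmdef] at hfin hini
  rw [Fintype.card_fin, ← hΛ] at hini2
  -- With no time left, the mean-field tail is the indicator of at least two survivors.
  have hat : (fun (_ : Fin k → V) (A : Finset (Fin k)) => a t A.card)
      = fun _ A => (fun j : ℕ => if 2 ≤ j then (1 : ℝ) else 0) A.card := by
    ext _ A
    simp only [ha, Nat.sub_self, Nat.cast_zero, zero_div]
    split_ifs with h
    · exact hg.zero _ h
    · exact hg.one _ _ (by omega) le_rfl
  rw [hat, tupleMean_card hC.stoch hC.prob (fun j : ℕ => if 2 ≤ j then (1 : ℝ) else 0)] at hfin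
  have ha0 : a 0 k = g k (t / m) := by simp [ha]
  rw [ha0] at hini2
  have hres : |∑ n ∈ Finset.range t, tupleMean (ι := Fin k) K π n (fun _ A =>
      a (n + 1) A.card - (A.card.choose 2 : ℕ) / m
        * (a (n + 1) A.card - a (n + 1) (A.card - 1)) - a n A.card)|
      ≤ t * (2 * (Λ * (1 / m)) ^ 2) := by
    refine (Finset.abs_sum_le_sum_abs _ _).trans ?_
    calc _ ≤ ∑ n ∈ Finset.range t, 2 * (Λ * (1 / m)) ^ 2 := by
          refine Finset.sum_le_sum fun n hn => ?_
          refine (abs_tupleMean_le hC.stoch hC.prob (g := fun _ _ => 2 * (Λ * (1 / m)) ^ 2)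
            (fun x A _ => ?_) n).trans_eq (tupleMean_const hC.stoch hC.prob n _)
          have e1 := hg.backward A.card _ _ (hxn (n + 1)) hs
          rw [← hx1 n (Finset.mem_range.1 hn)] at e1
          have e2 : a (n + 1) A.card - (A.card.choose 2 : ℕ) / m
              * (a (n + 1) A.card - a (n + 1) (A.card - 1)) - a n A.card
              = -(g A.card (((t - n : ℕ) : ℝ) / m) - g A.card (((t - (n + 1) : ℕ) : ℝ) / m)
                + 1 / m * (A.card.choose 2 : ℕ) * (g A.card (((t - (n + 1) : ℕ) : ℝ) / m)
                  - g (A.card - 1) (((t - (n + 1) : ℕ) : ℝ) / m))) := by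
            simp only [ha]; ring
          rw [e2, abs_neg]
          refine e1.trans ?_
          have hAk : A.card ≤ k := by simpa using Finset.card_le_univ A
          have := hchoose _ hAk
          gcongr
      _ = _ := by rw [Finset.sum_const, Finset.card_range, nsmul_eq_mul]
  have hgoal : ∀ (F E P Q0 G S : ℝ), |P - Q0 - S| ≤ t * (2 * Λ / m * Λ * η) + 2 * (Λ ^ 2 * η) →
      |P - F| ≤ Λ * η → |Q0 - E| ≤ Λ * η → |E - G| ≤ Λ * pm → |S| ≤ t * (2 * (Λ * (1 / m)) ^ 2) →
      |F - G| ≤ 5 * Λ ^ 2 * η * (1 + t / m) := by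
    intro F E P Q0 G S h1 h2 h3 h4 h5
    have e0 : Λ * η ≤ Λ ^ 2 * η := by nlinarith [mul_pos (by linarith : 0 < Λ) hη0]
    have e1 : Λ * pm ≤ Λ ^ 2 * η := le_trans (by gcongr) e0
    have e2 : (t : ℝ) * (2 * (Λ * (1 / m)) ^ 2) ≤ 2 * (Λ ^ 2 * η * (t / m)) := by
      have : 1 / m ≤ η := by rw [div_le_iff₀ hm]; exact hmη
      calc (t : ℝ) * (2 * (Λ * (1 / m)) ^ 2) = 2 * (Λ ^ 2 * (1 / m) * (t / m)) := by ring
        _ ≤ _ := by gcongr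
    have e3 : (t : ℝ) * (2 * Λ / m * Λ * η) = 2 * (Λ ^ 2 * η * (t / m)) := by ring
    have e4 : 0 ≤ Λ ^ 2 * η * (t / m) := by positivity
    have : |F - G| ≤ |P - F| + |P - Q0 - S| + |Q0 - E| + |E - G| + |S| := by
      have := abs_le.1 (le_refl |P - F|)
      have := abs_le.1 (le_refl |P - Q0 - S|)
      have := abs_le.1 (le_refl |Q0 - E|)
      have := abs_le.1 (le_refl |E - G|)
      have := abs_le.1 (le_refl |S|)
      rw [abs_le]
      constructor <;> linarith
    rw [e3] at h1
    nlinarith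
  exact hgoal _ _ _ _ _ _ hev hfin hini hini2 hres

theorem tupleMean_card_antitone {φ : ℕ → ℝ} (hφ : Monotone φ) {n t : ℕ} (hnt : n ≤ t) :
    tupleMean (ι := ι) K π t (fun _ A => φ A.card) ≤ tupleMean (ι := ι) K π n fun _ A => φ A.card := by
  induction t, hnt using Nat.le_induction with
  | base => exact le_rfl
  | succ t _ ih =>
    rw [tupleMean_succ]
    refine le_trans (tupleMean_mono hC.stoch hC.prob (fun x A _ => ?_) t) ih
    exact avg_le_const (fun i => hC.stoch _) fun y => hφ (Finset.card_le_card (prune_subset y A))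

/-- The number of stationary walkers is reduced by a constant factor after a time `4 m / k`. -/
theorem tupleMean_card_le (hδ : δ < 1 / 2) (hm : 0 < meanMeet K π) {η : ℝ}
    (hη : ∀ z, ∑ y, π y * |meet K z y / meanMeet K π - 1| ≤ η) {k : ℕ} (hk : 3 ≤ k)
    (hkη : 16 * ((k.choose 2 : ℕ) : ℝ) ^ 2 * η ≤ k) {t : ℕ} (ht : 4 * meanMeet K π ≤ k * t) :
    tupleMean (ι := Fin k) K π t (fun _ A => (A.card : ℝ)) ≤ 3 / 4 * k := by
  set m := meanMeet K π with hmdef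
  set Λ : ℝ := ((k.choose 2 : ℕ) : ℝ) with hΛ
  have hΛ1 : 1 ≤ Λ := by
    have : 1 ≤ k.choose 2 := Nat.choose_pos (by omega)
    rw [hΛ]; exact_mod_cast this
  obtain ⟨x₀⟩ := hC.nonempty
  have hη0 : 0 ≤ η := le_trans (Finset.sum_nonneg fun y _ =>
    mul_nonneg (hC.prob.1 y) (abs_nonneg _)) (hη x₀)
  have hD : ∀ j : ℕ, |(j : ℝ) - ((j - 1 : ℕ) : ℝ)| ≤ 1 := by
    intro j
    cases j with
    | zero => simp
    | succ j => simp
  have hev := hC.abs_evolution_le (ι := Fin k) hδ hm hη (a := fun _ j => (j : ℝ)) (θ := 0)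
    (fun _ => hD) (fun _ _ _ => by simp) t
  have hfin := hC.abs_tupleMean_corrected_sub_le (ι := Fin k) hη hD t
  have hini := hC.abs_tupleMean_corrected_sub_le (ι := Fin k) hη hD 0
  rw [Fintype.card_fin, ← hΛ, ← hmdef] at hev hfin hini
  have hini2 : tupleMean (ι := Fin k) K π 0 (fun _ A => (A.card : ℝ)) ≤ k := by
    refine (tupleMean_mono hC.stoch hC.prob (g := fun _ _ => (k : ℝ)) (fun x A _ => ?_) 0).trans_eq
      (tupleMean_const hC.stoch hC.prob 0 _)
    have hAk : A.card ≤ k := by simpa using Finset.card_le_univ A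
    exact_mod_cast hAk
  have hres : (fun (_ : Fin k → V) (A : Finset (Fin k)) => (A.card : ℝ)
      - (A.card.choose 2 : ℕ) / m * ((A.card : ℝ) - ((A.card - 1 : ℕ) : ℝ)) - (A.card : ℝ))
      = (-(1 / m)) • fun _ A => ((A.card.choose 2 : ℕ) : ℝ) := by
    ext x A
    rw [Pi.smul_apply, Pi.smul_apply, smul_eq_mul]
    rcases Nat.eq_zero_or_pos A.card with h | h
    · simp [h]
    · have : ((A.card - 1 : ℕ) : ℝ) = A.card - 1 := by rw [Nat.cast_sub h]; simp
      rw [this]; ring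
  set L := tupleMean (ι := Fin k) K π t (fun _ A => ((A.card.choose 2 : ℕ) : ℝ)) with hL
  have hsum : ∑ n ∈ Finset.range t, tupleMean (ι := Fin k) K π n
      (fun (_ : Fin k → V) (A : Finset (Fin k)) => (A.card : ℝ)
      - (A.card.choose 2 : ℕ) / m * ((A.card : ℝ) - ((A.card - 1 : ℕ) : ℝ)) - (A.card : ℝ))
      ≤ -(t / m) * L := by
    calc _ ≤ ∑ n ∈ Finset.range t, -(1 / m) * L := by
          refine Finset.sum_le_sum fun n hn => ?_
          rw [hres, map_smul, smul_eq_mul]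
          have := hC.tupleMean_card_antitone (ι := Fin k)
            (φ := fun j => ((j.choose 2 : ℕ) : ℝ))
            (fun i j hij => Nat.cast_le.2 (Nat.choose_le_choose 2 hij)) (Finset.mem_range.1 hn).le
          have hm' : 0 ≤ 1 / m := by positivity
          nlinarith
      _ = _ := by rw [Finset.sum_const, Finset.card_range, nsmul_eq_mul]; ring
  set e := tupleMean (ι := Fin k) K π t (fun _ A => (A.card : ℝ)) with he
  -- The tangent line at `k / 2` of the convex function `j * (j - 1) / 2`, which bounds the mean
  -- number of pairs from below by the mean number of survivors.
  have hLe : ((k : ℝ) / 2 - 1 / 2) * e - (k : ℝ) ^ 2 / 8 ≤ L := by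
    have h1 : ((k : ℝ) / 2 - 1 / 2) * e - (k : ℝ) ^ 2 / 8
        = tupleMean (ι := Fin k) K π t (((k : ℝ) / 2 - 1 / 2) •
          (fun (_ : Fin k → V) (A : Finset (Fin k)) => (A.card : ℝ))
          - fun _ _ => (k : ℝ) ^ 2 / 8) := by
      rw [map_sub, map_smul, tupleMean_const hC.stoch hC.prob, smul_eq_mul]
    rw [h1]
    refine tupleMean_mono hC.stoch hC.prob (fun x A _ => ?_) t
    simp only [Pi.sub_apply, Pi.smul_apply, smul_eq_mul]
    rw [Nat.cast_choose_two]
    nlinarith [sq_nonneg ((A.card : ℝ) - k / 2)]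
  -- If more than `3 / 4 * k` survivors remained in mean, at least `k ^ 2 / 8` pairs would have been
  -- present at all times, by `3 ≤ k`. A drift of at least `k / 2` would have been collected,
  -- whereas the errors amount to at most `k / 4`.
  by_contra hcon
  push Not at hcon
  have hk3 : (3 : ℝ) ≤ k := by exact_mod_cast hk
  have hL8 : (k : ℝ) ^ 2 / 8 ≤ L := by
    have : ((k : ℝ) / 2 - 1 / 2) * (3 / 4 * k) ≤ ((k : ℝ) / 2 - 1 / 2) * e :=
      mul_le_mul_of_nonneg_left hcon.le (by linarith)
    nlinarith
  have htL : (k : ℝ) / 2 ≤ t / m * L := by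
    have h1 : 4 / (k : ℝ) ≤ t / m := by
      rw [div_le_div_iff₀ (by linarith) hm]; linarith
    calc (k : ℝ) / 2 = 4 / k * (k ^ 2 / 8) := by field_simp; norm_num
      _ ≤ _ := mul_le_mul h1 hL8 (by positivity) (by positivity)
  have e0 : Λ * η ≤ Λ ^ 2 * η := by
    have : 0 ≤ Λ * η := by positivity
    nlinarith
  have h1 := (abs_le.1 hev).2
  have h2 := (abs_le.1 hfin).1
  have h3 := (abs_le.1 hini).2
  nlinarith

end IsMixingKernel

/-! ### The mean-field law -/

section MeanField

theorem choose_two_pos (n : ℕ) : (0 : ℝ) < ((n + 2).choose 2 : ℝ) := by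
  exact_mod_cast Nat.choose_pos (by omega : 2 ≤ n + 2)

instance (n : ℕ) : IsProbabilityMeasure (expMeasure ((n + 2).choose 2 : ℝ)) :=
  isProbabilityMeasure_expMeasure (choose_two_pos n)

/-- The joint law of the independent exponential times. -/
def expSeq : Measure (ℕ → ℝ) := Measure.infinitePi fun n : ℕ => expMeasure ((n + 2).choose 2 : ℝ)

instance : IsProbabilityMeasure expSeq := by unfold expSeq; infer_instance

/-- The mean-field coalescence time of `k` walkers. -/
def partialTime (k : ℕ) (z : ℕ → ℝ) : ℝ := ∑ n ∈ Finset.range (k - 1), z n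

/-- The tail of the mean-field coalescence time of `k` walkers. -/
def mfTail (k : ℕ) (x : ℝ) : ℝ := expSeq.real {z | x < partialTime k z}

theorem measurable_partialTime (k : ℕ) : Measurable (partialTime k) :=
  Finset.measurable_sum _ fun n _ => measurable_pi_apply n

theorem expMeasure_real_Ioi {r : ℝ} (hr : 0 < r) (y : ℝ) :
    (expMeasure r).real (Ioi y) = Real.exp (-(r * max y 0)) := by
  have := isProbabilityMeasure_expMeasure hr
  have h1 := cdf_expMeasure_eq hr y
  rw [cdf_eq_real] at h1
  rw [← compl_Iic, probReal_compl_eq_one_sub measurableSet_Iic, h1]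
  split_ifs with h
  · rw [max_eq_left h]; ring
  · rw [max_eq_right (not_le.1 h).le]; simp

theorem expMeasure_Ioi {r : ℝ} (hr : 0 < r) (y : ℝ) :
    expMeasure r (Ioi y) = ENNReal.ofReal (Real.exp (-(r * max y 0))) := by
  have := isProbabilityMeasure_expMeasure hr
  rw [← expMeasure_real_Ioi hr y, ofReal_measureReal]

theorem map_eval_expSeq (n : ℕ) :
    expSeq.map (fun z => z n) = expMeasure ((n + 2).choose 2 : ℝ) :=
  Measure.infinitePi_map_eval (fun n : ℕ => expMeasure ((n + 2).choose 2 : ℝ)) n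

theorem ae_nonneg_expSeq : ∀ᵐ z ∂expSeq, ∀ n, 0 ≤ z n := by
  rw [ae_all_iff]
  intro n
  have h0 : expMeasure ((n + 2).choose 2 : ℝ) (Ioi 0)ᶜ = 0 := by
    rw [prob_compl_eq_zero_iff measurableSet_Ioi, expMeasure_Ioi (choose_two_pos n)]
    simp
  rw [← map_eval_expSeq, Measure.map_apply (measurable_pi_apply n) measurableSet_Ioi.compl] at h0
  filter_upwards [compl_mem_ae_iff.2 h0] with z hz
  simp only [mem_compl_iff, mem_preimage, mem_Ioi, not_not] at hz
  exact hz.le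

theorem partialTime_succ (k : ℕ) (z : ℕ → ℝ) :
    partialTime (k + 2) z = partialTime (k + 1) z + z k := by
  simp [partialTime, Finset.sum_range_succ]

theorem indepFun_partialTime (k : ℕ) :
    IndepFun (partialTime (k + 1)) (fun z : ℕ → ℝ => z k) expSeq := by
  have h := iIndepFun_infinitePi (P := fun n : ℕ => expMeasure ((n + 2).choose 2 : ℝ))
    (X := fun _ x => x) (fun _ => measurable_id)
  have h2 := h.indepFun_finsetSum_of_notMem (fun i => measurable_pi_apply i)
    (s := Finset.range k) (i := k) (by simp)
  have h3 : (∑ j ∈ Finset.range k, fun ω : ℕ → ℝ => ω j) = partialTime (k + 1) := by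
    ext z; simp [partialTime, Finset.sum_apply]
  rw [← h3]
  exact h2

/-- Conditioning on the preceding partial sum, from which the last exponential variable is
independent. -/
theorem mfTail_succ (k : ℕ) (x : ℝ) :
    mfTail (k + 2) x = ∫ z, Real.exp (-(((k + 2).choose 2 : ℝ) *
      max (x - partialTime (k + 1) z) 0)) ∂expSeq := by
  have hS := measurable_partialTime (k + 1)
  have h1 := (indepFun_iff_map_prod_eq_prod_map_map hS.aemeasurable
    (measurable_pi_apply k).aemeasurable).1 (indepFun_partialTime k)
  rw [map_eval_expSeq] at h1
  have hmeas : MeasurableSet {p : ℝ × ℝ | x < p.1 + p.2} :=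
    measurableSet_lt measurable_const (measurable_fst.add measurable_snd)
  have h2 : expSeq {z | x < partialTime (k + 2) z}
      = ∫⁻ z, ENNReal.ofReal (Real.exp (-(((k + 2).choose 2 : ℝ) *
        max (x - partialTime (k + 1) z) 0))) ∂expSeq := by
    have e1 : {z | x < partialTime (k + 2) z}
        = (fun z : ℕ → ℝ => (partialTime (k + 1) z, z k)) ⁻¹' {p : ℝ × ℝ | x < p.1 + p.2} := by
      ext z; simp [partialTime_succ]
    rw [e1, ← Measure.map_apply (hS.prodMk (measurable_pi_apply k)) hmeas, h1,
      Measure.prod_apply hmeas, lintegral_map (measurable_measure_prodMk_left hmeas) hS]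
    refine lintegral_congr fun z => ?_
    rw [← expMeasure_Ioi (choose_two_pos k)]
    congr 1
    ext y
    simp only [mem_preimage, mem_ofPred_eq, mem_Ioi]
    constructor <;> intro h <;> linarith
  rw [mfTail, Measure.real, h2, integral_eq_lintegral_of_nonneg_ae
    (Eventually.of_forall fun z => (Real.exp_pos _).le)]
  have : Measurable fun z => Real.exp (-(((k + 2).choose 2 : ℝ) *
      max (x - partialTime (k + 1) z) 0)) := by fun_prop
  exact this.aestronglyMeasurable

theorem integrable_exp_max {r : ℝ} (hr : 0 < r) (k : ℕ) (x : ℝ) :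
    Integrable (fun z => Real.exp (-(r * max (x - partialTime k z) 0))) expSeq := by
  have hS := measurable_partialTime k
  refine Integrable.of_bound (C := 1) (by fun_prop) (Eventually.of_forall fun z => ?_)
  rw [Real.norm_eq_abs, abs_of_pos (Real.exp_pos _), Real.exp_le_one_iff]
  have := mul_nonneg hr.le (le_max_right (x - partialTime k z) 0)
  linarith

theorem abs_exp_neg_sub_le {a b : ℝ} (ha : 0 ≤ a) (hab : a ≤ b) :
    |Real.exp (-b) - Real.exp (-a)| ≤ b - a := by
  have h1 : Real.exp (-b) = Real.exp (-a) * Real.exp (-(b - a)) := by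
    rw [← Real.exp_add]; congr 1; ring
  have h2 : 1 - (b - a) ≤ Real.exp (-(b - a)) := by
    have := Real.add_one_le_exp (-(b - a)); linarith
  have h3 : Real.exp (-a) ≤ 1 := Real.exp_le_one_iff.2 (by linarith)
  have h4 : Real.exp (-(b - a)) ≤ 1 := Real.exp_le_one_iff.2 (by linarith)
  have h5 := Real.exp_pos (-a)
  rw [h1, abs_le]
  constructor <;> nlinarith

theorem mfTail_of_le_one {k : ℕ} (hk : k ≤ 1) {x : ℝ} (hx : 0 ≤ x) : mfTail k x = 0 := by
  have : ∀ z, partialTime k z = 0 := fun z => by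
    rw [partialTime, show k - 1 = 0 by omega]; simp
  simp [mfTail, this, not_lt.2 hx]

theorem mfTail_lipschitz (k : ℕ) {u s : ℝ} (hu : 0 ≤ u) (hs : 0 ≤ s) :
    |mfTail k (u + s) - mfTail k u| ≤ (k.choose 2 : ℕ) * s := by
  match k with
  | 0 => simp [mfTail_of_le_one, hu, add_nonneg hu hs]
  | 1 => simp [mfTail_of_le_one, hu, add_nonneg hu hs]
  | k + 2 =>
    have hr := choose_two_pos k
    rw [mfTail_succ, mfTail_succ, ← integral_sub (integrable_exp_max hr _ _)
      (integrable_exp_max hr _ _)]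
    refine (abs_integral_le_integral_abs).trans ?_
    refine (integral_mono (g := fun _ => ((k + 2).choose 2 : ℝ) * s)
      ((integrable_exp_max hr _ _).sub (integrable_exp_max hr _ _)).abs
      (integrable_const _) fun z => ?_).trans_eq (by simp)
    set y := u - partialTime (k + 1) z with hy
    have e1 : u + s - partialTime (k + 1) z = y + s := by rw [hy]; ring
    simp only [Pi.sub_apply]
    rw [e1]
    refine (abs_exp_neg_sub_le (mul_nonneg hr.le (le_max_right _ _))
      (mul_le_mul_of_nonneg_left (max_le_max (by linarith) le_rfl) hr.le)).trans ?_
    rw [← mul_sub]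
    refine mul_le_mul_of_nonneg_left ?_ hr.le
    have : max (y + s) 0 ≤ max y 0 + s := max_le (by linarith [le_max_left y 0])
      (by linarith [le_max_right y 0])
    linarith

/-- Here `σ` is a value of the preceding partial sum. For `σ ≤ u` the exponential tail solves the
backward equation up to a Taylor remainder, and for `u + s < σ` everything is constant. Only `u < σ
≤ u + s` gives a first-order error `r * s`, which the difference of the two indicators pays for. -/
theorem backward_pointwise {r u s σ : ℝ} (hr : 0 < r) (hs : 0 ≤ s) :
    |Real.exp (-(r * max (u + s - σ) 0)) - Real.exp (-(r * max (u - σ) 0))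
      + s * r * (Real.exp (-(r * max (u - σ) 0)) - if u < σ then 1 else 0)|
      ≤ (r * s) ^ 2 + r * s * ((if u < σ then 1 else 0) - if u + s < σ then 1 else 0) := by
  have hrs : 0 ≤ r * s := mul_nonneg hr.le hs
  by_cases h1 : u < σ
  · have e1 : max (u - σ) 0 = 0 := max_eq_right (by linarith)
    rw [if_pos h1, e1]
    by_cases h2 : u + s < σ
    · have e2 : max (u + s - σ) 0 = 0 := max_eq_right (by linarith)
      rw [if_pos h2, e2]
      simp only [mul_zero, neg_zero, Real.exp_zero, sub_self, add_zero, abs_zero]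
      positivity
    · have e2 : max (u + s - σ) 0 = u + s - σ := max_eq_left (by linarith)
      rw [if_neg h2, e2]
      have := abs_exp_neg_sub_le le_rfl (mul_nonneg hr.le (by linarith : 0 ≤ u + s - σ))
      simp only [mul_zero, neg_zero, Real.exp_zero, sub_self, add_zero, sub_zero, mul_one] at this ⊢
      refine this.trans ?_
      have h3 : r * (u + s - σ) ≤ r * s := mul_le_mul_of_nonneg_left (by linarith) hr.le
      nlinarith [sq_nonneg (r * s)]
  · have h2 : ¬ u + s < σ := by linarith
    have e1 : max (u - σ) 0 = u - σ := max_eq_left (by linarith)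
    have e2 : max (u + s - σ) 0 = u + s - σ := max_eq_left (by linarith)
    rw [if_neg h1, if_neg h2, e1, e2]
    have e3 : Real.exp (-(r * (u + s - σ)))
        = Real.exp (-(r * (u - σ))) * Real.exp (-(r * s)) := by
      rw [← Real.exp_add]; congr 1; ring
    have e4 : Real.exp (-(r * (u - σ))) ≤ 1 :=
      Real.exp_le_one_iff.2 (by nlinarith [mul_nonneg hr.le (by linarith : 0 ≤ u - σ)])
    have e5 := Real.exp_pos (-(r * (u - σ)))
    have e6 : 0 ≤ Real.exp (-(r * s)) - 1 + r * s := by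
      have := Real.add_one_le_exp (-(r * s)); linarith
    have e7 : Real.exp (-(r * s)) - 1 + r * s ≤ (r * s) ^ 2 := by
      rcases le_or_gt (r * s) 1 with h | h
      · have := Real.abs_exp_sub_one_sub_id_le (x := -(r * s)) (by rw [abs_neg, abs_of_nonneg hrs]; exact h)
        have := (abs_le.1 this).2
        nlinarith
      · have : Real.exp (-(r * s)) ≤ 1 := Real.exp_le_one_iff.2 (by linarith)
        nlinarith
    rw [e3, show ∀ a b : ℝ, a * b - a + s * r * (a - 0) = a * (b - 1 + r * s) by intros; ring,
      abs_of_nonneg (mul_nonneg e5.le e6)]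
    nlinarith

theorem mfTail_eq_integral (k : ℕ) (x : ℝ) :
    mfTail k x = ∫ z, (if x < partialTime k z then (1 : ℝ) else 0) ∂expSeq := by
  have hm : MeasurableSet {z | x < partialTime k z} :=
    measurableSet_lt measurable_const (measurable_partialTime k)
  rw [mfTail, ← integral_indicator_one hm]
  rfl

theorem integrable_ite_partialTime (k : ℕ) (x : ℝ) :
    Integrable (fun z => if x < partialTime k z then (1 : ℝ) else 0) expSeq := by
  refine Integrable.of_bound (C := 1) ?_ (Eventually.of_forall fun z => ?_)
  · exact (Measurable.ite (measurableSet_lt measurable_const (measurable_partialTime k))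
      measurable_const measurable_const).aestronglyMeasurable
  · split_ifs <;> simp

/-- The first-order error of `backward_pointwise` has as factor the probability that the preceding
partial sum lies in a window of length `s`. By the Lipschitz bound this is at most `r * s`, so the
total error is quadratic. -/
theorem mfTail_backward (k : ℕ) {u s : ℝ} (hu : 0 ≤ u) (hs : 0 ≤ s) :
    |mfTail k (u + s) - mfTail k u + s * (k.choose 2 : ℕ) * (mfTail k u - mfTail (k - 1) u)|
      ≤ 2 * ((k.choose 2 : ℕ) * s) ^ 2 := by
  match k with
  | 0 => simp [mfTail_of_le_one, hu, add_nonneg hu hs]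
  | 1 => simp [mfTail_of_le_one, hu, add_nonneg hu hs]
  | k + 2 =>
    have hr := choose_two_pos k
    set r : ℝ := ((k + 2).choose 2 : ℝ) with hrdef
    have i1 := integrable_exp_max hr (k + 1) (u + s)
    have i2 := integrable_exp_max hr (k + 1) u
    have i3 := integrable_ite_partialTime (k + 1) u
    have i4 := integrable_ite_partialTime (k + 1) (u + s)
    have i12 : Integrable (fun z => Real.exp (-(r * max (u + s - partialTime (k + 1) z) 0))
        - Real.exp (-(r * max (u - partialTime (k + 1) z) 0))) expSeq := i1.sub i2
    have i23 : Integrable (fun z => Real.exp (-(r * max (u - partialTime (k + 1) z) 0))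
        - if u < partialTime (k + 1) z then 1 else 0) expSeq := i2.sub i3
    have i34 : Integrable (fun z => (if u < partialTime (k + 1) z then (1 : ℝ) else 0)
        - if u + s < partialTime (k + 1) z then 1 else 0) expSeq := i3.sub i4
    have e1 : mfTail (k + 2) (u + s) - mfTail (k + 2) u
        + s * r * (mfTail (k + 2) u - mfTail (k + 2 - 1) u)
        = ∫ z, (Real.exp (-(r * max (u + s - partialTime (k + 1) z) 0))
            - Real.exp (-(r * max (u - partialTime (k + 1) z) 0))
          + s * r * (Real.exp (-(r * max (u - partialTime (k + 1) z) 0))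
            - if u < partialTime (k + 1) z then 1 else 0)) ∂expSeq := by
      rw [integral_add i12 (i23.const_mul _), integral_sub i1 i2,
        integral_const_mul, integral_sub i2 i3, mfTail_succ, mfTail_succ,
        show k + 2 - 1 = k + 1 by omega, mfTail_eq_integral (k + 1)]
    rw [e1]
    refine abs_integral_le_integral_abs.trans ?_
    refine (integral_mono (g := fun z => (r * s) ^ 2 + r * s *
      ((if u < partialTime (k + 1) z then 1 else 0)
        - if u + s < partialTime (k + 1) z then 1 else 0))
      (i12.add (i23.const_mul _)).abs
      ((integrable_const _).add (i34.const_mul _))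
      fun z => backward_pointwise hr hs).trans ?_
    rw [integral_add (integrable_const _) (i34.const_mul _), integral_const_mul,
      integral_sub i3 i4, ← mfTail_eq_integral, ← mfTail_eq_integral]
    have h1 := (abs_le.1 (mfTail_lipschitz (k + 1) hu hs)).1
    have h2 : (((k + 1).choose 2 : ℕ) : ℝ) ≤ r := by
      rw [hrdef]; exact_mod_cast Nat.choose_le_choose 2 (by omega)
    have h3 : mfTail (k + 1) u - mfTail (k + 1) (u + s) ≤ r * s := by
      have := mul_le_mul_of_nonneg_right h2 hs
      linarith
    have h4 := mul_le_mul_of_nonneg_left h3 (mul_nonneg hr.le hs)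
    simp only [integral_const, probReal_univ, smul_eq_mul, one_mul]
    nlinarith

theorem partialTime_mono {z : ℕ → ℝ} (hz : ∀ n, 0 ≤ z n) {j k : ℕ} (h : j ≤ k) :
    partialTime j z ≤ partialTime k z :=
  Finset.sum_le_sum_of_subset_of_nonneg (Finset.range_mono (by omega)) fun n _ _ => hz n

theorem partialTime_nonneg {z : ℕ → ℝ} (hz : ∀ n, 0 ≤ z n) (k : ℕ) : 0 ≤ partialTime k z :=
  Finset.sum_nonneg fun n _ => hz n

theorem isMeanFieldTail_mfTail : IsMeanFieldTail mfTail where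
  nonneg _ _ := measureReal_nonneg
  le_one _ _ := measureReal_le_one
  mono k x := by
    refine ENNReal.toReal_mono (measure_ne_top _ _) (measure_mono_ae ?_)
    filter_upwards [ae_nonneg_expSeq] with z hz h
    exact lt_of_lt_of_le h (partialTime_mono hz (Nat.sub_le k 1))
  one _ _ hk hx := mfTail_of_le_one hk hx
  zero k hk := by
    obtain ⟨k, rfl⟩ := Nat.exists_eq_add_of_le' hk
    rw [mfTail_succ]
    have : ∀ᵐ z ∂expSeq, Real.exp (-(((k + 2).choose 2 : ℝ) *
        max (0 - partialTime (k + 1) z) 0)) = 1 := by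
      filter_upwards [ae_nonneg_expSeq] with z hz
      rw [max_eq_right (by linarith [partialTime_nonneg hz (k + 1)])]
      simp
    rw [integral_congr_ae this]
    simp
  lipschitz k _ _ hu hs := mfTail_lipschitz k hu hs
  backward k _ _ hu hs := mfTail_backward k hu hs

end MeanField

/-! ### The infinite sum of exponential times: mean and exponential tail -/

section MeanFieldLimit

theorem lintegral_id_expMeasure {r : ℝ} (hr : 0 < r) :
    ∫⁻ y, ENNReal.ofReal y ∂(expMeasure r) = ENNReal.ofReal (1 / r) := by
  have := isProbabilityMeasure_expMeasure hr
  have h0 : expMeasure r (Ioi 0)ᶜ = 0 := by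
    rw [prob_compl_eq_zero_iff measurableSet_Ioi, expMeasure_Ioi hr]
    simp
  have h1 : 0 ≤ᵐ[expMeasure r] fun y : ℝ => y := by
    filter_upwards [compl_mem_ae_iff.2 h0] with y hy
    simp only [mem_compl_iff, mem_Ioi, not_not] at hy
    exact hy.le
  rw [lintegral_eq_lintegral_meas_lt _ h1 measurable_id.aemeasurable]
  have h2 : ∫⁻ t in Ioi (0 : ℝ), expMeasure r {a | t < a}
      = ∫⁻ t in Ioi (0 : ℝ), ENNReal.ofReal (Real.exp (-r * t)) := by
    refine setLIntegral_congr_fun measurableSet_Ioi fun t ht => ?_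
    have := expMeasure_Ioi hr t
    rw [max_eq_left (le_of_lt ht), ← neg_mul] at this
    exact this
  rw [h2, ← ofReal_integral_eq_lintegral_ofReal (integrableOn_exp_mul_Ioi (by linarith) 0)
    (Eventually.of_forall fun t => (Real.exp_pos _).le), integral_exp_mul_Ioi (by linarith)]
  congr 1
  simp

theorem lintegral_exp_half_expMeasure {r : ℝ} (hr : 1 / 2 < r) :
    ∫⁻ y, ENNReal.ofReal (Real.exp (y / 2)) ∂(expMeasure r) = ENNReal.ofReal (r / (r - 1 / 2)) := by
  have h1 : expMeasure r = volume.withDensity (exponentialPDF r) := rfl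
  have hm : Measurable (exponentialPDF r) := (measurable_exponentialPDFReal r).ennreal_ofReal
  have hm' : Measurable (exponentialPDF (r - 1 / 2)) :=
    (measurable_exponentialPDFReal _).ennreal_ofReal
  rw [h1, lintegral_withDensity_eq_lintegral_mul _ hm (by fun_prop)]
  have h2 : ∀ y, (exponentialPDF r * fun y => ENNReal.ofReal (Real.exp (y / 2))) y
      = ENNReal.ofReal (r / (r - 1 / 2)) * exponentialPDF (r - 1 / 2) y := by
    intro y
    have h3 : 0 < r - 1 / 2 := by linarith
    rw [Pi.mul_apply, exponentialPDF_eq, exponentialPDF_eq]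
    split_ifs with hy
    · rw [← ENNReal.ofReal_mul (by positivity), ← ENNReal.ofReal_mul (by positivity)]
      congr 1
      rw [mul_assoc, ← Real.exp_add, ← mul_assoc, div_mul_cancel₀ _ h3.ne']
      congr 2
      ring
    · simp
  simp_rw [h2]
  rw [lintegral_const_mul _ hm', lintegral_exponentialPDF_eq_one (by linarith), mul_one]

theorem lintegral_eval_expSeq (n : ℕ) :
    ∫⁻ z, ENNReal.ofReal (z n) ∂expSeq = ENNReal.ofReal (1 / ((n + 2).choose 2 : ℝ)) := by
  rw [← lintegral_id_expMeasure (choose_two_pos n), ← map_eval_expSeq,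
    lintegral_map ENNReal.measurable_ofReal (measurable_pi_apply n)]

theorem integrable_eval_expSeq (n : ℕ) : Integrable (fun z : ℕ → ℝ => z n) expSeq := by
  refine (lintegral_ofReal_ne_top_iff_integrable (measurable_pi_apply n).aestronglyMeasurable ?_).1
    ?_
  · filter_upwards [ae_nonneg_expSeq] with z hz using hz n
  · rw [lintegral_eval_expSeq]; exact ENNReal.ofReal_ne_top

theorem integral_eval_expSeq (n : ℕ) :
    ∫ z, z n ∂expSeq = 1 / ((n + 2).choose 2 : ℝ) := by
  rw [integral_eq_lintegral_of_nonneg_ae, lintegral_eval_expSeq,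
    ENNReal.toReal_ofReal (one_div_nonneg.2 (choose_two_pos n).le)]
  · filter_upwards [ae_nonneg_expSeq] with z hz using hz n
  · exact (measurable_pi_apply n).aestronglyMeasurable

theorem sum_one_div_choose (k : ℕ) :
    ∑ n ∈ Finset.range k, 1 / ((n + 2).choose 2 : ℝ) = 2 - 2 / (k + 1) := by
  induction k with
  | zero => simp
  | succ k ih =>
    rw [Finset.sum_range_succ, ih, Nat.cast_choose_two]
    push_cast
    rw [show ((k : ℝ) + 2 - 1) = k + 1 by ring, show ((k : ℝ) + 1 + 1) = k + 2 by ring]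
    field_simp
    ring

theorem hasSum_one_div_choose : HasSum (fun n : ℕ => 1 / ((n + 2).choose 2 : ℝ)) 2 := by
  rw [hasSum_iff_tendsto_nat_of_nonneg fun n => one_div_nonneg.2 (choose_two_pos n).le]
  simp_rw [sum_one_div_choose]
  have h := (tendsto_one_div_add_atTop_nhds_zero_nat (𝕜 := ℝ)).const_mul 2
  have h2 := h.const_sub 2
  simp only [mul_zero, sub_zero] at h2
  refine h2.congr fun k => by ring

theorem integrable_partialTime (k : ℕ) : Integrable (partialTime k) expSeq :=
  integrable_finsetSum _ fun n _ => integrable_eval_expSeq n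

theorem integral_partialTime (k : ℕ) : ∫ z, partialTime (k + 1) z ∂expSeq = 2 - 2 / (k + 1) := by
  simp only [partialTime]
  rw [integral_finsetSum _ fun n _ => integrable_eval_expSeq n]
  simp_rw [integral_eval_expSeq]
  exact sum_one_div_choose k

theorem ae_summable_expSeq : ∀ᵐ z ∂expSeq, Summable z := by
  have h1 : ∫⁻ z, ∑' n, ENNReal.ofReal (z n) ∂expSeq ≠ ∞ := by
    rw [lintegral_tsum fun n => (measurable_pi_apply n).ennreal_ofReal.aemeasurable]
    simp_rw [lintegral_eval_expSeq]
    rw [← ENNReal.ofReal_tsum_of_nonneg (fun n => one_div_nonneg.2 (choose_two_pos n).le)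
      hasSum_one_div_choose.summable]
    exact ENNReal.ofReal_ne_top
  have h2 := ae_lt_top' (AEMeasurable.tsum fun n =>
    (measurable_pi_apply n).ennreal_ofReal.aemeasurable) h1
  filter_upwards [h2, ae_nonneg_expSeq] with z hz h0
  have := ENNReal.summable_toReal hz.ne
  refine this.congr fun n => ?_
  rw [ENNReal.toReal_ofReal (h0 n)]

theorem integral_tsum_expSeq : ∫ z, ∑' n, z n ∂expSeq = 2 := by
  rw [← integral_tsum_of_summable_integral_norm integrable_eval_expSeq]
  · simp_rw [integral_eval_expSeq]
    exact hasSum_one_div_choose.tsum_eq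
  · refine hasSum_one_div_choose.summable.congr fun n => ?_
    rw [← integral_eval_expSeq]
    refine integral_congr_ae ?_
    filter_upwards [ae_nonneg_expSeq] with z hz
    rw [Real.norm_of_nonneg (hz n)]

/-- A function that is not integrable has integral `0` by convention, whereas this one has integral
`2`. -/
theorem integrable_tsum_expSeq : Integrable (fun z : ℕ → ℝ => ∑' n, z n) expSeq := by
  by_contra h
  have := integral_tsum_expSeq
  rw [integral_undef h] at this
  norm_num at this

/-- The tail of the mean-field law. -/
def mfLimit (x : ℝ) : ℝ := meanFieldLaw.real (Ioi x)

theorem mfLimit_eq (x : ℝ) : mfLimit x = expSeq.real {z | x < ∑' n, z n} := by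
  rw [mfLimit, Measure.real, meanFieldLaw, ← expSeq,
    Measure.map_apply_of_aemeasurable integrable_tsum_expSeq.aemeasurable measurableSet_Ioi]
  rfl

theorem mfLimit_nonneg (x : ℝ) : 0 ≤ mfLimit x := measureReal_nonneg

theorem mfLimit_antitone : Antitone mfLimit := fun x y h => by
  rw [mfLimit_eq, mfLimit_eq]
  exact measureReal_mono fun z hz => lt_of_le_of_lt h hz

theorem mfLimit_of_neg {x : ℝ} (hx : x < 0) : mfLimit x = 1 := by
  have h : expSeq {z | x < ∑' n, z n} = 1 := by
    rw [← (measure_univ : expSeq univ = 1)]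
    refine measure_congr ?_
    filter_upwards [ae_nonneg_expSeq] with z hz
    exact propext ⟨fun _ => trivial, fun _ => hx.trans_le (tsum_nonneg hz)⟩
  rw [mfLimit_eq, Measure.real, h, ENNReal.toReal_one]

theorem mfTail_le_mfLimit (k : ℕ) (x : ℝ) : mfTail k x ≤ mfLimit x := by
  rw [mfLimit_eq]
  refine ENNReal.toReal_mono (measure_ne_top _ _) (measure_mono_ae ?_)
  filter_upwards [ae_nonneg_expSeq, ae_summable_expSeq] with z hz hs h
  exact lt_of_lt_of_le h (hs.sum_le_tsum _ fun n _ => hz n)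

theorem mfTail_antitone (k : ℕ) : Antitone (mfTail k) := fun _ _ h =>
  measureReal_mono fun _ hz => lt_of_le_of_lt h hz

theorem setIntegral_mfLimit : ∫ x in Ioi 0, mfLimit x = 2 := by
  simp_rw [mfLimit_eq]
  rw [← Integrable.integral_eq_integral_meas_lt integrable_tsum_expSeq, integral_tsum_expSeq]
  filter_upwards [ae_nonneg_expSeq] with z hz
  exact tsum_nonneg hz

theorem integrableOn_mfLimit : IntegrableOn mfLimit (Ioi 0) := by
  by_contra h
  have := setIntegral_mfLimit
  rw [integral_undef h] at this
  norm_num at this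

/-- A time of rate `r` contributes the factor `r / (r - 1 / 2)`, finite because all rates are at
least `1`. The bound `4 - 4 / (k + 2)` is an equality at `k = 0` and is preserved by multiplication
with the next factor. -/
theorem lintegral_exp_partialTime_le (k : ℕ) :
    ∫⁻ z, ENNReal.ofReal (Real.exp (partialTime (k + 2) z / 2)) ∂expSeq
      ≤ ENNReal.ofReal (4 - 4 / (k + 2)) := by
  have step : ∀ k, ∫⁻ z, ENNReal.ofReal (Real.exp (partialTime (k + 2) z / 2)) ∂expSeq
      = (∫⁻ z, ENNReal.ofReal (Real.exp (partialTime (k + 1) z / 2)) ∂expSeq)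
        * ENNReal.ofReal (((k + 2).choose 2 : ℝ) / (((k + 2).choose 2 : ℝ) - 1 / 2)) := by
    intro k
    have hf : Measurable fun s : ℝ => ENNReal.ofReal (Real.exp (s / 2)) := by fun_prop
    have h1 := lintegral_mul_eq_lintegral_mul_lintegral_of_indepFun''
      (hf.comp (measurable_partialTime (k + 1))).aemeasurable
      (hf.comp (measurable_pi_apply k)).aemeasurable ((indepFun_partialTime k).comp hf hf)
    have h2 : ∫⁻ z : ℕ → ℝ, ENNReal.ofReal (Real.exp (z k / 2)) ∂expSeq
        = ENNReal.ofReal (((k + 2).choose 2 : ℝ) / (((k + 2).choose 2 : ℝ) - 1 / 2)) := by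
      have h3 : (1 : ℝ) ≤ ((k + 2).choose 2 : ℝ) := by
        exact_mod_cast Nat.choose_pos (by omega : 2 ≤ k + 2)
      rw [← lintegral_exp_half_expMeasure (by linarith), ← map_eval_expSeq,
        lintegral_map hf (measurable_pi_apply k)]
    simp only [Function.comp_apply] at h1
    rw [← h2, ← h1]
    refine lintegral_congr fun z => ?_
    rw [partialTime_succ, add_div, Real.exp_add, ENNReal.ofReal_mul (Real.exp_pos _).le]
  induction k with
  | zero =>
    rw [step]
    simp [partialTime]
    norm_num
  | succ k ih =>
    rw [step]
    refine (mul_le_mul_left ih _).trans ?_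
    rw [← ENNReal.ofReal_mul]
    · refine ENNReal.ofReal_le_ofReal ?_
      rw [Nat.cast_choose_two]
      push_cast
      have e : (4 - 4 / ((k : ℝ) + 2)) * ((k + 1 + 2) * (k + 1 + 2 - 1) / 2 /
          ((k + 1 + 2) * (k + 1 + 2 - 1) / 2 - 1 / 2))
          = 4 * ((k + 1) * (k + 3)) / (k ^ 2 + 5 * k + 5) := by
        have : (k : ℝ) ^ 2 + 5 * k + 5 ≠ 0 := by positivity
        have h2 : ((k : ℝ) + 1 + 2) * (k + 1 + 2 - 1) / 2 - 1 / 2 = (k ^ 2 + 5 * k + 5) / 2 := by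
          ring
        rw [h2]
        field_simp
        ring
      rw [e, show (4 : ℝ) - 4 / (k + 1 + 2) = 4 * (k + 2) / (k + 3) by field_simp; ring,
        div_le_div_iff₀ (by positivity) (by positivity)]
      nlinarith
    · rw [sub_nonneg, div_le_iff₀ (by positivity)]
      nlinarith [(k.cast_nonneg : (0 : ℝ) ≤ k)]

/-- Markov's inequality for the exponential of half the sum; its mean is at most `4` by Fatou's
lemma along the partial sums. -/
theorem mfLimit_le_exp (x : ℝ) : mfLimit x ≤ 4 * Real.exp (-(x / 2)) := by
  have hm : ∀ k, Measurable fun z => ENNReal.ofReal (Real.exp (partialTime (k + 2) z / 2)) :=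
    fun k => by have := measurable_partialTime (k + 2); fun_prop
  have h1 : ∫⁻ z, liminf (fun k => ENNReal.ofReal (Real.exp (partialTime (k + 2) z / 2))) atTop
      ∂expSeq ≤ 4 := by
    refine (lintegral_liminf_le hm).trans ?_
    refine (liminf_le_liminf (v := fun _ => (4 : ℝ≥0∞)) (Eventually.of_forall fun k => ?_)).trans
      (by simp)
    refine (lintegral_exp_partialTime_le k).trans ?_
    rw [show (4 : ℝ≥0∞) = ENNReal.ofReal 4 by simp]
    refine ENNReal.ofReal_le_ofReal ?_
    have : (0 : ℝ) ≤ 4 / (k + 2) := by positivity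
    linarith
  have h2 : expSeq {z | x < ∑' n, z n} ≤ expSeq {z | ENNReal.ofReal (Real.exp (x / 2)) ≤
      liminf (fun k => ENNReal.ofReal (Real.exp (partialTime (k + 2) z / 2))) atTop} := by
    refine measure_mono_ae ?_
    filter_upwards [ae_summable_expSeq] with z hs h
    have h3 : Tendsto (fun k => partialTime (k + 2) z) atTop (𝓝 (∑' n, z n)) :=
      (tendsto_add_atTop_iff_nat 1).2 hs.hasSum.tendsto_sum_nat
    have h4 : Tendsto (fun k => ENNReal.ofReal (Real.exp (partialTime (k + 2) z / 2))) atTop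
        (𝓝 (ENNReal.ofReal (Real.exp ((∑' n, z n) / 2)))) :=
      ENNReal.tendsto_ofReal ((Real.continuous_exp.tendsto _).comp (h3.div_const 2))
    change _ ≤ _
    rw [h4.liminf_eq]
    refine ENNReal.ofReal_le_ofReal (Real.exp_le_exp.2 ?_)
    have : x < ∑' n, z n := h
    linarith
  have h3 := (mul_meas_ge_le_lintegral (μ := expSeq) (Measurable.liminf hm)
    (ENNReal.ofReal (Real.exp (x / 2)))).trans h1
  have h4 := (mul_le_mul_right h2 (ENNReal.ofReal (Real.exp (x / 2)))).trans h3
  have h5 := ENNReal.toReal_mono (by simp) h4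
  rw [ENNReal.toReal_mul, ENNReal.toReal_ofReal (Real.exp_pos _).le, ← Measure.real,
    ← mfLimit_eq] at h5
  rw [Real.exp_neg, ← div_eq_mul_inv, le_div_iff₀ (Real.exp_pos _), mul_comm]
  simpa using h5

end MeanFieldLimit

/-! ### Coalescing step paths -/

section Paths

variable {V X : Type*}

/-- `f` is right-continuous and piecewise constant, with jumps in `D` only. -/
def ConstOff (D : Set ℝ≥0) (f : ℝ≥0 → X) : Prop :=
  ∀ ⦃s t : ℝ≥0⦄, s ≤ t → (∀ d ∈ D, s < d → t < d) → f s = f t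

/-- `D` is locally finite. -/
def LocFinite (D : Set ℝ≥0) : Prop := ∀ H, (D ∩ Iic H).Finite

theorem ConstOff.mono {D D' : Set ℝ≥0} {f : ℝ≥0 → X} (h : ConstOff D f) (hD : D ⊆ D') :
    ConstOff D' f := fun _ _ hst hd => h hst fun d hdD => hd d (hD hdD)

theorem IsStepPath.exists_constOff {ω : ℝ≥0 → V} (h : IsStepPath ω) :
    ∃ D, LocFinite D ∧ ConstOff D ω := by
  classical
  obtain ⟨t, h0, hmono, htop, hc⟩ := h
  refine ⟨range t, fun H => ?_, fun s u hsu hd => ?_⟩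
  · obtain ⟨n, hn⟩ := (htop.eventually_gt_atTop H).exists
    refine ((finite_Iio n).image t).subset ?_
    rintro _ ⟨⟨j, rfl⟩, hj⟩
    exact ⟨j, hmono.lt_iff_lt.1 (lt_of_le_of_lt hj hn), rfl⟩
  · have hex : ∃ n, s < t n := (htop.eventually_gt_atTop s).exists
    obtain ⟨n, hn⟩ : ∃ n, Nat.find hex = n + 1 := by
      refine Nat.exists_eq_succ_of_ne_zero fun hz => ?_
      have := Nat.find_spec hex
      rw [hz, h0] at this
      exact not_lt_bot this
    have hlt : s < t (n + 1) := hn ▸ Nat.find_spec hex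
    have hle : t n ≤ s := not_lt.1 (Nat.find_min hex (by omega))
    rw [hc n s ⟨hle, hlt⟩, hc n u ⟨hle.trans hsu, hd _ ⟨_, rfl⟩ hlt⟩]

theorem exists_constOff {ι : Type*} [Finite ι] (w : ι → StepPath V) :
    ∃ D, LocFinite D ∧ ∀ i, ConstOff D (w i) := by
  choose D hD hw using fun i => (w i).isStepPath.exists_constOff
  refine ⟨⋃ i, D i, fun H => ?_, fun i => (hw i).mono (subset_iUnion D i)⟩
  rw [iUnion_inter]
  exact finite_iUnion fun i => hD i H

theorem LocFinite.exists_gt {D : Set ℝ≥0} (hD : LocFinite D) (T : ℝ≥0) :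
    ∃ T', T < T' ∧ ∀ d ∈ D, T < d → T' < d := by
  have h1 : ∀ᶠ T' in 𝓝[>] T, ∀ d ∈ D ∩ Iic (T + 1), T < d → T' < d := by
    rw [Filter.eventually_all_finite (hD _)]
    intro d _
    by_cases h : T < d
    · filter_upwards [Ioo_mem_nhdsGT h] with T' hT' _ using hT'.2
    · exact Eventually.of_forall fun _ h' => absurd h' h
  have h2 : ∀ᶠ T' in 𝓝[>] T, T' ∈ Ioo T (T + 1) := Ioo_mem_nhdsGT (by simp)
  obtain ⟨T', hT', hlt⟩ := (h1.and h2).exists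
  refine ⟨T', hlt.1, fun d hd hTd => ?_⟩
  rcases le_or_gt d (T + 1) with h | h
  · exact hT' d ⟨hd, h⟩ hTd
  · exact hlt.2.trans h

/-- Directly after the infimum there is an interval free of jumps on which `p` is constant, so the
infimum is attained. -/
theorem LocFinite.exists_isLeast {D : Set ℝ≥0} (hD : LocFinite D) {p : ℝ≥0 → Prop}
    (hp : ConstOff D p) (hne : ∃ t, p t) : ∃ T, IsLeast {t | p t} T := by
  refine ⟨sInf {t | p t}, ?_, fun t ht => csInf_le' ht⟩
  obtain ⟨T', hT', hd⟩ := hD.exists_gt (sInf {t | p t})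
  obtain ⟨t, ht, hlt⟩ := exists_lt_of_csInf_lt hne hT'
  have : p (sInf {t | p t}) = p t :=
    hp (csInf_le' ht) fun d hdD hdT => hlt.trans (hd d hdD hdT)
  change p (sInf {t | p t})
  rw [this]
  exact ht

/-- The first time at which `p` holds. -/
def firstTime (p : ℝ≥0 → Prop) : ℝ≥0∞ := ⨅ (t : ℝ≥0) (_ : p t), (t : ℝ≥0∞)

theorem firstTime_eq {p : ℝ≥0 → Prop} {T : ℝ≥0} (h : IsLeast {t | p t} T) : firstTime p = T :=
  le_antisymm (iInf₂_le T h.1) (le_iInf₂ fun _ ht => ENNReal.coe_le_coe.2 (h.2 ht))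

theorem LocFinite.firstTime_le_iff {D : Set ℝ≥0} (hD : LocFinite D) {p : ℝ≥0 → Prop}
    (hp : ConstOff D p) {t : ℝ≥0} : firstTime p ≤ t ↔ ∃ s ≤ t, p s := by
  constructor
  · intro h
    have hne : ∃ t, p t := by
      by_contra hne
      push Not at hne
      simp [firstTime, hne] at h
    obtain ⟨T, hT⟩ := hD.exists_isLeast hp hne
    rw [firstTime_eq hT] at h
    exact ⟨T, ENNReal.coe_le_coe.1 h, hT.1⟩
  · rintro ⟨s, hs, hps⟩
    exact (iInf₂_le s hps).trans (ENNReal.coe_le_coe.2 hs)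

theorem follow_of_exists {D : Set ℝ≥0} (hD : LocFinite D) {k : ℕ} {Z : Fin k → ℝ≥0 → V}
    {w : ℝ≥0 → V} (hp : ConstOff D fun t => ∃ i, w t = Z i t) {t : ℝ≥0}
    (h : ∃ s ≤ t, ∃ i, w s = Z i s) : ∃ i, follow Z w t = Z i t := by
  obtain ⟨s, hs, hps⟩ := h
  obtain ⟨T, hT⟩ := hD.exists_isLeast hp ⟨s, hps⟩
  have hE : encounterTime Z w = T := firstTime_eq hT
  have h1 : encounterTime Z w ≤ t ∧
      ∃ i, w (encounterTime Z w).toNNReal = Z i (encounterTime Z w).toNNReal := by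
    rw [hE, ENNReal.toNNReal_coe]
    exact ⟨ENNReal.coe_le_coe.2 ((hT.2 hps).trans hs), hT.1⟩
  exact ⟨h1.2.choose, by rw [follow, dif_pos h1]⟩

theorem follow_of_not_exists {D : Set ℝ≥0} (hD : LocFinite D) {k : ℕ} {Z : Fin k → ℝ≥0 → V}
    {w : ℝ≥0 → V} (hp : ConstOff D fun t => ∃ i, w t = Z i t) {t : ℝ≥0}
    (h : ¬ ∃ s ≤ t, ∃ i, w s = Z i s) : follow Z w t = w t := by
  rw [follow, dif_neg]
  exact fun h' => h ((hD.firstTime_le_iff hp).1 h'.1)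

/-- Walker `i` has, at the times in `G` up to `t`, met no walker of smaller index that was itself
alive in this sense. -/
def Alive {k : ℕ} (G : Set ℝ≥0) (w : Fin k → ℝ≥0 → V) (i : Fin k) (t : ℝ≥0) : Prop :=
  ∀ s ∈ G, s ≤ t → ∀ l, l < i → Alive G w l s → w l s ≠ w i s
termination_by i

theorem alive_iff {k : ℕ} {G : Set ℝ≥0} {w : Fin k → ℝ≥0 → V} {i : Fin k} {t : ℝ≥0} :
    Alive G w i t ↔ ∀ s ∈ G, s ≤ t → ∀ l < i, Alive G w l s → w l s ≠ w i s := by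
  rw [Alive]

theorem Alive.mono {k : ℕ} {G : Set ℝ≥0} {w : Fin k → ℝ≥0 → V} {i : Fin k} {s t : ℝ≥0}
    (h : Alive G w i t) (hst : s ≤ t) : Alive G w i s := by
  rw [alive_iff] at h ⊢
  exact fun r hr hrs => h r hr (hrs.trans hst)

theorem alive_castSucc {k : ℕ} {G : Set ℝ≥0} (w : Fin (k + 1) → ℝ≥0 → V) (i : Fin k) (t : ℝ≥0) :
    Alive G (Fin.init w) i t ↔ Alive G w i.castSucc t := by
  induction i using WellFoundedLT.induction generalizing t with
  | _ i ih =>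
    rw [alive_iff, alive_iff]
    constructor
    · intro h s hs hst l hl hal
      have hlk : (l : ℕ) < k := lt_trans hl i.2
      have e : l = (Fin.mk l hlk).castSucc := rfl
      have hli : Fin.mk l hlk < i := hl
      rw [e] at hal
      exact h s hs hst _ hli ((ih _ hli s).2 hal)
    · intro h s hs hst l hl hal
      exact h s hs hst l.castSucc hl ((ih l hl s).1 hal)

/-- A meeting at a time between `s` and `t` is already visible at `s` if nobody jumps in between,
and a walker alive at the later time is alive at `s`. -/
theorem constOff_alive {D : Set ℝ≥0} {k : ℕ} {w : Fin k → ℝ≥0 → V}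
    (hw : ∀ i, ConstOff D (w i)) (i : Fin k) : ConstOff D (Alive univ w i) := by
  induction i using WellFoundedLT.induction with
  | _ i ih =>
    intro s t hst hd
    refine propext ⟨fun h => ?_, fun h => h.mono hst⟩
    rw [alive_iff] at h ⊢
    intro r _ hrt l hl hal
    rcases le_or_gt r s with hrs | hrs
    · exact h r trivial hrs l hl hal
    · have hd' : ∀ d ∈ D, s < d → r < d := fun d hdD hsd => hrt.trans_lt (hd d hdD hsd)
      rw [← hw l hrs.le hd', ← hw i hrs.le hd']
      exact h s trivial le_rfl l hl (hal.mono hrs.le)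

/-- A walker that has met an earlier one occupies one of the earlier sites, whichever index the
choice in `follow` selects; otherwise it is alive and on its own trajectory. This removes the
arbitrary choices: coalescence depends only on which independent walks are alive. -/
theorem range_coalesce {D : Set ℝ≥0} (hD : LocFinite D) {k : ℕ} {w : Fin k → ℝ≥0 → V}
    (hw : ∀ i, ConstOff D (w i)) (t : ℝ≥0) :
    (range fun j => coalesce k w j t) = {v | ∃ i, Alive univ w i t ∧ w i t = v} := by
  induction k generalizing t with
  | zero =>
    ext v
    simp
  | succ k ih =>
    have ih := ih (w := Fin.init w) fun i => hw i.castSucc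
    set Z := coalesce k (Fin.init w) with hZ
    set u := w (Fin.last k) with hu
    have hmem : ∀ t, (∃ i, u t = Z i t) ↔ ∃ i : Fin k, Alive univ w i.castSucc t ∧
        w i.castSucc t = u t := by
      intro t
      have : (∃ i, u t = Z i t) ↔ u t ∈ range fun j => Z j t := by
        simp [eq_comm]
      rw [this, ih]
      simp only [mem_ofPred_eq, alive_castSucc]
      rfl
    have hlast : ∀ t, Alive univ w (Fin.last k) t ↔ ¬ ∃ s ≤ t, ∃ i, u s = Z i s := by
      intro t
      rw [alive_iff]
      constructor
      · rintro h ⟨s, hs, hi⟩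
        obtain ⟨i, hi, he⟩ := (hmem s).1 hi
        exact h s trivial hs _ (Fin.castSucc_lt_last i) hi he
      · intro h s _ hs l hl hal he
        obtain ⟨i, rfl⟩ := Fin.exists_castSucc_eq.2 hl.ne
        exact h ⟨s, hs, (hmem s).2 ⟨i, hal, he⟩⟩
    have hp : ConstOff D fun t => ∃ i, u t = Z i t := by
      intro s t hst hd
      simp only [hmem]
      refine propext (exists_congr fun i => ?_)
      rw [constOff_alive hw _ hst hd, hw _ hst hd, hu, hw _ hst hd]
    have hco : ∀ j, coalesce (k + 1) w j t
        = (Fin.snoc (α := fun _ => ℝ≥0 → V) Z (follow Z u) : Fin (k + 1) → ℝ≥0 → V) j t :=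
      fun j => rfl
    ext v
    constructor
    · rintro ⟨j, rfl⟩
      simp only [hco]
      have hZmem : ∀ i, ∃ l, Alive univ w l t ∧ w l t = Z i t := by
        intro i
        have : Z i t ∈ range fun j => Z j t := ⟨i, rfl⟩
        rw [ih] at this
        obtain ⟨l, hl, he⟩ := this
        exact ⟨l.castSucc, (alive_castSucc w l t).1 hl, he⟩
      refine Fin.lastCases ?_ (fun i => ?_) j
      · rw [Fin.snoc_last]
        by_cases h : ∃ s ≤ t, ∃ i, u s = Z i s
        · obtain ⟨i, hi⟩ := follow_of_exists hD hp h
          rw [hi]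
          exact hZmem i
        · rw [follow_of_not_exists hD hp h]
          exact ⟨Fin.last k, (hlast t).2 h, rfl⟩
      · rw [Fin.snoc_castSucc]
        exact hZmem i
    · rintro ⟨i, hi, rfl⟩
      simp only [mem_range, hco]
      induction i using Fin.lastCases with
      | last =>
        refine ⟨Fin.last k, ?_⟩
        rw [Fin.snoc_last, follow_of_not_exists hD hp ((hlast t).1 hi)]
      | cast i =>
        have : w i.castSucc t ∈ range fun j => Z j t := by
          rw [ih]
          exact ⟨i, (alive_castSucc w i t).2 hi, rfl⟩
        obtain ⟨j, hj⟩ := this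
        exact ⟨j.castSucc, by rw [Fin.snoc_castSucc]; exact hj⟩

open Classical in
/-- The set of walkers alive at time `t`. -/
def aliveAt {k : ℕ} (G : Set ℝ≥0) (w : Fin k → ℝ≥0 → V) (t : ℝ≥0) : Finset (Fin k) :=
  Finset.univ.filter fun i => Alive G w i t

theorem mem_aliveAt {k : ℕ} {G : Set ℝ≥0} {w : Fin k → ℝ≥0 → V} {t : ℝ≥0} {i : Fin k} :
    i ∈ aliveAt G w t ↔ Alive G w i t := by simp [aliveAt]

theorem aliveAt_injOn {k : ℕ} {G : Set ℝ≥0} {w : Fin k → ℝ≥0 → V} {t : ℝ≥0} (ht : t ∈ G) :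
    InjOn (fun i => w i t) (aliveAt G w t) := by
  intro i hi j hj hij
  rw [Finset.mem_coe, mem_aliveAt] at hi hj
  rcases lt_trichotomy i j with h | h | h
  · exact absurd hij (alive_iff.1 hj t ht le_rfl i h hi)
  · exact h
  · exact absurd hij.symm (alive_iff.1 hi t ht le_rfl j h hj)

theorem ncard_range_coalesce {D : Set ℝ≥0} (hD : LocFinite D) {k : ℕ} {w : Fin k → ℝ≥0 → V}
    (hw : ∀ i, ConstOff D (w i)) (t : ℝ≥0) :
    (range fun j => coalesce k w j t).ncard = (aliveAt univ w t).card := by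
  have h : {v | ∃ i, Alive univ w i t ∧ w i t = v} = (fun i => w i t) '' aliveAt univ w t := by
    ext v; simp [mem_aliveAt]
  rw [range_coalesce hD hw, h, (aliveAt_injOn (mem_univ t)).ncard_image, ncard_coe_finset]

/-- The walkers have coalesced by time `t` if and only if at most one is alive. -/
theorem coalescenceTime_le_iff {k : ℕ} (w : Fin k → StepPath V) (t : ℝ≥0) :
    coalescenceTime w ≤ t ↔ (aliveAt univ (fun i => (w i : ℝ≥0 → V)) t).card ≤ 1 := by
  obtain ⟨D, hD, hw⟩ := exists_constOff w
  have h1 : coalescenceTime w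
      = firstTime fun t => (aliveAt univ (fun i => (w i : ℝ≥0 → V)) t).card ≤ 1 := by
    simp only [coalescenceTime, firstTime, ncard_range_coalesce hD hw]
  have hp : ConstOff D fun t => (aliveAt univ (fun i => (w i : ℝ≥0 → V)) t).card ≤ 1 := by
    intro s t hst hd
    have : aliveAt univ (fun i => (w i : ℝ≥0 → V)) s = aliveAt univ (fun i => (w i : ℝ≥0 → V)) t := by
      ext i
      rw [mem_aliveAt, mem_aliveAt, constOff_alive hw i hst hd]
    simp only [this]
  rw [h1, hD.firstTime_le_iff hp]
  constructor
  · rintro ⟨s, hs, h⟩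
    refine (Finset.card_le_card fun i hi => ?_).trans h
    rw [mem_aliveAt] at hi ⊢
    exact hi.mono hs
  · exact fun h => ⟨t, le_rfl, h⟩

/-- The time grid of mesh `h`. -/
def grid (h : ℝ≥0) : Set ℝ≥0 := range fun n : ℕ => n * h

/-- The grid time just after `s` works unless a jump separates it from `s`. Then the grid time just
before `s` works, since two jumps within one mesh are excluded. -/
theorem exists_grid_near {D : Set ℝ≥0} {h H : ℝ≥0} (hh : 0 < h)
    (hgap : ∀ d ∈ D, ∀ d' ∈ D, d < d' → d' ≤ H → h ≤ d' - d) {s t : ℝ≥0} (hst : s ≤ t) (htH : t ≤ H)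
    (ht : t ∈ grid h) : ∃ r ∈ grid h, r ≤ t ∧
      ((s ≤ r ∧ ∀ d ∈ D, s < d → r < d) ∨ (r ≤ s ∧ ∀ d ∈ D, r < d → s < d)) := by
  obtain ⟨n, rfl⟩ := ht
  set j := ⌈s / h⌉₊ with hj
  have hsj : s ≤ j * h := (div_le_iff₀ hh).1 (Nat.le_ceil _)
  have hjn : j ≤ n := Nat.ceil_le.2 ((div_le_iff₀ hh).2 hst)
  have hjt : (j : ℝ≥0) * h ≤ n * h := mul_le_mul_left (Nat.cast_le.2 hjn) h
  by_cases hd : ∀ d ∈ D, s < d → j * h < d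
  · exact ⟨j * h, ⟨j, rfl⟩, hjt, Or.inl ⟨hsj, hd⟩⟩
  · push Not at hd
    obtain ⟨d, hdD, hsd, hdj⟩ := hd
    have hj0 : j ≠ 0 := by
      rintro h0
      rw [h0] at hdj
      simp only [Nat.cast_zero, zero_mul, nonpos_iff_eq_zero] at hdj
      rw [hdj] at hsd
      exact not_lt_bot hsd
    obtain ⟨i, hi⟩ := Nat.exists_eq_succ_of_ne_zero hj0
    have his : (i : ℝ≥0) * h < s := by
      have : (i : ℝ≥0) < s / h := Nat.lt_ceil.1 (by omega)
      exact (lt_div_iff₀ hh).1 this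
    refine ⟨i * h, ⟨i, rfl⟩, his.le.trans hst, Or.inr ⟨his.le, fun d' hd' hid' => ?_⟩⟩
    by_contra hle
    have h1 := hgap d' hd' d hdD ((not_lt.1 hle).trans_lt hsd) (hdj.trans (hjt.trans htH))
    have h2 : d < d' + h := by
      refine hdj.trans_lt ?_
      rw [hi, Nat.cast_succ, add_mul, one_mul]
      gcongr
    have h3 : d' + h ≤ d := by
      have := add_le_add_right h1 d'
      rwa [add_tsub_cancel_of_le ((not_lt.1 hle).trans hsd.le)] at this
    exact absurd h2 (not_lt.2 h3)

/-- A meeting at any time `s` also occurs at a grid time `r ≤ t` not separated from `s` by a jump,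
where positions and earlier survivors are the same. -/
theorem alive_grid_iff {D : Set ℝ≥0} {h H : ℝ≥0} (hh : 0 < h)
    (hgap : ∀ d ∈ D, ∀ d' ∈ D, d < d' → d' ≤ H → h ≤ d' - d) {k : ℕ} {w : Fin k → ℝ≥0 → V}
    (hw : ∀ i, ConstOff D (w i)) (i : Fin k) {t : ℝ≥0} (ht : t ∈ grid h) (htH : t ≤ H) :
    Alive (grid h) w i t ↔ Alive univ w i t := by
  induction i using WellFoundedLT.induction generalizing t with
  | _ i ih =>
    rw [alive_iff, alive_iff]
    constructor
    · intro ha s _ hst l hl hal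
      obtain ⟨r, hr, hrt, hcase⟩ := exists_grid_near hh hgap hst htH ht
      have he : ∀ {X : Type _} {f : ℝ≥0 → X}, ConstOff D f → f s = f r := fun hf =>
        hcase.elim (fun h => hf h.1 h.2) fun h => (hf h.1 h.2).symm
      have h1 := constOff_alive hw l
      rw [show w l s = w l r from hcase.elim (fun h => hw l h.1 h.2) fun h => (hw l h.1 h.2).symm,
        show w i s = w i r from hcase.elim (fun h => hw i h.1 h.2) fun h => (hw i h.1 h.2).symm]
      refine ha r hr hrt l hl ((ih l hl hr (hrt.trans htH)).2 ?_)
      rwa [← he h1]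
    · intro ha s hs hst l hl hal
      exact ha s trivial hst l hl ((ih l hl hs (hst.trans htH)).1 hal)

/-- The mesh of the dyadic grids. -/
def mesh (j : ℕ) : ℝ≥0 := (1 / 2) ^ j

theorem mesh_pos (j : ℕ) : 0 < mesh j := by unfold mesh; positivity

theorem tendsto_mesh : Tendsto mesh atTop (𝓝 0) :=
  tendsto_pow_atTop_nhds_zero_of_lt_one (by simp) (by
    rw [div_lt_one (by norm_num)]; norm_num)

theorem LocFinite.eventually_gap {D : Set ℝ≥0} (hD : LocFinite D) (H : ℝ≥0) :
    ∀ᶠ j in atTop, ∀ d ∈ D, ∀ d' ∈ D, d < d' → d' ≤ H → mesh j ≤ d' - d := by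
  have h : ∀ᶠ j in atTop, ∀ d ∈ D ∩ Iic H, ∀ d' ∈ D ∩ Iic H, d < d' → mesh j ≤ d' - d := by
    rw [Filter.eventually_all_finite (hD H)]
    intro d _
    rw [Filter.eventually_all_finite (hD H)]
    intro d' _
    by_cases h : d < d'
    · filter_upwards [tendsto_mesh.eventually_lt_const (tsub_pos_of_lt h)] with j hj _ using hj.le
    · exact Eventually.of_forall fun _ h' => absurd h' h
  filter_upwards [h] with j hj d hd d' hd' hlt hle
  exact hj d ⟨hd, hlt.le.trans hle⟩ d' ⟨hd', hle⟩ hlt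

theorem mesh_mul_mem_grid (a : ℕ) {b j : ℕ} (h : b ≤ j) : a * mesh b ∈ grid (mesh j) := by
  refine ⟨a * 2 ^ (j - b), ?_⟩
  obtain ⟨c, rfl⟩ := Nat.exists_eq_add_of_le h
  simp only [mesh, Nat.add_sub_cancel_left, pow_add]
  push_cast
  have : (2 : ℝ≥0) ^ c * (1 / 2) ^ c = 1 := by rw [← mul_pow]; simp
  calc (a : ℝ≥0) * 2 ^ c * ((1 / 2) ^ b * (1 / 2) ^ c)
      = a * (1 / 2) ^ b * (2 ^ c * (1 / 2) ^ c) := by ring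
    _ = _ := by rw [this, mul_one]

/-- At dyadic times, the walkers alive on a fine dyadic grid are the walkers alive. -/
theorem eventually_aliveAt_grid {k : ℕ} (w : Fin k → StepPath V) (a b : ℕ) :
    ∀ᶠ j in atTop, aliveAt (grid (mesh j)) (fun i => (w i : ℝ≥0 → V)) (a * mesh b)
      = aliveAt univ (fun i => (w i : ℝ≥0 → V)) (a * mesh b) := by
  obtain ⟨D, hD, hw⟩ := exists_constOff w
  filter_upwards [hD.eventually_gap (a * mesh b), eventually_ge_atTop b] with j hj hbj
  ext i
  rw [mem_aliveAt, mem_aliveAt]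
  exact alive_grid_iff (mesh_pos j) hj hw i (mesh_mul_mem_grid a hbj) le_rfl

theorem mem_prune {ι : Type*} [Fintype ι] [LinearOrder ι] [Fintype V] [DecidableEq V] {x : ι → V}
    {A : Finset ι} {i : ι} : i ∈ prune x A ↔ i ∈ A ∧ ∀ j ∈ A, j < i → x j ≠ x i :=
  Finset.mem_filter

/-- The walkers alive on a grid evolve by pruning. -/
theorem aliveAt_grid_succ [Fintype V] [DecidableEq V] {k : ℕ} {h : ℝ≥0} (hh : 0 < h) (w : Fin k → ℝ≥0 → V)
    (n : ℕ) : aliveAt (grid h) w ((n + 1 : ℕ) * h)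
      = prune (fun i => w i ((n + 1 : ℕ) * h)) (aliveAt (grid h) w (n * h)) := by
  have hle : ((n : ℕ) : ℝ≥0) * h ≤ ((n + 1 : ℕ) : ℝ≥0) * h :=
    mul_le_mul_left (Nat.cast_le.2 n.le_succ) h
  set t := ((n + 1 : ℕ) : ℝ≥0) * h with ht
  have htG : t ∈ grid h := ⟨n + 1, rfl⟩
  have hcases : ∀ s ∈ grid h, s ≤ t → s = t ∨ s ≤ n * h := by
    rintro _ ⟨i, rfl⟩ hs
    have hi : i ≤ n + 1 := by
      have := le_of_mul_le_mul_right hs hh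
      exact_mod_cast this
    rcases Nat.lt_or_ge n i with h' | h'
    · left
      rw [show i = n + 1 by omega]
    · exact Or.inr (mul_le_mul_left (Nat.cast_le.2 h') h)
  ext i
  rw [mem_aliveAt, mem_prune, mem_aliveAt]
  constructor
  · intro hi
    refine ⟨hi.mono hle, fun l hl hli he => ?_⟩
    obtain ⟨l', hl', hle', he'⟩ := exists_mem_prune (fun i => w i t) _ hl
    refine alive_iff.1 hi t htG le_rfl l' (hle'.trans_lt hli) ?_ (he'.trans he)
    rw [mem_prune, mem_aliveAt] at hl'
    refine alive_iff.2 fun s hs hst r hr har => ?_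
    rcases hcases s hs hst with rfl | hsn
    · exact hl'.2 r (mem_aliveAt.2 (har.mono hle)) hr
    · exact alive_iff.1 hl'.1 s hs hsn r hr har
  · rintro ⟨hi, hp⟩
    refine alive_iff.2 fun s hs hst l hl hal => ?_
    rcases hcases s hs hst with rfl | hsn
    · exact hp l (mem_aliveAt.2 (hal.mono hle)) hl
    · exact alive_iff.1 hi s hs hsn l hl hal

theorem aliveAt_zero {k : ℕ} {G : Set ℝ≥0} {w : Fin k → ℝ≥0 → V}
    (hw : Function.Injective fun i => w i 0) : aliveAt G w 0 = Finset.univ := by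
  ext i
  simp only [mem_aliveAt, Finset.mem_univ, iff_true]
  refine alive_iff.2 fun s _ hs0 l hl _ he => hl.ne (hw ?_)
  rwa [le_antisymm hs0 zero_le] at he

/-- The first meeting time along the grid of mesh `h`. -/
def gridMeetingTime (h : ℝ≥0) (w w' : StepPath V) : ℝ≥0∞ :=
  firstTime fun t => t ∈ grid h ∧ w t = w' t

theorem meetingTime_le_gridMeetingTime (h : ℝ≥0) (w w' : StepPath V) :
    meetingTime w w' ≤ gridMeetingTime h w w' :=
  le_iInf₂ fun t ht => iInf₂_le t ht.2

theorem gridMeetingTime_antitone (w w' : StepPath V) :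
    Antitone fun j => gridMeetingTime (mesh j) w w' := by
  intro i j hij
  refine le_iInf₂ fun t ht => iInf₂_le t ⟨?_, ht.2⟩
  obtain ⟨⟨n, rfl⟩, -⟩ := ht
  exact mesh_mul_mem_grid n hij

/-- From their first meeting until the next jump the two paths stay together, and a fine grid has a
point in this interval within one mesh of the meeting. -/
theorem tendsto_gridMeetingTime (w w' : StepPath V) :
    Tendsto (fun j => gridMeetingTime (mesh j) w w') atTop (𝓝 (meetingTime w w')) := by
  obtain ⟨D, hD, hw⟩ := exists_constOff ![w, w']
  have hp : ConstOff D fun t => w t = w' t := fun s t hst hd => by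
    have h0 := hw 0 hst hd
    have h1 := hw 1 hst hd
    simp only [Matrix.cons_val_zero, Matrix.cons_val_one] at h0 h1
    simp only [h0, h1]
  by_cases hne : ∃ t, w t = w' t
  · obtain ⟨T, hT⟩ := hD.exists_isLeast hp hne
    have hM : meetingTime w w' = T := firstTime_eq hT
    rw [hM]
    obtain ⟨T', hT', hd⟩ := hD.exists_gt T
    refine tendsto_of_tendsto_of_tendsto_of_le_of_le' (g := fun _ => (T : ℝ≥0∞))
      (h := fun j => ((T + mesh j : ℝ≥0) : ℝ≥0∞)) tendsto_const_nhds ?_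
      (Eventually.of_forall fun j => hM ▸ meetingTime_le_gridMeetingTime _ w w') ?_
    · have := tendsto_mesh.const_add T
      rw [add_zero] at this
      exact ENNReal.tendsto_coe.2 this
    · filter_upwards [tendsto_mesh.eventually_lt_const (tsub_pos_of_lt hT')] with j hj
      set n := ⌈T / mesh j⌉₊
      have h1 : T ≤ n * mesh j := (div_le_iff₀ (mesh_pos j)).1 (Nat.le_ceil _)
      have h2 : n * mesh j ≤ T + mesh j := by
        have : (n : ℝ≥0) ≤ T / mesh j + 1 := (Nat.ceil_lt_add_one zero_le).le
        calc n * mesh j ≤ (T / mesh j + 1) * mesh j := mul_le_mul_left this _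
          _ = T + mesh j := by rw [add_mul, one_mul, div_mul_cancel₀ _ (mesh_pos j).ne']
      have h3 : w (n * mesh j) = w' (n * mesh j) := by
        have h4 : (w T = w' T) = (w (n * mesh j) = w' (n * mesh j)) := hp h1 fun d hdD hTd =>
          (h2.trans_lt (lt_tsub_iff_left.1 hj)).trans (hd d hdD hTd)
        exact h4 ▸ hT.1
      exact (iInf₂_le (n * mesh j) ⟨⟨n, rfl⟩, h3⟩).trans (ENNReal.coe_le_coe.2 h2)
  · push Not at hne
    have h1 : meetingTime w w' = ∞ := by simp [meetingTime, hne]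
    have h2 : ∀ j, gridMeetingTime (mesh j) w w' = ∞ := fun j => by
      simp [gridMeetingTime, firstTime, hne]
    simp [h1, h2]

end Paths

/-! ### The chain observed along a grid -/

section Skeleton

variable {V : Type*}

theorem measurableSet_eval (t : ℝ≥0) (S : Set V) : MeasurableSet {ω : StepPath V | ω t ∈ S} := by
  have h : MeasurableSpace.comap (fun ω : StepPath V => ω t) ⊤
      ≤ (inferInstance : MeasurableSpace (StepPath V)) :=
    le_iSup (fun t => MeasurableSpace.comap (fun ω : StepPath V => ω t) ⊤) t
  exact h _ ⟨S, trivial, rfl⟩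

theorem measurable_eval [MeasurableSpace V] (t : ℝ≥0) :
    Measurable fun ω : StepPath V => ω t := fun S _ => measurableSet_eval t S

theorem measurable_shift (T : ℝ≥0) : Measurable (shift T : StepPath V → StepPath V) := by
  rw [measurable_iff_comap_le]
  change MeasurableSpace.comap (shift T) (⨆ t : ℝ≥0, _) ≤ _
  rw [MeasurableSpace.comap_iSup]
  refine iSup_le fun t => ?_
  rw [MeasurableSpace.comap_comp]
  rintro _ ⟨S, -, rfl⟩
  exact measurableSet_eval (t + T) S

theorem shift_apply (T : ℝ≥0) (ω : StepPath V) (s : ℝ≥0) : shift T ω s = ω (s + T) := rfl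

/-- The transition matrix over a time `h`. -/
def stepKernel (P : V → Measure (StepPath V)) (h : ℝ≥0) (x y : V) : ℝ := (P x).real {ω | ω h = y}

variable [Fintype V]

theorem startFrom_apply (P : V → Measure (StepPath V)) (p : V → ℝ) (S : Set (StepPath V)) :
    startFrom P p S = ∑ x, ENNReal.ofReal (p x) * P x S := by
  simp [startFrom, Measure.finsetSum_apply]

theorem lintegral_startFrom (P : V → Measure (StepPath V)) (p : V → ℝ) (f : StepPath V → ℝ≥0∞) :
    ∫⁻ ω, f ω ∂(startFrom P p) = ∑ x, ENNReal.ofReal (p x) * ∫⁻ ω, f ω ∂(P x) := by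
  rw [startFrom, lintegral_finsetSum_measure]
  simp

theorem lintegral_eval (μ : Measure (StepPath V)) (t : ℝ≥0) (f : V → ℝ≥0∞) :
    ∫⁻ ω, f (ω t) ∂μ = ∑ y, f y * μ {ω | ω t = y} := by
  classical
  have h1 : ∀ ω : StepPath V, f (ω t) = ∑ y, {ω : StepPath V | ω t = y}.indicator (fun _ => f y) ω := by
    intro ω
    rw [Finset.sum_eq_single (ω t)]
    · simp
    · intro y _ hy
      rw [indicator_of_notMem]
      exact fun h => hy h.symm
    · simp
  have hm : ∀ y, MeasurableSet {ω : StepPath V | ω t = y} := fun y => measurableSet_eval t {y}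
  simp_rw [h1]
  rw [lintegral_finsetSum _ fun y _ => measurable_const.indicator (hm y)]
  refine Finset.sum_congr rfl fun y _ => ?_
  rw [lintegral_indicator_const (hm y)]

/-! ### The Markov property over one step of the grid -/

section Chain

variable {q : V → V → ℝ≥0} {P : V → Measure (StepPath V)} (hP : IsMarkovChain q P)
include hP

theorem IsMarkovChain.ae_start (x : V) : ∀ᵐ ω ∂(P x), ω 0 = x := by
  have := hP.prob x
  exact (prob_compl_eq_zero_iff (measurableSet_eval 0 {x})).2 (hP.start x)

theorem IsMarkovChain.stepKernel_mem (h : ℝ≥0) (x : V) : stepKernel P h x ∈ stdSimplex ℝ V := by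
  have := hP.prob x
  refine ⟨fun y => measureReal_nonneg, ?_⟩
  have h1 := lintegral_eval (P x) h fun _ => 1
  simp only [lintegral_const, measure_univ, one_mul] at h1
  have h2 := congrArg ENNReal.toReal h1
  rw [ENNReal.toReal_sum fun y _ => measure_ne_top _ _] at h2
  simpa [stepKernel, Measure.real] using h2.symm

/-- The Markov property with the trivial past event, decomposed according to the position at time
`h`. -/
theorem IsMarkovChain.map_shift (h : ℝ≥0) (x : V) :
    (P x).map (shift h) = startFrom P (stepKernel P h x) := by
  have := hP.prob x
  ext B hB
  rw [Measure.map_apply (measurable_shift h) hB, startFrom_apply]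
  have h1 := hP.markov x h univ B MeasurableSet.univ hB
  rw [univ_inter, Measure.restrict_univ, lintegral_eval (P x) h fun y => P y B] at h1
  rw [h1]
  refine Finset.sum_congr rfl fun y _ => ?_
  rw [stepKernel, ofReal_measureReal, mul_comm]

theorem IsMarkovChain.isProbabilityMeasure_startFrom {p : V → ℝ} (hp : p ∈ stdSimplex ℝ V) :
    IsProbabilityMeasure (startFrom P p) := by
  have := hP.prob
  refine ⟨?_⟩
  rw [startFrom_apply]
  simp only [measure_univ, mul_one]
  rw [← ENNReal.ofReal_sum_of_nonneg fun x _ => hp.1 x, hp.2, ENNReal.ofReal_one]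

theorem IsMarkovChain.startFrom_real {p : V → ℝ} (hp : p ∈ stdSimplex ℝ V) (S : Set (StepPath V)) :
    (startFrom P p).real S = ∑ x, p x * (P x).real S := by
  have := hP.prob
  rw [Measure.real, startFrom_apply, ENNReal.toReal_sum fun x _ =>
    ENNReal.mul_ne_top ENNReal.ofReal_ne_top (measure_ne_top _ _)]
  refine Finset.sum_congr rfl fun x _ => ?_
  rw [ENNReal.toReal_mul, ENNReal.toReal_ofReal (hp.1 x), Measure.real]

theorem IsMarkovChain.stepKernel_add (s t : ℝ≥0) (x y : V) :
    stepKernel P (s + t) x y = ∑ u, stepKernel P t x u * stepKernel P s u y := by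
  have h1 : stepKernel P (s + t) x y = ((P x).map (shift t)).real {ω | ω s = y} := by
    have hm : MeasurableSet {ω : StepPath V | ω s = y} := measurableSet_eval s {y}
    rw [Measure.real, Measure.map_apply (measurable_shift t) hm]
    rfl
  rw [h1, hP.map_shift, hP.startFrom_real (hP.stepKernel_mem t x)]
  rfl

theorem IsMarkovChain.stepKernel_zero [DecidableEq V] (x y : V) :
    stepKernel P 0 x y = if x = y then 1 else 0 := by
  have := hP.prob x
  split_ifs with h
  · subst h
    rw [stepKernel, Measure.real, hP.start, ENNReal.toReal_one]
  · rw [stepKernel, Measure.real, ENNReal.toReal_eq_zero_iff]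
    left
    refine measure_mono_null (fun ω hω => ?_) (ae_iff.1 (hP.ae_start x))
    exact fun hx => h (hx.symm.trans hω)

theorem IsMarkovChain.kpow_stepKernel [DecidableEq V] (h : ℝ≥0) (n : ℕ) (x y : V) :
    kpow (stepKernel P h) n x y = stepKernel P (n * h) x y := by
  induction n generalizing x with
  | zero => rw [Nat.cast_zero, zero_mul, hP.stepKernel_zero]; rfl
  | succ n ih =>
    rw [Nat.cast_succ, add_mul, one_mul, hP.stepKernel_add]
    exact Finset.sum_congr rfl fun u _ => by rw [ih]

/-! #### Pairs of walks -/

theorem IsMarkovChain.prod_startFrom_real [DecidableEq V] {p p' : V → ℝ} (hp : p ∈ stdSimplex ℝ V)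
    (hp' : p' ∈ stdSimplex ℝ V) {S : Set (StepPath V × StepPath V)} (hS : MeasurableSet S) :
    ((startFrom P p).prod (startFrom P p')).real S
      = pairAvg p p' fun x y => ((P x).prod (P y)).real S := by
  have := hP.prob
  have h1 := hP.isProbabilityMeasure_startFrom hp
  have h2 := hP.isProbabilityMeasure_startFrom hp'
  have h3 : ∀ x, ∫⁻ ω, startFrom P p' (Prod.mk ω ⁻¹' S) ∂(P x)
      = ∑ y, ENNReal.ofReal (p' y) * ((P x).prod (P y)) S := by
    intro x
    simp_rw [startFrom_apply]
    rw [lintegral_finsetSum _ fun y _ => (measurable_measure_prodMk_left hS).const_mul _]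
    refine Finset.sum_congr rfl fun y _ => ?_
    rw [lintegral_const_mul _ (measurable_measure_prodMk_left hS), Measure.prod_apply hS]
  rw [Measure.real, Measure.prod_apply hS, lintegral_startFrom]
  simp_rw [h3]
  have hfin : ∀ x y, ENNReal.ofReal (p' y) * ((P x).prod (P y)) S ≠ ∞ := fun x y =>
    ENNReal.mul_ne_top ENNReal.ofReal_ne_top (measure_ne_top _ _)
  rw [ENNReal.toReal_sum fun x _ => ENNReal.mul_ne_top ENNReal.ofReal_ne_top
    (ENNReal.sum_ne_top.2 fun y _ => hfin x y), pairAvg_apply]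
  refine Finset.sum_congr rfl fun x _ => ?_
  rw [ENNReal.toReal_mul, ENNReal.toReal_ofReal (hp.1 x),
    ENNReal.toReal_sum fun y _ => hfin x y]
  congr 1
  refine Finset.sum_congr rfl fun y _ => ?_
  rw [ENNReal.toReal_mul, ENNReal.toReal_ofReal (hp'.1 y), Measure.real]

end Chain

/-- The pairs of trajectories that have not met along the first steps of a grid. -/
def apart (V : Type*) (h : ℝ≥0) (n : ℕ) : Set (StepPath V × StepPath V) :=
  {w | ∀ i ≤ n, w.1 (i * h) ≠ w.2 (i * h)}

theorem measurableSet_apart (h : ℝ≥0) (n : ℕ) : MeasurableSet (apart V h n) := by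
  let _ : MeasurableSpace V := ⊤
  have : DiscreteMeasurableSpace V := ⟨fun _ => trivial⟩
  have h1 : apart V h n = ⋂ i : ℕ, ⋂ (_ : i ≤ n), {w | w.1 (i * h) ≠ w.2 (i * h)} := by
    ext w; simp [apart]
  rw [h1]
  refine MeasurableSet.iInter fun i => MeasurableSet.iInter fun _ => ?_
  have h2 : Measurable fun w : StepPath V × StepPath V => (w.1 (i * h), w.2 (i * h)) :=
    ((measurable_eval _).comp measurable_fst).prodMk ((measurable_eval _).comp measurable_snd)
  exact h2 (MeasurableSet.of_discrete (s := {p : V × V | p.1 ≠ p.2}))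

theorem apart_succ (h : ℝ≥0) (n : ℕ) : apart V h (n + 1)
    = {w | w.1 0 ≠ w.2 0} ∩ Prod.map (shift h) (shift h) ⁻¹' apart V h n := by
  ext w
  simp only [apart, mem_ofPred_eq, mem_inter_iff, mem_preimage, Prod.map_fst, Prod.map_snd,
    shift_apply]
  have e : ∀ i : ℕ, ((i : ℝ≥0) * h + h) = ((i + 1 : ℕ) : ℝ≥0) * h := fun i => by push_cast; ring
  simp only [e]
  constructor
  · intro hw
    refine ⟨?_, fun i hi => hw (i + 1) (by omega)⟩
    have := hw 0 (by omega)
    rwa [Nat.cast_zero, zero_mul] at this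
  · rintro ⟨h0, hw⟩ i hi
    cases i with
    | zero => rwa [Nat.cast_zero, zero_mul]
    | succ i => exact hw i (by omega)

/-- Each grid time up to which the paths have stayed apart contributes one mesh. -/
theorem gridMeetingTime_eq_tsum {h : ℝ≥0} (hh : 0 < h) (w : StepPath V × StepPath V) :
    gridMeetingTime h w.1 w.2 = ∑' n, (apart V h n).indicator (fun _ => (h : ℝ≥0∞)) w := by
  classical
  by_cases hex : ∃ n : ℕ, w.1 (n * h) = w.2 (n * h)
  · set N := Nat.find hex with hN
    have h1 : gridMeetingTime h w.1 w.2 = ((N * h : ℝ≥0) : ℝ≥0∞) := by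
      refine firstTime_eq ⟨⟨⟨N, rfl⟩, Nat.find_spec hex⟩, ?_⟩
      rintro _ ⟨⟨n, rfl⟩, hn⟩
      exact mul_le_mul_left (Nat.cast_le.2 (Nat.find_min' hex hn)) h
    have h2 : ∀ n, n ∉ Finset.range N →
        (apart V h n).indicator (fun _ => (h : ℝ≥0∞)) w = 0 := by
      intro n hn
      refine indicator_of_notMem (fun hw => ?_) _
      exact hw N (by simpa using hn) (Nat.find_spec hex)
    rw [h1, tsum_eq_sum fun n hn => h2 n hn]
    have h3 : ∀ n ∈ Finset.range N,
        (apart V h n).indicator (fun _ => (h : ℝ≥0∞)) w = h := by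
      intro n hn
      refine indicator_of_mem (fun i hi => ?_) _
      exact Nat.find_min hex (lt_of_le_of_lt hi (Finset.mem_range.1 hn))
    rw [Finset.sum_congr rfl h3]
    simp
  · push Not at hex
    have h1 : gridMeetingTime h w.1 w.2 = ∞ := by
      rw [gridMeetingTime, firstTime]
      simp only [iInf_eq_top]
      rintro _ ⟨⟨n, rfl⟩, hn⟩
      exact absurd hn (hex n)
    have h2 : ∀ n, (apart V h n).indicator (fun _ => (h : ℝ≥0∞)) w = h := fun n =>
      indicator_of_mem (show w ∈ apart V h n from fun i _ => hex i) _
    simp_rw [h1, h2]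
    rw [ENNReal.tsum_const_eq_top_of_ne_zero]
    exact_mod_cast hh.ne'

section Chain

variable [DecidableEq V] {q : V → V → ℝ≥0} {P : V → Measure (StepPath V)} (hP : IsMarkovChain q P)
include hP

theorem IsMarkovChain.ae_start_prod (x y : V) :
    ∀ᵐ w ∂(P x).prod (P y), w.1 0 = x ∧ w.2 0 = y := by
  have := hP.prob
  filter_upwards [Measure.quasiMeasurePreserving_fst.ae (hP.ae_start x),
    Measure.quasiMeasurePreserving_snd.ae (hP.ae_start y)] with w h1 h2 using ⟨h1, h2⟩

theorem IsMarkovChain.prod_apart_self (h : ℝ≥0) (n : ℕ) (x : V) :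
    ((P x).prod (P x)).real (apart V h n) = 0 := by
  rw [Measure.real, ENNReal.toReal_eq_zero_iff]
  left
  refine measure_mono_null (fun w hw => ?_) (ae_iff.1 (hP.ae_start_prod x x))
  have h0 := hw 0 (Nat.zero_le _)
  rw [Nat.cast_zero, zero_mul] at h0
  exact fun hw0 => h0 (hw0.1.trans hw0.2.symm)

/-- Shifting both independent paths by `h` gives independent chains started from the one-step
distributions, which is the recursion that defines `surv`. -/
theorem IsMarkovChain.prod_apart (h : ℝ≥0) (n : ℕ) (x y : V) :
    ((P x).prod (P y)).real (apart V h n) = surv (stepKernel P h) n x y := by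
  have := hP.prob
  induction n generalizing x y with
  | zero =>
    simp only [surv]
    split_ifs with hxy
    · rw [hxy, hP.prod_apart_self]
    · have : (P x).prod (P y) (apart V h 0) = 1 := by
        rw [← (measure_univ : (P x).prod (P y) univ = 1)]
        refine measure_congr ?_
        filter_upwards [hP.ae_start_prod x y] with w hw
        refine propext ⟨fun _ => trivial, fun _ i hi => ?_⟩
        rw [Nat.le_zero.1 hi, Nat.cast_zero, zero_mul, hw.1, hw.2]
        exact hxy
      rw [Measure.real, this, ENNReal.toReal_one]
  | succ n ih =>
    simp only [surv]
    split_ifs with hxy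
    · rw [hxy, hP.prod_apart_self]
    · have hms := measurable_shift (V := V) h
      have h1 : (P x).prod (P y) (apart V h (n + 1))
          = (P x).prod (P y) (Prod.map (shift h) (shift h) ⁻¹' apart V h n) := by
        rw [apart_succ]
        refine measure_congr ?_
        filter_upwards [hP.ae_start_prod x y] with w hw
        refine propext ⟨fun h => h.2, fun h => ⟨?_, h⟩⟩
        change w.1 0 ≠ w.2 0
        rw [hw.1, hw.2]
        exact hxy
      rw [Measure.real, h1, ← Measure.map_apply (hms.prodMap hms) (measurableSet_apart h n),
        ← Measure.map_prod_map _ _ hms hms, hP.map_shift, hP.map_shift, ← Measure.real,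
        hP.prod_startFrom_real (hP.stepKernel_mem h x) (hP.stepKernel_mem h y)
          (measurableSet_apart h n)]
      simp_rw [ih]

theorem IsMarkovChain.lintegral_gridMeetingTime {h : ℝ≥0} (hh : 0 < h) {π : V → ℝ}
    (hπ : π ∈ stdSimplex ℝ V) (hs : ∀ x y, Summable fun n => surv (stepKernel P h) n x y) :
    ∫⁻ w, gridMeetingTime h w.1 w.2 ∂((startFrom P π).prod (startFrom P π))
      = ENNReal.ofReal (h * meanMeet (stepKernel P h) π) := by
  have h0 := hP.isProbabilityMeasure_startFrom hπ
  simp_rw [gridMeetingTime_eq_tsum hh]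
  rw [lintegral_tsum fun n =>
    (measurable_const.indicator (measurableSet_apart h n)).aemeasurable]
  have h1 : ∀ n, ∫⁻ w, (apart V h n).indicator (fun _ => (h : ℝ≥0∞)) w
      ∂((startFrom P π).prod (startFrom P π))
      = ENNReal.ofReal (h * pairAvg π π (surv (stepKernel P h) n)) := by
    intro n
    rw [lintegral_indicator_const (measurableSet_apart h n), ← ofReal_measureReal,
      hP.prod_startFrom_real hπ hπ (measurableSet_apart h n)]
    simp_rw [hP.prod_apart]
    rw [ENNReal.ofReal_mul h.coe_nonneg, ENNReal.ofReal_coe_nnreal]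
  have h2 : HasSum (fun n => (h : ℝ) * pairAvg π π (surv (stepKernel P h) n))
      (h * meanMeet (stepKernel P h) π) := by
    refine HasSum.mul_left _ ?_
    simp only [meanMeet, pairAvg_apply]
    exact hasSum_sum fun a _ => (hasSum_sum fun b _ => (hs a b).hasSum.mul_left _).mul_left _
  simp_rw [h1]
  rw [← ENNReal.ofReal_tsum_of_nonneg _ h2.summable, h2.tsum_eq]
  exact fun n => mul_nonneg h.coe_nonneg
    (pairAvg_nonneg hπ hπ fun a b => surv_nonneg (hP.stepKernel_mem h) n a b)

/-! #### Families of walks -/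

theorem IsMarkovChain.pi_startFrom {k : ℕ} {p : Fin k → V → ℝ} (hp : ∀ i, p i ∈ stdSimplex ℝ V) :
    (Measure.pi fun i => startFrom P (p i))
      = ∑ φ : Fin k → V, ENNReal.ofReal (∏ i, p i (φ i)) • walksLaw P φ := by
  have := hP.prob
  have h0 := fun i => hP.isProbabilityMeasure_startFrom (hp i)
  refine Measure.pi_eq fun s _ => ?_
  rw [Measure.finsetSum_apply]
  simp_rw [startFrom_apply]
  rw [Fintype.prod_sum]
  refine Finset.sum_congr rfl fun φ _ => ?_
  rw [Measure.smul_apply, walksLaw, Measure.pi_pi, smul_eq_mul, Finset.prod_mul_distrib,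
    ENNReal.ofReal_prod_of_nonneg fun i _ => (hp i).1 _]

theorem IsMarkovChain.map_shift_walksLaw {k : ℕ} (h : ℝ≥0) (x : Fin k → V) :
    (walksLaw P x).map (fun w i => shift h (w i))
      = ∑ φ : Fin k → V, ENNReal.ofReal (∏ i, stepKernel P h (x i) (φ i)) • walksLaw P φ := by
  have := hP.prob
  have h0 : ∀ i, IsProbabilityMeasure ((P (x i)).map (shift h)) := fun i =>
    Measure.isProbabilityMeasure_map (measurable_shift h).aemeasurable
  rw [walksLaw, Measure.pi_map_pi fun i => (measurable_shift h).aemeasurable]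
  simp_rw [hP.map_shift]
  exact hP.pi_startFrom fun i => hP.stepKernel_mem h (x i)

theorem IsMarkovChain.isProbabilityMeasure_walksLaw {k : ℕ} (x : Fin k → V) :
    IsProbabilityMeasure (walksLaw P x) := by
  have := hP.prob
  unfold walksLaw
  infer_instance

theorem IsMarkovChain.ae_start_walksLaw {k : ℕ} (x : Fin k → V) :
    ∀ᵐ w ∂(walksLaw P x), (fun i => w i 0) = x := by
  have := hP.prob
  have h : ∀ᵐ w ∂(walksLaw P x), ∀ i, w i 0 = x i :=
    eventually_all.2 fun i => (Measure.tendsto_eval_ae_ae (μ := fun i => P (x i))).eventually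
      (hP.ae_start (x i))
  filter_upwards [h] with w hw using funext hw

end Chain

/-! ### Survivors along a grid and the passage to the coalescence time -/

variable [DecidableEq V]

/-- The survivors among `A` after `n` steps along the grid of mesh `h`. -/
def gridAlive {k : ℕ} (h : ℝ≥0) (A : Finset (Fin k)) (w : Fin k → StepPath V) : ℕ → Finset (Fin k)
  | 0 => A
  | n + 1 => prune (fun i => w i ((n + 1 : ℕ) * h)) (gridAlive h A w n)

theorem gridAlive_succ {k : ℕ} (h : ℝ≥0) (A : Finset (Fin k)) (w : Fin k → StepPath V) (n : ℕ) :
    gridAlive h A w (n + 1)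
      = gridAlive h (prune (fun i => shift h (w i) 0) A) (fun i => shift h (w i)) n := by
  induction n with
  | zero => simp [gridAlive, shift_apply]
  | succ n ih =>
    rw [gridAlive, ih, gridAlive]
    congr 1
    ext i
    rw [shift_apply]
    congr 1
    push_cast
    ring

theorem aliveAt_grid_eq {k : ℕ} {h : ℝ≥0} (hh : 0 < h) {w : Fin k → StepPath V}
    (hw : Function.Injective fun i => w i 0) (n : ℕ) :
    aliveAt (grid h) (fun i => (w i : ℝ≥0 → V)) (n * h) = gridAlive h Finset.univ w n := by
  induction n with
  | zero => rw [Nat.cast_zero, zero_mul, aliveAt_zero hw]; rfl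
  | succ n ih => rw [aliveAt_grid_succ hh, ih]; rfl

theorem measurableSet_gridAlive {k : ℕ} (h : ℝ≥0) (n : ℕ) (s : Set ((Fin k → V) × Finset (Fin k)))
    (A : Finset (Fin k)) :
    MeasurableSet {w : Fin k → StepPath V | ((fun i => w i 0), gridAlive h A w n) ∈ s} := by
  let _ : MeasurableSpace V := ⊤
  have : DiscreteMeasurableSpace V := ⟨fun _ => trivial⟩
  let _ : MeasurableSpace (Finset (Fin k)) := ⊤
  have : DiscreteMeasurableSpace (Finset (Fin k)) := ⟨fun _ => trivial⟩
  have h0 : ∀ t : ℝ≥0, Measurable fun (w : Fin k → StepPath V) i => w i t := fun t =>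
    measurable_pi_lambda _ fun i => (measurable_eval t).comp (measurable_pi_apply i)
  have h1 : Measurable fun w : Fin k → StepPath V => gridAlive h A w n := by
    induction n with
    | zero => exact measurable_const
    | succ n ih =>
      have : Measurable fun p : (Fin k → V) × Finset (Fin k) => prune p.1 p.2 :=
        Measurable.of_discrete
      exact this.comp ((h0 _).prodMk ih)
  exact ((h0 0).prodMk h1) (MeasurableSet.of_discrete (s := s))

section Chain

variable {q : V → V → ℝ≥0} {P : V → Measure (StepPath V)} (hP : IsMarkovChain q P)
include hP

/-- Induction on the first step. Pruning happens only after a move, both in `gridAlive` and in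
`tupleOp`, so `A` may be arbitrary at time zero. -/
theorem IsMarkovChain.walksLaw_gridAlive {k : ℕ} (h : ℝ≥0) (p : Finset (Fin k) → Prop)
    [DecidablePred p] (n : ℕ) (x : Fin k → V) (A : Finset (Fin k)) :
    (walksLaw P x).real {w | p (gridAlive h A w n)}
      = (tupleOp (stepKernel P h) ^ n) (fun _ A => if p A then 1 else 0) x A := by
  induction n generalizing x A with
  | zero =>
    have := hP.isProbabilityMeasure_walksLaw x
    simp only [gridAlive, pow_zero, Module.End.one_apply]
    by_cases hA : p A <;> simp [hA]
  | succ n ih =>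
    have hm : Measurable fun (w : Fin k → StepPath V) i => shift h (w i) :=
      measurable_pi_lambda _ fun i => (measurable_shift h).comp (measurable_pi_apply i)
    set S : Set (Fin k → StepPath V) := {w | p (gridAlive h (prune (fun i => w i 0) A) w n)} with hS
    have hSm : MeasurableSet S := by
      have : S = ⋃ B : Finset (Fin k), {w | ((fun i => w i 0), gridAlive h B w n) ∈
          {r : (Fin k → V) × Finset (Fin k) | prune r.1 A = B ∧ p r.2}} := by
        ext w; simp [hS]
      rw [this]
      exact MeasurableSet.iUnion fun B => measurableSet_gridAlive h n _ B
    have e1 : {w | p (gridAlive h A w (n + 1))} = (fun w i => shift h (w i)) ⁻¹' S := by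
      ext w
      simp only [hS, mem_ofPred_eq, mem_preimage, gridAlive_succ]
    rw [e1, Measure.real, ← Measure.map_apply hm hSm, hP.map_shift_walksLaw,
      Measure.finsetSum_apply, pow_succ', Module.End.mul_apply, tupleOp_apply, avg_apply]
    have hfin : ∀ φ : Fin k → V, walksLaw P φ S ≠ ∞ := fun φ => by
      have := hP.isProbabilityMeasure_walksLaw φ
      exact measure_ne_top _ _
    rw [ENNReal.toReal_sum fun φ _ => by
      rw [Measure.smul_apply]
      exact ENNReal.mul_ne_top ENNReal.ofReal_ne_top (hfin φ)]
    refine Finset.sum_congr rfl fun φ _ => ?_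
    rw [Measure.smul_apply, smul_eq_mul, ENNReal.toReal_mul, ENNReal.toReal_ofReal
      (Finset.prod_nonneg fun i _ => (hP.stepKernel_mem h (x i)).1 _), ← ih φ (prune φ A)]
    congr 1
    rw [Measure.real]
    congr 1
    refine measure_congr ?_
    filter_upwards [hP.ae_start_walksLaw φ] with w hw
    change p _ = p _
    rw [hw]

/-- The probability that the walks, observed along a grid, have not coalesced after `n` steps. -/
theorem IsMarkovChain.walksLaw_aliveAt {h : ℝ≥0} (hh : 0 < h) (n : ℕ)
    (x : Fin (Fintype.card V) ≃ V) :
    (walksLaw P x).real {w | 2 ≤ (aliveAt (grid h) (fun i => (w i : ℝ≥0 → V)) (n * h)).card}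
      = (flowOp (stepKernel P h) ^ n) twoInd Finset.univ := by
  have hK := hP.stepKernel_mem h
  have hinj : InjOn x (Finset.univ : Finset (Fin (Fintype.card V))) := x.injective.injOn
  have e1 : (walksLaw P x).real
      {w | 2 ≤ (aliveAt (grid h) (fun i => (w i : ℝ≥0 → V)) (n * h)).card}
      = (walksLaw P x).real {w | 2 ≤ (gridAlive h Finset.univ w n).card} := by
    refine measureReal_congr ?_
    filter_upwards [hP.ae_start_walksLaw x] with w hw
    have hwi : Function.Injective fun i => w i 0 := by rw [hw]; exact x.injective
    change (2 ≤ _) = (2 ≤ _)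
    rw [aliveAt_grid_eq hh hwi]
  have e2 : (Finset.univ : Finset V) = Finset.univ.image x := by
    ext v; simp
  rw [e1, hP.walksLaw_gridAlive h (fun A => 2 ≤ A.card) n x, e2, ← tupleOp_pow_image hK twoInd n hinj]
  have key : ∀ (y : Fin (Fintype.card V) → V) (A : Finset (Fin (Fintype.card V))), InjOn y A →
      (if 2 ≤ A.card then (1 : ℝ) else 0) = twoInd (A.image y) := by
    intro y A hA
    rw [twoInd, Finset.card_image_of_injOn hA]
  exact le_antisymm
    (tupleOp_pow_mono hK (fun y A hA => (key y A hA).le) n x _ hinj)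
    (tupleOp_pow_mono hK (fun y A hA => (key y A hA).ge) n x _ hinj)

end Chain

theorem eventually_mem_iff {k : ℕ} (w : Fin k → StepPath V) (a b : ℕ) :
    ∀ᶠ j in atTop, w ∈ {w : Fin k → StepPath V | 2 ≤ (aliveAt (grid (mesh (j + b)))
      (fun i => (w i : ℝ≥0 → V)) (a * mesh b)).card} ↔
      w ∈ {w | ((a * mesh b : ℝ≥0) : ℝ≥0∞) < coalescenceTime w} := by
  filter_upwards [(tendsto_add_atTop_nat b).eventually (eventually_aliveAt_grid w a b)] with j hj
  rw [hj, ← not_le, coalescenceTime_le_iff]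
  omega

theorem mesh_mul_eq (a b j : ℕ) : a * mesh b = (a * 2 ^ j : ℕ) * mesh (j + b) := by
  simp only [mesh, pow_add]
  push_cast
  have : (2 : ℝ≥0) ^ j * (1 / 2) ^ j = 1 := by rw [← mul_pow]; simp
  calc (a : ℝ≥0) * (1 / 2) ^ b = a * (1 / 2) ^ b * (2 ^ j * (1 / 2) ^ j) := by rw [this, mul_one]
    _ = _ := by ring

theorem measurableSet_aliveAt_grid {k : ℕ} {h : ℝ≥0} (hh : 0 < h) (n : ℕ) :
    MeasurableSet {w : Fin k → StepPath V |
      2 ≤ (aliveAt (grid h) (fun i => (w i : ℝ≥0 → V)) (n * h)).card} := by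
  let _ : MeasurableSpace V := ⊤
  have : DiscreteMeasurableSpace V := ⟨fun _ => trivial⟩
  let _ : MeasurableSpace (Finset (Fin k)) := ⊤
  have : DiscreteMeasurableSpace (Finset (Fin k)) := ⟨fun _ => trivial⟩
  have h0 : ∀ t : ℝ≥0, Measurable fun (w : Fin k → StepPath V) i => w i t := fun t =>
    measurable_pi_lambda _ fun i => (measurable_eval t).comp (measurable_pi_apply i)
  have hp : Measurable fun p : (Fin k → V) × Finset (Fin k) => prune p.1 p.2 :=
    Measurable.of_discrete
  have h1 : Measurable fun w : Fin k → StepPath V =>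
      aliveAt (grid h) (fun i => (w i : ℝ≥0 → V)) (n * h) := by
    induction n with
    | zero =>
      have : ∀ w : Fin k → StepPath V,
          aliveAt (grid h) (fun i => (w i : ℝ≥0 → V)) ((0 : ℕ) * h)
            = prune (fun i => w i 0) Finset.univ := by
        intro w
        ext i
        have hz : ∀ s ∈ grid h, s ≤ ((0 : ℕ) : ℝ≥0) * h → s = 0 := fun s _ hs => by
          rw [Nat.cast_zero, zero_mul] at hs
          exact le_antisymm hs zero_le
        rw [mem_aliveAt, mem_prune]
        constructor
        · intro hi
          refine ⟨Finset.mem_univ _, fun l _ hli he => ?_⟩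
          obtain ⟨l', hl', hle', he'⟩ :=
            exists_mem_prune (fun i => w i 0) Finset.univ (Finset.mem_univ l)
          refine alive_iff.1 hi 0 ⟨0, by simp⟩ zero_le l' (hle'.trans_lt hli) ?_ (he'.trans he)
          refine alive_iff.2 fun s hs hs0 r hr _ => ?_
          rw [le_antisymm hs0 zero_le]
          exact (mem_prune.1 hl').2 r (Finset.mem_univ r) hr
        · rintro ⟨-, hp⟩
          refine alive_iff.2 fun s hs hst l hl _ => ?_
          rw [hz s hs hst]
          exact hp l (Finset.mem_univ l) hl
      simp_rw [this]
      exact hp.comp ((h0 0).prodMk measurable_const)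
    | succ n ih =>
      simp_rw [aliveAt_grid_succ hh]
      exact hp.comp ((h0 _).prodMk ih)
  exact h1 (MeasurableSet.of_discrete (s := {A : Finset (Fin k) | 2 ≤ A.card}))

/-- Pathwise, the event is eventually equal to its version on refining dyadic grids, which depends
on finitely many times. -/
theorem measurableSet_lt_coalescenceTime {k : ℕ} (a b : ℕ) :
    MeasurableSet {w : Fin k → StepPath V |
      ((a * mesh b : ℝ≥0) : ℝ≥0∞) < coalescenceTime w} := by
  refine measurableSet_of_tendsto_indicator atTop (fun j => ?_) fun w => eventually_mem_iff w a b
  rw [mesh_mul_eq a b j]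
  exact measurableSet_aliveAt_grid (mesh_pos _) _

/-- The dyadic times are dense. -/
theorem exists_mesh_mul_between {s t : ℝ≥0} (h : s < t) : ∃ a b : ℕ, s < a * mesh b ∧ a * mesh b < t := by
  obtain ⟨b, hb⟩ := (tendsto_mesh.eventually_lt_const (tsub_pos_of_lt h)).exists
  refine ⟨⌊s / mesh b⌋₊ + 1, b, ?_, ?_⟩
  · rw [← div_lt_iff₀ (mesh_pos b)]
    push_cast
    exact Nat.lt_floor_add_one _
  · have h1 : (⌊s / mesh b⌋₊ : ℝ≥0) * mesh b ≤ s :=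
      (le_div_iff₀ (mesh_pos b)).1 (Nat.floor_le zero_le)
    push_cast
    rw [add_mul, one_mul]
    exact (add_le_add_left h1 _).trans_lt (lt_tsub_iff_left.1 hb)

theorem measurable_coalescenceTime {k : ℕ} :
    Measurable fun w : Fin k → StepPath V => coalescenceTime w := by
  refine measurable_of_Ioi fun t => ?_
  have : (fun w : Fin k → StepPath V => coalescenceTime w) ⁻¹' Ioi t
      = ⋃ (a : ℕ) (b : ℕ) (_ : t ≤ ((a * mesh b : ℝ≥0) : ℝ≥0∞)),
        {w | ((a * mesh b : ℝ≥0) : ℝ≥0∞) < coalescenceTime w} := by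
    ext w
    simp only [mem_preimage, mem_Ioi, mem_iUnion, mem_ofPred_eq, exists_prop]
    constructor
    · intro h
      lift t to ℝ≥0 using h.ne_top
      obtain ⟨t', ht', hlt⟩ := ENNReal.lt_iff_exists_nnreal_btwn.1 h
      obtain ⟨a, b, h1, h2⟩ := exists_mesh_mul_between (ENNReal.coe_lt_coe.1 ht')
      exact ⟨a, b, ENNReal.coe_le_coe.2 h1.le, (ENNReal.coe_lt_coe.2 h2).trans hlt⟩
    · rintro ⟨a, b, h1, h2⟩
      exact h1.trans_lt h2
  rw [this]
  exact MeasurableSet.iUnion fun a => MeasurableSet.iUnion fun b => MeasurableSet.iUnion fun _ =>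
    measurableSet_lt_coalescenceTime a b

/-- The law of the coalescence time at dyadic times is the limit of its grid versions. -/
theorem IsMarkovChain.tendsto_flowOp_pow {q : V → V → ℝ≥0} {P : V → Measure (StepPath V)}
    (hP : IsMarkovChain q P) (x : Fin (Fintype.card V) ≃ V) (a b : ℕ) :
    Tendsto (fun j => (flowOp (stepKernel P (mesh (j + b))) ^ (a * 2 ^ j)) twoInd Finset.univ) atTop
      (𝓝 ((walksLaw P x).real {w | ((a * mesh b : ℝ≥0) : ℝ≥0∞) < coalescenceTime w})) := by
  have := hP.isProbabilityMeasure_walksLaw x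
  have h1 := tendsto_measure_of_tendsto_indicator (μ := walksLaw P x) (B := univ) atTop
    (A := {w | ((a * mesh b : ℝ≥0) : ℝ≥0∞) < coalescenceTime w})
    (As := fun j => {w | 2 ≤ (aliveAt (grid (mesh (j + b)))
      (fun i => (w i : ℝ≥0 → V)) (a * mesh b)).card})
    (fun j => by
      rw [mesh_mul_eq a b j]
      exact measurableSet_aliveAt_grid (mesh_pos _) _)
    MeasurableSet.univ (measure_ne_top _ _) (Eventually.of_forall fun j => subset_univ _)
    fun w => eventually_mem_iff w a b
  have h2 := (ENNReal.tendsto_toReal (measure_ne_top _ _)).comp h1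
  refine h2.congr fun j => ?_
  rw [← hP.walksLaw_aliveAt (mesh_pos _) _ x, ← mesh_mul_eq]
  rfl

theorem measurable_gridMeetingTime {h : ℝ≥0} (hh : 0 < h) :
    Measurable fun w : StepPath V × StepPath V => gridMeetingTime h w.1 w.2 := by
  simp_rw [gridMeetingTime_eq_tsum hh]
  exact Measurable.tsum fun n => measurable_const.indicator (measurableSet_apart h n)

/-- The mean meeting time is the limit of its grid versions. -/
theorem IsMarkovChain.tendsto_meanMeet {q : V → V → ℝ≥0} {P : V → Measure (StepPath V)}
    (hP : IsMarkovChain q P) {π : V → ℝ} (hπ : π ∈ stdSimplex ℝ V) {j₀ : ℕ}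
    (hs : ∀ j ≥ j₀, ∀ x y, Summable fun n => surv (stepKernel P (mesh j)) n x y) :
    meanMeetingTime P π < ∞ ∧
    Tendsto (fun j => mesh j * meanMeet (stepKernel P (mesh j)) π) atTop
      (𝓝 (meanMeetingTime P π).toReal) := by
  have h0 := hP.isProbabilityMeasure_startFrom hπ
  have h1 : ∀ j ≥ j₀, ∫⁻ w, gridMeetingTime (mesh j) w.1 w.2
      ∂((startFrom P π).prod (startFrom P π))
      = ENNReal.ofReal (mesh j * meanMeet (stepKernel P (mesh j)) π) := fun j hj =>
    hP.lintegral_gridMeetingTime (mesh_pos j) hπ (hs j hj)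
  have h2 : meanMeetingTime P π < ∞ := by
    refine lt_of_le_of_lt (lintegral_mono fun w => meetingTime_le_gridMeetingTime (mesh j₀) w.1 w.2) ?_
    rw [h1 j₀ le_rfl]
    exact ENNReal.ofReal_lt_top
  refine ⟨h2, ?_⟩
  -- Dyadic grids are nested, so grid meeting times decrease; the integral is finite at level `j₀`,
  -- as monotone convergence from above requires.
  have h3 := lintegral_tendsto_of_tendsto_of_antitone
    (μ := (startFrom P π).prod (startFrom P π))
    (f := fun j w => gridMeetingTime (mesh (j + j₀)) w.1 w.2)
    (F := fun w => meetingTime w.1 w.2)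
    (fun j => (measurable_gridMeetingTime (mesh_pos _)).aemeasurable)
    (Eventually.of_forall fun w i j hij => gridMeetingTime_antitone w.1 w.2 (by omega))
    (by rw [h1 _ (by omega)]; exact ENNReal.ofReal_ne_top)
    (Eventually.of_forall fun w =>
      (tendsto_gridMeetingTime w.1 w.2).comp (tendsto_add_atTop_nat j₀))
  rw [← tendsto_add_atTop_iff_nat j₀]
  refine ((ENNReal.tendsto_toReal h2.ne).comp h3).congr fun j => ?_
  rw [Function.comp_apply, h1 _ (by omega), ENNReal.toReal_ofReal]
  refine mul_nonneg NNReal.zero_le_coe (pairAvg_nonneg hπ hπ fun a b => ?_)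
  exact tsum_nonneg fun n => surv_nonneg (hP.stepKernel_mem _) n a b

end Skeleton

/-! ### Mixing of the chain observed along a fine grid -/

section Mixing

variable {V : Type*} [Fintype V] [DecidableEq V] {q : V → V → ℝ≥0} {P : V → Measure (StepPath V)}
  {π : V → ℝ} (hP : IsMarkovChain q P)
include hP

theorem IsMarkovChain.sum_stationary (hπ : IsStationary P π) (T : ℝ≥0) (y : V) :
    ∑ x, π x * stepKernel P T x y = π y := by
  have hm : MeasurableSet {ω : StepPath V | ω 0 = y} := measurableSet_eval 0 {y}
  have h1 : (startFrom P π).real {ω | ω T = y} = (startFrom P π).real {ω | ω 0 = y} := by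
    have h0 : (startFrom P π) {ω | ω 0 = y} = startFrom P π {ω | ω T = y} := by
      conv_lhs => rw [← hπ.2 T]
      rw [Measure.map_apply (measurable_shift T) hm]
      congr 1
      ext ω
      simp [shift_apply]
    rw [Measure.real, Measure.real, h0]
  rw [hP.startFrom_real hπ.1, hP.startFrom_real hπ.1] at h1
  have h2 : ∀ x, (P x).real {ω | ω 0 = y} = if x = y then 1 else 0 := fun x =>
    hP.stepKernel_zero x y
  simp_rw [h2] at h1
  simpa [stepKernel] using h1

/-- A stochastic matrix that preserves `π` contracts the `L¹` distance to `π`. -/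
theorem IsMarkovChain.mixedAt_mono (hπ : IsStationary P π) {a : ℝ} {s t : ℝ≥0} (hst : s ≤ t)
    (h : MixedAt P π a s) : MixedAt P π a t := by
  intro x
  refine le_trans ?_ (h x)
  obtain ⟨r, rfl⟩ := exists_add_of_le hst
  rw [tvDist, tvDist]
  refine mul_le_mul_of_nonneg_left ?_ (by norm_num)
  have e : ∀ y, |(P x).real {ω | ω (s + r) = y} - π y|
      ≤ ∑ u, |stepKernel P s x u - π u| * stepKernel P r u y := by
    intro y
    have h1 : (P x).real {ω | ω (s + r) = y} = ∑ u, stepKernel P s x u * stepKernel P r u y := by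
      rw [add_comm]; exact hP.stepKernel_add r s x y
    rw [h1, ← hP.sum_stationary hπ r y, ← Finset.sum_sub_distrib]
    refine (Finset.abs_sum_le_sum_abs _ _).trans (Finset.sum_le_sum fun u _ => ?_)
    rw [← sub_mul, abs_mul, abs_of_nonneg ((hP.stepKernel_mem r u).1 y)]
  refine (Finset.sum_le_sum fun y _ => e y).trans ?_
  rw [Finset.sum_comm]
  refine Finset.sum_le_sum fun u _ => ?_
  rw [← Finset.mul_sum, (hP.stepKernel_mem r u).2, mul_one]
  exact le_rfl

/-- The strict inequality avoids the question whether the infimum is attained. -/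
theorem IsMarkovChain.mixedAt_of_mixingTime_lt (hM : IsMixing P π) {T : ℝ≥0}
    (hT : mixingTime P π (1 / 4) < T) : MixedAt P π (1 / 4) T := by
  obtain ⟨s, hs, hlt⟩ := exists_lt_of_csInf_lt (hM.mixes (1 / 4) (by norm_num)) hT
  exact hP.mixedAt_mono hM.stationary hlt.le hs

/-- Centring `f` at the middle of its range bounds it by `b / 2`, and the two laws differ by at most
`1 / 2` in `L¹`. -/
theorem IsMarkovChain.abs_sum_stepKernel_sub_le (hπ : π ∈ stdSimplex ℝ V) {T : ℝ≥0}
    (hT : MixedAt P π (1 / 4) T) {f : V → ℝ} {a b : ℝ} (hf : ∀ v, a ≤ f v ∧ f v ≤ a + b) (x : V) :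
    |∑ y, stepKernel P T x y * f y - ∑ y, π y * f y| ≤ b / 4 := by
  have h1 : ∑ y, stepKernel P T x y * f y - ∑ y, π y * f y
      = ∑ y, (stepKernel P T x y - π y) * (f y - (a + b / 2)) := by
    simp only [sub_mul, mul_sub, Finset.sum_sub_distrib]
    rw [← Finset.sum_mul, ← Finset.sum_mul, (hP.stepKernel_mem T x).2, hπ.2]
    ring
  have h2 := hT x
  rw [tvDist] at h2
  have hb : 0 ≤ b := by linarith [(hf x).1, (hf x).2]
  rw [h1]
  refine (Finset.abs_sum_le_sum_abs _ _).trans ?_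
  refine (Finset.sum_le_sum (g := fun y => |stepKernel P T x y - π y| * (b / 2)) fun y _ => ?_).trans
    ?_
  · rw [abs_mul]
    refine mul_le_mul_of_nonneg_left ?_ (abs_nonneg _)
    rw [abs_le]
    constructor <;> linarith [(hf y).1, (hf y).2]
  · rw [← Finset.sum_mul]
    have h3 : ∑ y, |stepKernel P T x y - π y| ≤ 1 / 2 := by
      have : ∑ y, |(P x).real {ω | ω T = y} - π y| ≤ 1 / 2 := by linarith
      exact this
    nlinarith

/-- Beyond the mixing time the chain converges exponentially fast. -/
theorem IsMarkovChain.abs_sum_stepKernel_mul_sub_le (hπ : IsStationary P π) {T : ℝ≥0}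
    (hT : MixedAt P π (1 / 4) T) (n : ℕ) {f : V → ℝ} {a b : ℝ} (hf : ∀ v, a ≤ f v ∧ f v ≤ a + b)
    (x : V) :
    |∑ y, stepKernel P (n * T) x y * f y - ∑ y, π y * f y| ≤ b * (1 / 2) ^ n := by
  induction n generalizing f a b with
  | zero =>
    rw [Nat.cast_zero, zero_mul]
    simp_rw [hP.stepKernel_zero]
    have h1 : a ≤ ∑ y, π y * f y := by
      calc a = ∑ y, π y * a := by rw [← Finset.sum_mul, hπ.1.2, one_mul]
        _ ≤ _ := Finset.sum_le_sum fun y _ => mul_le_mul_of_nonneg_left (hf y).1 (hπ.1.1 y)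
    have h2 : ∑ y, π y * f y ≤ a + b := by
      calc ∑ y, π y * f y ≤ ∑ y, π y * (a + b) :=
            Finset.sum_le_sum fun y _ => mul_le_mul_of_nonneg_left (hf y).2 (hπ.1.1 y)
        _ = _ := by rw [← Finset.sum_mul, hπ.1.2, one_mul]
    simp only [ite_mul, one_mul, zero_mul, Finset.sum_ite_eq, Finset.mem_univ, if_true, pow_zero,
      mul_one]
    rw [abs_le]
    constructor <;> linarith [(hf x).1, (hf x).2]
  | succ n ih =>
    set g : V → ℝ := fun u => ∑ y, stepKernel P T u y * f y with hg
    set c := ∑ y, π y * f y with hc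
    have h1 : ∑ y, stepKernel P ((n + 1 : ℕ) * T) x y * f y
        = ∑ u, stepKernel P (n * T) x u * g u := by
      rw [show ((n + 1 : ℕ) : ℝ≥0) * T = T + n * T by push_cast; ring]
      simp_rw [hP.stepKernel_add, hg, Finset.sum_mul, Finset.mul_sum]
      rw [Finset.sum_comm]
      exact Finset.sum_congr rfl fun u _ => Finset.sum_congr rfl fun y _ => by ring
    have h2 : ∑ u, π u * g u = c := by
      simp_rw [hg, Finset.mul_sum]
      rw [Finset.sum_comm]
      refine Finset.sum_congr rfl fun y _ => ?_
      rw [← hP.sum_stationary hπ T y, Finset.sum_mul]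
      exact Finset.sum_congr rfl fun u _ => by ring
    -- After one period `T` all values lie within `b / 4` of the stationary mean, so the oscillation
    -- has been halved.
    have h3 : ∀ u, c - b / 4 ≤ g u ∧ g u ≤ c - b / 4 + b / 2 := by
      intro u
      have := abs_le.1 (hP.abs_sum_stepKernel_sub_le hπ.1 hT hf u)
      constructor <;> linarith [this.1, this.2]
    have := ih h3
    rw [h2] at this
    rw [h1, pow_succ]
    refine this.trans_eq (by ring)

theorem IsMarkovChain.eventually_jump_le {c : ℝ} (hc : qMax q < c) :
    ∀ᶠ j in atTop, ∀ x, 1 - stepKernel P (mesh j) x x ≤ c * mesh j := by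
  rw [eventually_all]
  intro x
  have h1 : Tendsto (fun ε : ℝ≥0 => ∑ y ∈ Finset.univ.erase x, stepKernel P ε x y / (ε : ℝ))
      (𝓝[>] 0) (𝓝 (∑ y ∈ Finset.univ.erase x, (q x y : ℝ))) :=
    tendsto_finsetSum _ fun y hy => hP.rates x y (Finset.ne_of_mem_erase hy).symm
  have h2 : ∑ y ∈ Finset.univ.erase x, (q x y : ℝ) < c :=
    lt_of_le_of_lt (le_ciSup (f := fun x => ∑ y ∈ Finset.univ.erase x, (q x y : ℝ))
      (finite_range _).bddAbove x) hc
  have h3 : Tendsto mesh atTop (𝓝[>] 0) :=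
    tendsto_nhdsWithin_iff.2 ⟨tendsto_mesh, Eventually.of_forall mesh_pos⟩
  filter_upwards [h3.eventually (h1.eventually_lt_const h2)] with j hj
  have h4 : (0 : ℝ) < mesh j := mesh_pos j
  have h5 := (hP.stepKernel_mem (mesh j) x).2
  rw [← Finset.add_sum_erase _ _ (Finset.mem_univ x)] at h5
  rw [← Finset.sum_div, div_lt_iff₀ h4] at hj
  linarith

omit hP in
theorem qMax_nonneg [Nonempty V] (q : V → V → ℝ≥0) : 0 ≤ qMax q := by
  obtain ⟨x⟩ := ‹Nonempty V›
  exact (Finset.sum_nonneg fun y _ => (q x y).coe_nonneg).trans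
    (le_ciSup (f := fun x => ∑ y ∈ Finset.univ.erase x, (q x y : ℝ)) (finite_range _).bddAbove x)

omit hP in
theorem iSup_le_alpha [Nonempty V] (q : V → V → ℝ≥0) (P : V → Measure (StepPath V))
    (hπ : π ∈ stdSimplex ℝ V) : ⨆ x, π x ≤ alpha q P π := by
  obtain ⟨x⟩ := ‹Nonempty V›
  have h0 : 0 ≤ ⨆ x, π x := (hπ.1 x).trans (le_ciSup (finite_range π).bddAbove x)
  have : Nonempty V := ⟨x⟩
  have := mul_nonneg (qMax_nonneg q) (mixingTime P π (1 / 4)).coe_nonneg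
  rw [alpha]
  nlinarith

/-- Along fine dyadic grids, the chain satisfies the discrete mixing hypothesis. -/
theorem IsMarkovChain.eventually_isMixingKernel [Nonempty V] (hM : IsMixing P π) {n : ℕ}
    (hn : 1 ≤ n) :
    ∀ᶠ j in atTop, ∃ (ρ : ℝ) (R : ℕ),
      IsMixingKernel (stepKernel P (mesh j)) π (⨆ x, π x) ρ ((1 / 2) ^ n) R ∧ 1 ≤ R ∧
      (⨆ x, π x) * (1 + 2 * ρ * R) ≤ 3 * n * alpha q P π := by
  set τ := mixingTime P π (1 / 4) with hτ
  set pm := ⨆ x, π x with hpm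
  have hle : ∀ y, π y ≤ pm := fun y => le_ciSup (finite_range π).bddAbove y
  have hpm0 : 0 ≤ pm := by
    obtain ⟨x⟩ := ‹Nonempty V›
    exact (hM.stationary.1.1 x).trans (hle x)
  have hτ0 : (0 : ℝ) ≤ τ := τ.coe_nonneg
  -- A rate strictly above `qMax q` bounds the jump probability per unit time on fine grids. The
  -- excess is so small that it costs at most `1 / 2` over the mixing time.
  set c := qMax q + 1 / (2 * (τ + 1)) with hc
  have hq := qMax_nonneg q
  have hcτ : c * τ ≤ qMax q * τ + 1 / 2 := by
    have : 1 / (2 * ((τ : ℝ) + 1)) * τ ≤ 1 / 2 := by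
      rw [div_mul_eq_mul_div, one_mul, div_le_iff₀ (by positivity)]
      linarith
    rw [hc, add_mul]
    linarith
  have hc0 : 0 < c := by positivity
  have hlim : Tendsto (fun j => c * (2 * (mesh j : ℝ))) atTop (𝓝 0) := by
    have := ((NNReal.tendsto_coe.2 tendsto_mesh).const_mul 2).const_mul c
    simpa using this
  have hqc : qMax q < c := lt_add_of_pos_right _ (by positivity)
  filter_upwards [hP.eventually_jump_le hqc, hlim.eventually_lt_const (show (0 : ℝ) < 1 / 2 by norm_num)]
    with j hj hj2
  set h := mesh j with hh
  have hh0 : 0 < h := mesh_pos j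
  have hh0' : (0 : ℝ) < h := hh0
  -- The additional step makes `r * h` strictly larger than the mixing time.
  set r := ⌈τ / h⌉₊ + 1 with hr
  have hr1 : τ < r * h := by
    have h1 : τ ≤ ⌈τ / h⌉₊ * h := (div_le_iff₀ hh0).1 (Nat.le_ceil _)
    rw [hr]
    push_cast
    rw [add_mul, one_mul]
    exact h1.trans_lt (lt_add_of_pos_right _ hh0)
  have hr2 : (r : ℝ) * h ≤ τ + 2 * h := by
    have h1 : (⌈τ / h⌉₊ : ℝ≥0) ≤ τ / h + 1 := (Nat.ceil_lt_add_one zero_le).le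
    have h2 : ((⌈τ / h⌉₊ : ℝ≥0) : ℝ) ≤ ((τ / h + 1 : ℝ≥0) : ℝ) := h1
    push_cast at h2
    rw [hr]
    push_cast
    have h3 : (τ : ℝ) / h * h = τ := div_mul_cancel₀ _ hh0'.ne'
    nlinarith
  have hmixed := hP.mixedAt_of_mixingTime_lt hM hr1
  -- `n` periods of `r` steps give the accuracy `(1 / 2) ^ n` and multiply the expected number of
  -- jumps by `n`.
  refine ⟨c * h, n * r, ⟨fun x => hP.stepKernel_mem h x, hM.stationary.1,
    hP.sum_stationary hM.stationary h, hle, hj, fun x B f hf => ?_⟩, ?_, ?_⟩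
  · simp_rw [hP.kpow_stepKernel]
    have := hP.abs_sum_stepKernel_mul_sub_le hM.stationary hmixed n (a := 0) (b := B)
      (fun v => by simpa using hf v) x
    rw [show ((n * r : ℕ) : ℝ≥0) * h = n * (r * h) by push_cast; ring, mul_comm ((1 / 2 : ℝ) ^ n)]
    exact this
  · exact Nat.one_le_iff_ne_zero.2 (Nat.mul_ne_zero (by omega) (by omega))
  · have h1 : c * (r * h) ≤ qMax q * τ + 1 := by
      calc c * (r * h) ≤ c * (τ + 2 * h) := mul_le_mul_of_nonneg_left hr2 hc0.le
        _ = c * τ + c * (2 * h) := by ring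
        _ ≤ _ := by linarith
    have hn' : (1 : ℝ) ≤ n := by exact_mod_cast hn
    have hqτ : 0 ≤ qMax q * τ := mul_nonneg hq hτ0
    have h2 : 1 + 2 * (c * h) * ((n * r : ℕ) : ℝ) ≤ 3 * n * (1 + qMax q * τ) := by
      push_cast
      have h3 : 2 * (c * h) * (n * r) = 2 * n * (c * (r * h)) := by ring
      rw [h3]
      have h4 : 2 * n * (c * (r * h)) ≤ 2 * n * (qMax q * τ + 1) :=
        mul_le_mul_of_nonneg_left h1 (by positivity)
      nlinarith
    have h5 := mul_le_mul_of_nonneg_left h2 hpm0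
    rw [alpha]
    refine h5.trans_eq ?_
    ring

end Mixing

/-! ### Comparison with the mean-field law, for one kernel -/

section Comparison

/-- The number of walkers after the initial stage, as a function of `ε` and `log |V|`. -/
def bigBang (ε ℓ : ℝ) : ℕ := ⌈ℓ / ε⌉₊

theorem choose_two_sq_le (k : ℕ) : (((k.choose 2 : ℕ) : ℝ)) ^ 2 ≤ (k : ℝ) ^ 4 / 4 := by
  have h1 : ((k.choose 2 : ℕ) : ℝ) ≤ (k : ℝ) ^ 2 / 2 := by
    rw [Nat.cast_choose_two]
    nlinarith [(k.cast_nonneg : (0 : ℝ) ≤ k)]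
  calc (((k.choose 2 : ℕ) : ℝ)) ^ 2 ≤ ((k : ℝ) ^ 2 / 2) ^ 2 :=
        pow_le_pow_left₀ (Nat.cast_nonneg _) h1 2
    _ = _ := by ring

/-- Since `15 / 16 ≤ exp (-1 / 16)`, the power is at most `x ^ (-2)`. For `x = |V|` this gives the
number of rounds of the initial stage. -/
theorem pow_mul_le_inv {x : ℝ} (hx : 0 < x) {r : ℕ} (hr : 32 * Real.log x ≤ r) :
    (15 / 16 : ℝ) ^ r * x ≤ 1 / x := by
  have h1 : (15 / 16 : ℝ) ≤ Real.exp (-(1 / 16)) := by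
    have := Real.add_one_le_exp (-(1 / 16) : ℝ); linarith
  have h2 : (15 / 16 : ℝ) ^ r ≤ Real.exp (-(2 * Real.log x)) := by
    refine (pow_le_pow_left₀ (by norm_num) h1 r).trans ?_
    rw [← Real.exp_nat_mul]
    refine Real.exp_le_exp.2 ?_
    linarith
  have h3 : Real.exp (-(2 * Real.log x)) = 1 / x / x := by
    rw [Real.exp_neg, two_mul, Real.exp_add, Real.exp_log hx]
    field_simp
  rw [h3] at h2
  calc (15 / 16 : ℝ) ^ r * x ≤ 1 / x / x * x := mul_le_mul_of_nonneg_right h2 hx.le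
    _ = 1 / x := div_mul_cancel₀ _ hx.ne'

variable {V : Type*} [Fintype V] [DecidableEq V] {K : V → V → ℝ} {π : V → ℝ} {pm ρ δ : ℝ} {R : ℕ}

/-- The size of the parameters, for `a` of order `α log (1/α)`, `ℓ = log |V|` and `ε⁶ = a ℓ⁴`. -/
structure SmallParameters (a ε ℓ : ℝ) : Prop where
  pos : 0 < ε
  small : ε ≤ 1 / 10 ^ 4
  log_large : 69 / 100 ≤ ℓ
  nonneg : 0 ≤ a
  eq : a * ℓ ^ 4 = ε ^ 6

namespace SmallParameters

variable {a ε ℓ : ℝ} (h : SmallParameters a ε ℓ)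
include h

theorem log_pos : 0 < ℓ := lt_of_lt_of_le (by norm_num) h.log_large

theorem pow_le_sq {n : ℕ} (hn : 2 ≤ n) : ε ^ n ≤ (1 / 10 ^ 4) ^ (n - 2) * ε ^ 2 := by
  obtain ⟨k, rfl⟩ := Nat.exists_eq_add_of_le hn
  rw [pow_add, mul_comm, Nat.add_sub_cancel_left]
  exact mul_le_mul_of_nonneg_right (pow_le_pow_left₀ h.pos.le h.small k) (sq_nonneg ε)

theorem le_pow : a ≤ 5 * ε ^ 6 := by
  have h1 : (69 / 100 : ℝ) ^ 4 ≤ ℓ ^ 4 := pow_le_pow_left₀ (by norm_num) h.log_large 4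
  have h2 := mul_le_mul_of_nonneg_left h1 h.nonneg
  rw [h.eq] at h2
  norm_num at h2
  have := h.nonneg
  linarith

theorem mul_log_le : a * ℓ ≤ 4 * ε ^ 6 := by
  have h1 : (69 / 100 : ℝ) ^ 3 ≤ ℓ ^ 3 := pow_le_pow_left₀ (by norm_num) h.log_large 3
  have h0 : 0 ≤ a * ℓ := mul_nonneg h.nonneg h.log_pos.le
  have h2 := mul_le_mul_of_nonneg_left h1 h0
  rw [show a * ℓ * ℓ ^ 3 = a * ℓ ^ 4 by ring, h.eq] at h2
  norm_num at h2
  linarith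

theorem bigBang_ge : ℓ / ε ≤ bigBang ε ℓ := Nat.le_ceil _

theorem bigBang_le : (bigBang ε ℓ : ℝ) ≤ 2 * (ℓ / ε) := by
  have h1 : (bigBang ε ℓ : ℝ) < ℓ / ε + 1 := Nat.ceil_lt_add_one (div_nonneg h.log_pos.le h.pos.le)
  have h2 : 1 ≤ ℓ / ε := by
    rw [le_div_iff₀ h.pos]
    linarith [h.small, h.log_large]
  linarith

theorem three_le_bigBang : 3 ≤ bigBang ε ℓ := by
  have h2 : 3 ≤ ℓ / ε := by
    rw [le_div_iff₀ h.pos]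
    linarith [h.small, h.log_large]
  have := h2.trans h.bigBang_ge
  exact_mod_cast this

/-- The balance behind the exponent `1 / 6`: with `k` of order `ℓ / ε`, the error `k ^ 4 * a` is of
order `a * ℓ ^ 4 / ε ^ 4 = ε ^ 2`. -/
theorem bigBang_pow_mul_le : (bigBang ε ℓ : ℝ) ^ 4 * a ≤ 16 * ε ^ 2 := by
  have h1 := pow_le_pow_left₀ (Nat.cast_nonneg _) h.bigBang_le 4
  have h2 := mul_le_mul_of_nonneg_right h1 h.nonneg
  have h3 : (2 * (ℓ / ε)) ^ 4 * a = 16 * ε ^ 2 := by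
    have hε := h.pos.ne'
    rw [show (2 * (ℓ / ε)) ^ 4 * a = 16 * (a * ℓ ^ 4) / ε ^ 4 by field_simp; ring, h.eq]
    field_simp
  rwa [h3] at h2

theorem bigBang_mul_le : (bigBang ε ℓ : ℝ) * a ≤ 8 * ε ^ 5 := by
  have h2 := mul_le_mul_of_nonneg_right h.bigBang_le h.nonneg
  have hε := h.pos.ne'
  have h3 : 2 * (ℓ / ε) * a = 2 * (a * ℓ) / ε := by ring
  have h4 : 2 * (a * ℓ) / ε ≤ 8 * ε ^ 5 := by
    rw [div_le_iff₀ h.pos]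
    have := h.mul_log_le
    nlinarith
  linarith

/-- The duration of the initial stage: `34 * ℓ` rounds of length about `4 * m / k ≤ 4 * ε * m / ℓ`
take `136 * ε * m`, and the mixing and rounding terms are of order `a * ℓ * m`, hence negligible. -/
theorem stage_le {m R t r : ℝ} (hm : 0 < m) (hRm : R ≤ 72 * a * m) (hm1 : 1 ≤ 72 * a * m)
    (ht : t ≤ 4 * m / bigBang ε ℓ + 1) (hr : r ≤ 34 * ℓ) (hr0 : 0 ≤ r) :
    (R + t) * r + R ≤ 140 * ε * m := by
  have hε := h.pos
  have hℓ0 := h.log_pos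
  have ha0 := h.nonneg
  have hk0 : (0 : ℝ) < bigBang ε ℓ := by
    have : 0 < bigBang ε ℓ := lt_of_lt_of_le (by norm_num) h.three_le_bigBang
    exact_mod_cast this
  have e1 : 4 * m / bigBang ε ℓ ≤ 4 * ε * m / ℓ := by
    have h1 := h.bigBang_ge
    rw [div_le_div_iff₀ hk0 hℓ0]
    rw [div_le_iff₀ hε] at h1
    have := mul_le_mul_of_nonneg_left h1 hm.le
    linarith
  have e2 : R + t ≤ 144 * a * m + 4 * ε * m / ℓ := by linarith
  have e3 : (R + t) * r ≤ (144 * a * m + 4 * ε * m / ℓ) * (34 * ℓ) :=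
    mul_le_mul e2 hr hr0 (by positivity)
  have e4 : (144 * a * m + 4 * ε * m / ℓ) * (34 * ℓ) = 4896 * (a * ℓ * m) + 136 * (ε * m) := by
    field_simp
    ring
  have e5 := mul_le_mul_of_nonneg_right h.mul_log_le hm.le
  have e6 := mul_le_mul_of_nonneg_right h.le_pow hm.le
  have e7 : ε ^ 6 * m ≤ 1 / 10 ^ 6 * (ε * m) := by
    rw [← mul_assoc]
    refine mul_le_mul_of_nonneg_right ?_ hm.le
    have h1 : ε ^ 2 ≤ 1 * ε := by nlinarith [h.small]
    have h6 := h.pow_le_sq (n := 6) (by norm_num)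
    norm_num at h6
    linarith
  have e8 := mul_pos hε hm
  linarith

end SmallParameters

/-! ### Coalescence tails along one grid -/

namespace IsMixingKernel

variable (hC : IsMixingKernel K π pm ρ δ R) {a ε : ℝ}
  (hs : SmallParameters a ε (Real.log (Fintype.card V))) (hR : 1 ≤ R)
  (hβ : pm * (1 + 2 * ρ * R) ≤ 9 * a) (hδ0 : 0 ≤ δ) (hδ : δ ≤ 2 * a)
include hC hs hR hβ hδ0 hδ

/-- The factor `72 = 8 * 9` comes from `le_meanMeet` and `hβ`. Together with `1 ≤ R` it shows that
`m` counts many steps, so the discretization error `1 / m` is at most of order `a`. -/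
theorem one_le_mul_meanMeet : 1 ≤ 72 * a * meanMeet K π ∧ (R : ℝ) ≤ 72 * a * meanMeet K π := by
  have ha := hs.le_pow
  have h6 := hs.pow_le_sq (n := 6) (by norm_num)
  have h2 : ε ^ 2 ≤ 1 := by nlinarith [hs.pos, hs.small]
  have h1 := hC.le_meanMeet (by norm_num at h6; linarith) (by norm_num at h6; linarith)
  have h3 : (R : ℝ) ≤ 72 * a * meanMeet K π := by
    refine h1.trans ?_
    have := mul_le_mul_of_nonneg_right hβ hC.meanMeet_nonneg
    nlinarith
  have h4 : (1 : ℝ) ≤ R := by exact_mod_cast hR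
  exact ⟨h4.trans h3, h3⟩

theorem meanMeet_pos : 0 < meanMeet K π := by
  have h := (hC.one_le_mul_meanMeet hs hR hβ hδ0 hδ).1
  by_contra h0
  have := hC.meanMeet_nonneg
  have h1 : meanMeet K π = 0 := le_antisymm (not_lt.1 h0) this
  rw [h1] at h
  norm_num at h

theorem one_div_card_le : 1 / (Fintype.card V : ℝ) ≤ 9 * a := by
  have := hC.nonempty
  have hN : (0 : ℝ) < Fintype.card V := by exact_mod_cast Fintype.card_pos
  have h1 : 1 ≤ Fintype.card V * pm := by
    calc (1 : ℝ) = ∑ y, π y := hC.prob.2.symm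
      _ ≤ ∑ _y : V, pm := Finset.sum_le_sum fun y _ => hC.le_pm y
      _ = _ := by simp
  have h2 : pm ≤ pm * (1 + 2 * ρ * R) := by
    have := mul_nonneg hC.pm_nonneg (mul_nonneg hC.rho_nonneg (Nat.cast_nonneg (α := ℝ) R))
    nlinarith
  rw [div_le_iff₀ hN]
  nlinarith

/-- `337 = 35 * 9 + 11 * 2`. -/
theorem sum_abs_meet_le (z : V) :
    ∑ y, π y * |meet K z y / meanMeet K π - 1| ≤ 337 * a := by
  have ha := hs.le_pow
  have h6 := hs.pow_le_sq (n := 6) (by norm_num)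
  have h2 : ε ^ 2 ≤ 1 := by nlinarith [hs.pos, hs.small]
  norm_num at h6
  have := hC.sum_abs_meet_sub_one_le hδ0 (by linarith) (by linarith)
    (hC.meanMeet_pos hs hR hβ hδ0 hδ) z
  linarith

/-- For `2 * k` walkers the error is at most `5 * (2 * k) ^ 4 / 4 * 337 * a = 6740 * k ^ 4 * a`, and
`k ^ 4 * a ≤ 16 * ε ^ 2`. -/
theorem abs_avg_sub_mfTail_le (n : ℕ) :
    |avg (fun _ : Fin (2 * bigBang ε (Real.log (Fintype.card V))) => π)
        (fun y => (flowOp K ^ n) twoInd (Finset.univ.image y))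
      - mfTail (2 * bigBang ε (Real.log (Fintype.card V))) (n / meanMeet K π)|
      ≤ 107840 * ε ^ 2 * (1 + n / meanMeet K π) := by
  set k := bigBang ε (Real.log (Fintype.card V)) with hk
  have hk3 := hs.three_le_bigBang
  have ha := hs.le_pow
  have ha0 := hs.nonneg
  have h6 := hs.pow_le_sq (n := 6) (by norm_num)
  have h2 : ε ^ 2 ≤ 1 := by nlinarith [hs.pos, hs.small]
  norm_num at h6
  have hm := hC.meanMeet_pos hs hR hβ hδ0 hδ
  have hpm : pm ≤ 337 * a := by
    have := mul_nonneg hC.pm_nonneg (mul_nonneg hC.rho_nonneg (Nat.cast_nonneg (α := ℝ) R))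
    nlinarith
  have hmη : 1 ≤ 337 * a * meanMeet K π := by
    have h1 := (hC.one_le_mul_meanMeet hs hR hβ hδ0 hδ).1
    nlinarith [mul_nonneg ha0 hm.le]
  refine (hC.abs_avg_twoInd_sub_le isMeanFieldTail_mfTail (by linarith) hm
    (hC.sum_abs_meet_le hs hR hβ hδ0 hδ) hpm hmη (by omega) n).trans ?_
  refine mul_le_mul_of_nonneg_right ?_ (by positivity)
  have h7 := choose_two_sq_le (2 * k)
  have h8 := hs.bigBang_pow_mul_le
  push_cast at h7
  have h9 := mul_le_mul_of_nonneg_right h7 ha0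
  rw [← hk] at h8
  nlinarith

/-- The non-coalescence probabilities dominate the mean-field tail. -/
theorem mfTail_sub_le (n : ℕ) :
    mfTail (2 * bigBang ε (Real.log (Fintype.card V))) (n / meanMeet K π)
      - 200000 * ε ^ 2 * (1 + n / meanMeet K π) ≤ (flowOp K ^ n) twoInd Finset.univ := by
  have h1 := (abs_le.1 (hC.abs_avg_sub_mfTail_le hs hR hβ hδ0 hδ n)).1
  have h2 := hC.avg_twoInd_le (2 * bigBang ε (Real.log (Fintype.card V))) n
  have hm := hC.meanMeet_pos hs hR hβ hδ0 hδ
  have h3 : 0 ≤ ε ^ 2 * (1 + n / meanMeet K π) := by positivity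
  linarith

/-- The non-coalescence probabilities are dominated by the shifted mean-field tail. -/
theorem flowOp_pow_le_mfTail (n : ℕ) (hn : 140 * ε ≤ n / meanMeet K π) :
    (flowOp K ^ n) twoInd Finset.univ
      ≤ mfTail (2 * bigBang ε (Real.log (Fintype.card V))) (n / meanMeet K π - 140 * ε)
        + 200000 * ε ^ 2 * (1 + n / meanMeet K π) := by
  set ℓ := Real.log (Fintype.card V) with hℓ
  set k := bigBang ε ℓ with hk
  set m := meanMeet K π with hmdef
  have hm : 0 < m := hC.meanMeet_pos hs hR hβ hδ0 hδ
  have := hC.nonempty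
  have hN : (0 : ℝ) < Fintype.card V := by exact_mod_cast Fintype.card_pos
  have hk3 := hs.three_le_bigBang
  have hε := hs.pos
  have ha := hs.le_pow
  have ha0 := hs.nonneg
  have hℓ0 := hs.log_pos
  have h6 := hs.pow_le_sq (n := 6) (by norm_num)
  have h5 := hs.pow_le_sq (n := 5) (by norm_num)
  have h2 : ε ^ 2 ≤ 1 / 10 ^ 8 := by
    calc ε ^ 2 ≤ (1 / 10 ^ 4) ^ 2 := pow_le_pow_left₀ hε.le hs.small 2
      _ = _ := by norm_num
  norm_num at h6 h5 h2
  obtain ⟨hm1, hRm⟩ := hC.one_le_mul_meanMeet hs hR hβ hδ0 hδ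
  rw [← hmdef] at hm1 hRm
  -- `t` is long enough for `k` stationary walkers to lose a quarter of their number, and `r` rounds
  -- make the probability that at least `2 * k` walkers are left at most `1 / |V|`.
  set t := ⌈4 * m / k⌉₊ with ht
  set r := ⌈32 * ℓ⌉₊ with hr
  have hk0 : (0 : ℝ) < k := by
    have : 0 < k := by omega
    exact_mod_cast this
  have ht1 : 4 * m ≤ k * t := by
    have := Nat.le_ceil (4 * m / k)
    rw [div_le_iff₀ hk0] at this
    linarith
  have ht2 : (t : ℝ) ≤ 4 * m / k + 1 := (Nat.ceil_lt_add_one (by positivity)).le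
  have hr2 : (r : ℝ) ≤ 34 * ℓ := by
    have h1 : (r : ℝ) < 32 * ℓ + 1 := Nat.ceil_lt_add_one (by positivity)
    linarith [hs.log_large]
  have h8 := hs.bigBang_pow_mul_le
  have h9 := hs.bigBang_mul_le
  rw [← hk] at h8 h9 hk3
  have hcard : tupleMean (ι := Fin k) K π t (fun _ A => (A.card : ℝ)) ≤ 3 / 4 * k := by
    refine hC.tupleMean_card_le (by linarith) hm (hC.sum_abs_meet_le hs hR hβ hδ0 hδ) hk3 ?_ ht1
    have h7 := mul_le_mul_of_nonneg_right (choose_two_sq_le k) ha0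
    have h3 : (3 : ℝ) ≤ k := by exact_mod_cast hk3
    nlinarith
  have hκδ : k * δ ≤ 16 * ε ^ 5 := by
    have := mul_le_mul_of_nonneg_left hδ hk0.le
    linarith
  set T := (R + t) * r + R with hT
  have hTm : (T : ℝ) ≤ 140 * ε * m := by
    rw [hT]
    push_cast
    exact hs.stage_le hm hRm hm1 ht2 hr2 (Nat.cast_nonneg _)
  have hTn : T ≤ n := by
    rw [le_div_iff₀ hm] at hn
    have : (T : ℝ) ≤ n := hTm.trans hn
    exact_mod_cast this
  obtain ⟨j, rfl⟩ := Nat.exists_eq_add_of_le hTn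
  have hmain := hC.flowOp_pow_twoInd_le (by omega : 0 < k) hcard (by linarith) hδ0 r j
  have havg := (abs_le.1 (hC.abs_avg_sub_mfTail_le hs hR hβ hδ0 hδ j)).2
  have hpow := pow_mul_le_inv hN (Nat.le_ceil (32 * ℓ))
  have hinv := hC.one_div_card_le hs hR hβ hδ0 hδ
  rw [← hr] at hpow
  rw [← hmdef] at havg
  have hj : (j : ℝ) / m ≤ ((T + j : ℕ) : ℝ) / m := by
    refine div_le_div_of_nonneg_right ?_ hm.le
    exact_mod_cast Nat.le_add_left _ _
  have hmono : mfTail (2 * k) (j / m) ≤ mfTail (2 * k) (((T + j : ℕ) : ℝ) / m - 140 * ε) := by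
    refine mfTail_antitone _ ?_
    push_cast
    rw [add_div, sub_le_iff_le_add, add_comm]
    have : (T : ℝ) / m ≤ 140 * ε := (div_le_iff₀ hm).2 hTm
    linarith
  have hj0 : 0 ≤ (j : ℝ) / m := by positivity
  -- `32 * ε ^ 5` is the mixing defect of `2 * k` walkers, and `45 * ε ^ 6` bounds `1 / |V| ≤ 9 *
  -- a`.
  have hE : 107840 * ε ^ 2 * (1 + j / m) + 32 * ε ^ 5 + 45 * ε ^ 6
      ≤ 200000 * ε ^ 2 * (1 + ((T + j : ℕ) : ℝ) / m) := by
    have h3 : 0 ≤ ε ^ 2 := sq_nonneg ε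
    have h4 := mul_le_mul_of_nonneg_left hj h3
    have h7 := mul_nonneg h3 hj0
    linarith
  linarith

/-- The non-coalescence probabilities decay exponentially on the scale of the meeting time. -/
theorem flowOp_pow_le_half_pow (i n : ℕ) (hn : 8 * i ≤ n / meanMeet K π) :
    (flowOp K ^ n) twoInd Finset.univ ≤ (1 / 2) ^ i := by
  set m := meanMeet K π with hmdef
  have hm : 0 < m := hC.meanMeet_pos hs hR hβ hδ0 hδ
  have hε := hs.pos
  have ha := hs.le_pow
  have hm1 := (hC.one_le_mul_meanMeet hs hR hβ hδ0 hδ).1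
  rw [← hmdef] at hm1
  have h6 := hs.pow_le_sq (n := 6) (by norm_num)
  have h2 : ε ^ 2 ≤ 1 / 10 ^ 8 := by
    calc ε ^ 2 ≤ (1 / 10 ^ 4) ^ 2 := pow_le_pow_left₀ hε.le hs.small 2
      _ = _ := by norm_num
  norm_num at h6 h2
  -- Since `m` counts many steps, rounding `7 * m` up stays below `8 * m`. One such period halves
  -- the probability of not having coalesced, and submultiplicativity iterates this.
  set N := ⌈7 * m⌉₊ with hN
  have hN1 : 7 * m ≤ N := Nat.le_ceil _
  have hN2 : (N : ℝ) ≤ 8 * m := by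
    have h1 : (N : ℝ) < 7 * m + 1 := Nat.ceil_lt_add_one (by positivity)
    nlinarith
  have hNd1 : 7 ≤ (N : ℝ) / m := (le_div_iff₀ hm).2 hN1
  have hNd2 : (N : ℝ) / m ≤ 8 := (div_le_iff₀ hm).2 hN2
  have hhalf : (flowOp K ^ N) twoInd Finset.univ ≤ 1 / 2 := by
    have h1 := hC.flowOp_pow_le_mfTail hs hR hβ hδ0 hδ N (by linarith [hs.small])
    rw [← hmdef] at h1
    -- The time left after the initial stage is at least `6`, and `4 * exp (-3) ≤ 1 / 4`.
    have h3 : mfTail (2 * bigBang ε (Real.log (Fintype.card V))) (N / m - 140 * ε) ≤ 1 / 4 := by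
      refine (mfTail_antitone _ (by linarith [hs.small] : (6 : ℝ) ≤ N / m - 140 * ε)).trans ?_
      refine (mfTail_le_mfLimit _ _).trans ((mfLimit_le_exp 6).trans ?_)
      have e1 : (16 : ℝ) ≤ Real.exp (6 / 2) := by
        have h4 : Real.exp (6 / 2) = Real.exp 1 ^ 3 := by
          rw [← Real.exp_nat_mul]; norm_num
        rw [h4]
        have h5 : (2.7 : ℝ) ≤ Real.exp 1 := by linarith [Real.exp_one_gt_d9]
        calc (16 : ℝ) ≤ 2.7 ^ 3 := by norm_num
          _ ≤ _ := pow_le_pow_left₀ (by norm_num) h5 3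
      rw [Real.exp_neg, ← div_eq_mul_inv, div_le_iff₀ (Real.exp_pos _)]
      linarith
    nlinarith
  have hpow : ∀ i : ℕ, (flowOp K ^ (i * N)) twoInd Finset.univ ≤ (1 / 2) ^ i := by
    intro i
    induction i with
    | zero => simpa using flowOp_pow_twoInd_le_one hC.stoch 0 Finset.univ
    | succ i ih =>
      rw [add_mul, one_mul]
      refine (flowOp_pow_add_twoInd_le hC.stoch (i * N) N Finset.univ).trans ?_
      rw [pow_succ, mul_comm]
      exact mul_le_mul ih hhalf (flowOp_pow_twoInd_nonneg hC.stoch _ _) (by positivity)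
  have hle : i * N ≤ n := by
    rw [le_div_iff₀ hm] at hn
    have h1 : (i : ℝ) * N ≤ n := by
      have := mul_le_mul_of_nonneg_left hN2 (Nat.cast_nonneg (α := ℝ) i)
      linarith
    exact_mod_cast h1
  obtain ⟨c, rfl⟩ := Nat.exists_eq_add_of_le hle
  refine (flowOp_pow_add_twoInd_le hC.stoch (i * N) c Finset.univ).trans ?_
  refine (mul_le_of_le_one_left (flowOp_pow_twoInd_nonneg hC.stoch _ _)
    (flowOp_pow_twoInd_le_one hC.stoch _ _)).trans (hpow i)

end IsMixingKernel

end Comparison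

/-! ### From tail bounds to the Wasserstein distance -/

section Wasserstein

/-- The integrand is the tail of the sum shifted by `σ`, so shifting costs exactly `σ`. -/
theorem setIntegral_mfLimit_sub {σ : ℝ} (hσ : 0 ≤ σ) : ∫ x in Ioi 0, mfLimit (x - σ) = 2 + σ := by
  have h1 : Integrable (fun z : ℕ → ℝ => (∑' n, z n) + σ) expSeq :=
    integrable_tsum_expSeq.add (integrable_const σ)
  have h2 : ∀ x, mfLimit (x - σ) = expSeq.real {z | x < (∑' n, z n) + σ} := fun x => by
    rw [mfLimit_eq]
    congr 1
    ext z
    exact sub_lt_iff_lt_add (α := ℝ)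
  simp_rw [h2]
  rw [← Integrable.integral_eq_integral_meas_lt h1, integral_add integrable_tsum_expSeq
    (integrable_const σ), integral_tsum_expSeq]
  · simp
  · filter_upwards [ae_nonneg_expSeq] with z hz
    exact add_nonneg (tsum_nonneg hz) hσ

theorem integrableOn_mfLimit_sub {σ : ℝ} (hσ : 0 ≤ σ) :
    IntegrableOn (fun x => mfLimit (x - σ)) (Ioi 0) := by
  by_contra h
  have := setIntegral_mfLimit_sub hσ
  rw [integral_undef h] at this
  linarith

theorem integrableOn_mfTail_add (k : ℕ) {ε : ℝ} (hε : 0 ≤ ε) :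
    IntegrableOn (fun x => mfTail k (x + ε)) (Ioi 0) := by
  have ha : Antitone fun x => mfTail k (x + ε) := fun x y h =>
    mfTail_antitone k (by linarith)
  refine integrableOn_mfLimit.mono' ha.measurable.aestronglyMeasurable
    (Eventually.of_forall fun x => ?_)
  rw [Real.norm_of_nonneg (isMeanFieldTail_mfTail.nonneg _ _)]
  exact (mfTail_antitone k (by linarith)).trans (mfTail_le_mfLimit k x)

/-- On the positive half-line the integrand is the tail of the positive part of the partial sum
minus `ε`. -/
theorem le_setIntegral_mfTail_add (k : ℕ) {ε : ℝ} :
    2 - 2 / (k + 1) - ε ≤ ∫ x in Ioi 0, mfTail (k + 1) (x + ε) := by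
  have hi := integrable_partialTime (k + 1)
  have h1 : Integrable (fun z => max (partialTime (k + 1) z - ε) 0) expSeq :=
    (hi.sub (integrable_const ε)).pos_part
  have h2 : ∫ x in Ioi 0, mfTail (k + 1) (x + ε)
      = ∫ x in Ioi 0, expSeq.real {z | x < max (partialTime (k + 1) z - ε) 0} := by
    refine setIntegral_congr_fun measurableSet_Ioi fun x hx => ?_
    rw [mfTail]
    congr 1
    ext z
    simp only [mem_ofPred_eq, lt_max_iff]
    constructor
    · intro h; left; linarith
    · rintro (h | h)
      · linarith
      · exact absurd h (not_lt.2 (le_of_lt hx))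
  rw [h2, ← Integrable.integral_eq_integral_meas_lt h1
    (Eventually.of_forall fun z => le_max_right _ _), ← integral_partialTime]
  have h3 : ∫ z, partialTime (k + 1) z ∂expSeq - ε = ∫ z, (partialTime (k + 1) z - ε) ∂expSeq := by
    rw [integral_sub hi (integrable_const ε)]; simp
  rw [h3]
  exact integral_mono (hi.sub (integrable_const ε)) h1 fun z => le_max_left _ _

/-- Tail bounds of a random variable close to the mean-field law. -/
structure IsNearMeanField (F : ℝ → ℝ) (k : ℕ) (ε : ℝ) : Prop where
  nonneg : ∀ x, 0 ≤ F x
  le_one : ∀ x, F x ≤ 1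
  antitone : Antitone F
  of_neg : ∀ x < 0, F x = 1
  lower : ∀ x, 0 ≤ x → mfTail k (x + ε) - 200000 * ε ^ 2 * (2 + x) ≤ F x
  upper : ∀ x, 141 * ε ≤ x → F x ≤ mfTail k (x - 141 * ε) + 200000 * ε ^ 2 * (2 + x)
  tail : ∀ (i : ℕ) (x : ℝ), 8 * i < x → F x ≤ (1 / 2) ^ i

namespace IsNearMeanField

variable {F : ℝ → ℝ} {k : ℕ} {ε : ℝ} (hF : IsNearMeanField F k ε)
include hF

/-- Take the largest admissible `i`, which is at least `x / 8 - 1`, and use `log 2 / 8 > 1 / 12`. -/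
theorem le_exp {x : ℝ} (hx : 0 < x) : F x ≤ 2 * Real.exp (-(1 / 12) * x) := by
  set i := ⌈x / 8⌉₊ - 1 with hi
  have hpos : 0 < ⌈x / 8⌉₊ := Nat.ceil_pos.2 (by positivity)
  have h1 : 8 * (i : ℝ) < x := by
    have : (i : ℝ) < x / 8 := Nat.lt_ceil.1 (by omega)
    linarith
  have h2 : x / 8 - 1 ≤ i := by
    have h3 := Nat.le_ceil (x / 8)
    have h4 : ((⌈x / 8⌉₊ : ℕ) : ℝ) = i + 1 := by
      rw [hi]
      have : ⌈x / 8⌉₊ = (⌈x / 8⌉₊ - 1) + 1 := by omega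
      exact_mod_cast this
    linarith
  refine (hF.tail i x h1).trans ?_
  have h3 : (1 / 2 : ℝ) ^ i = Real.exp (-(i * Real.log 2)) := by
    rw [← mul_neg, Real.exp_nat_mul, Real.exp_neg, Real.exp_log (by norm_num)]
    norm_num
  have h4 : (2 : ℝ) = Real.exp (Real.log 2) := (Real.exp_log (by norm_num)).symm
  rw [h3]
  conv_rhs => rw [h4]
  rw [← Real.exp_add]
  refine Real.exp_le_exp.2 ?_
  have h5 := Real.log_two_gt_d9
  nlinarith

/-- The error `p` of the tail bounds grows in `x`, but `F` and the mean-field tail are together at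
most `6 * y ^ 4`. The smaller of the two bounds is at most their geometric mean, and `p * 6 * y ^ 4`
is of order `ε ^ 2 * y ^ 2` because `(2 + x) * y ^ 2` is bounded. This is why an error of order `ε ^
2` in the tails becomes `ε` in the distance. -/
theorem abs_sub_le (hε : 0 < ε) {x : ℝ} (hx : 0 < x) :
    |F x - mfLimit x| ≤ (mfLimit (x - 141 * ε) - mfLimit x) + (mfLimit x - mfTail k (x + ε))
      + 5400 * ε * Real.exp (-(1 / 48) * x) := by
  have hA1 : 0 ≤ mfLimit (x - 141 * ε) - mfLimit x :=
    sub_nonneg.2 (mfLimit_antitone (by linarith))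
  have hA2 : 0 ≤ mfLimit x - mfTail k (x + ε) :=
    sub_nonneg.2 ((mfTail_antitone k (by linarith)).trans (mfTail_le_mfLimit k x))
  set p := 200000 * ε ^ 2 * (2 + x) with hp
  set y := Real.exp (-(1 / 48) * x) with hy
  have hy0 : 0 < y := Real.exp_pos _
  have hp0 : 0 ≤ p := by positivity
  have e2 : Real.exp (-(1 / 12) * x) = y ^ 4 := by
    rw [hy, ← Real.exp_nat_mul]; congr 1; push_cast; ring
  have hg := mfLimit_nonneg x
  rcases le_or_gt p (5400 * ε * y) with hpb | hpb
  · have hup : F x - mfLimit x ≤ mfLimit (x - 141 * ε) - mfLimit x + p := by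
      rcases le_or_gt (141 * ε) x with h | h
      · have := hF.upper x h
        have := mfTail_le_mfLimit k (x - 141 * ε)
        linarith
      · have h1 : mfLimit (x - 141 * ε) = 1 := mfLimit_of_neg (by linarith)
        linarith [hF.le_one x]
    have hlo := hF.lower x hx.le
    rw [abs_le]
    constructor <;> linarith
  · have hq : F x + mfLimit x ≤ 6 * y ^ 4 := by
      have h1 := hF.le_exp hx
      have h2 := mfLimit_le_exp x
      have h3 : Real.exp (-(x / 2)) ≤ Real.exp (-(1 / 12) * x) := Real.exp_le_exp.2 (by linarith)
      rw [e2] at h1 h3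
      linarith
    have hxy : (2 + x) * y ^ 2 ≤ 24 := by
      have h1 : x / 24 + 1 ≤ Real.exp (x / 24) := Real.add_one_le_exp _
      have h2 : Real.exp (x / 24) * y ^ 2 = 1 := by
        rw [hy, ← Real.exp_nat_mul, ← Real.exp_add, Real.exp_eq_one_iff]
        push_cast
        ring
      have h3 := mul_le_mul_of_nonneg_right h1 (sq_nonneg y)
      nlinarith [sq_nonneg y]
    have hb : 6 * y ^ 4 ≤ 5400 * ε * y := by
      by_contra hlt
      push Not at hlt
      have h1 : (5400 * ε * y) * (5400 * ε * y) < p * (6 * y ^ 4) :=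
        mul_lt_mul'' hpb hlt (by positivity) (by positivity)
      have h2 : p * (6 * y ^ 4) ≤ 200000 * 6 * 24 * ε ^ 2 * y ^ 2 := by
        have h3 : p * (6 * y ^ 4) = 1200000 * ε ^ 2 * y ^ 2 * ((2 + x) * y ^ 2) := by
          rw [hp]; ring
        rw [h3]
        have := mul_le_mul_of_nonneg_left hxy (show 0 ≤ 1200000 * ε ^ 2 * y ^ 2 by positivity)
        linarith
      have h4 : 0 < ε ^ 2 * y ^ 2 := by positivity
      nlinarith
    have h0 := hF.nonneg x
    rw [abs_le]
    constructor <;> linarith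

theorem integrableOn : IntegrableOn F (Ioi 0) := by
  have h1 : IntegrableOn (fun x => 2 * Real.exp (-(1 / 12) * x)) (Ioi 0) :=
    (integrableOn_exp_mul_Ioi (by norm_num) 0).const_mul 2
  refine h1.mono' hF.antitone.measurable.aestronglyMeasurable ?_
  filter_upwards [ae_restrict_mem measurableSet_Ioi] with x hx
  rw [Real.norm_of_nonneg (hF.nonneg x)]
  exact hF.le_exp hx

/-- The three parts contribute `141 * ε` by the shift, at most `3 * ε` by truncating the sum and
moving it by `ε`, and `5400 * 48 * ε` by the exponential. -/
theorem setIntegral_abs_sub_le (hε : 0 < ε) (hk : 1 ≤ k) (hkε : 2 / (k : ℝ) ≤ 2 * ε) :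
    ∫ x in Ioi 0, |F x - mfLimit x| ≤ 260000 * ε := by
  obtain ⟨k, rfl⟩ := Nat.exists_eq_add_of_le' hk
  have i1 := integrableOn_mfLimit_sub (σ := 141 * ε) (by linarith)
  have i2 := integrableOn_mfLimit
  have i3 := integrableOn_mfTail_add (k + 1) hε.le
  have i4 : IntegrableOn (fun x => 5400 * ε * Real.exp (-(1 / 48) * x)) (Ioi 0) :=
    (integrableOn_exp_mul_Ioi (by norm_num) 0).const_mul _
  have i12 : IntegrableOn (fun x => mfLimit (x - 141 * ε) - mfLimit x) (Ioi 0) := i1.sub i2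
  have i23 : IntegrableOn (fun x => mfLimit x - mfTail (k + 1) (x + ε)) (Ioi 0) := i2.sub i3
  have i123 : IntegrableOn (fun x => (mfLimit (x - 141 * ε) - mfLimit x)
      + (mfLimit x - mfTail (k + 1) (x + ε))) (Ioi 0) := i12.add i23
  have h1 : ∫ x in Ioi 0, |F x - mfLimit x| ≤ ∫ x in Ioi 0,
      ((mfLimit (x - 141 * ε) - mfLimit x) + (mfLimit x - mfTail (k + 1) (x + ε))
        + 5400 * ε * Real.exp (-(1 / 48) * x)) :=
    setIntegral_mono_on (hF.integrableOn.sub i2).abs (i123.add i4) measurableSet_Ioi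
      fun x hx => hF.abs_sub_le hε hx
  refine h1.trans ?_
  rw [integral_add i123 i4, integral_add i12 i23, integral_sub i1 i2, integral_sub i2 i3,
    integral_const_mul, integral_exp_mul_Ioi (by norm_num), setIntegral_mfLimit_sub (by linarith),
    setIntegral_mfLimit]
  have h2 := le_setIntegral_mfTail_add k (ε := ε)
  push_cast at hkε
  norm_num
  linarith

theorem lintegral_abs_sub_le (hε : 0 < ε) (hk : 1 ≤ k) (hkε : 2 / (k : ℝ) ≤ 2 * ε) :
    ∫⁻ x, ENNReal.ofReal |F x - mfLimit x| ≤ ENNReal.ofReal (260000 * ε) := by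
  have h1 : ∫⁻ x in Iic (0 : ℝ), ENNReal.ofReal |F x - mfLimit x| = 0 := by
    rw [setLIntegral_congr Iio_ae_eq_Iic.symm,
      setLIntegral_congr_fun (g := fun _ => 0) measurableSet_Iio]
    · simp
    · intro x hx
      simp [hF.of_neg x hx, mfLimit_of_neg hx]
  have hi : IntegrableOn (fun x => |F x - mfLimit x|) (Ioi 0) :=
    (hF.integrableOn.sub integrableOn_mfLimit).abs
  rw [← lintegral_add_compl _ (measurableSet_Iic (a := (0 : ℝ))), h1, zero_add, compl_Iic,
    ← ofReal_integral_eq_lintegral_ofReal hi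
      (Eventually.of_forall fun x => abs_nonneg _)]
  exact ENNReal.ofReal_le_ofReal (hF.setIntegral_abs_sub_le hε hk hkε)

theorem abs_setIntegral_sub_le (hε : 0 < ε) (hk : 1 ≤ k) (hkε : 2 / (k : ℝ) ≤ 2 * ε) :
    |(∫ x in Ioi 0, F x) - 2| ≤ 260000 * ε := by
  have h1 : (∫ x in Ioi 0, F x) - 2 = ∫ x in Ioi 0, (F x - mfLimit x) := by
    rw [integral_sub hF.integrableOn integrableOn_mfLimit, setIntegral_mfLimit]
  rw [h1]
  exact abs_integral_le_integral_abs.trans (hF.setIntegral_abs_sub_le hε hk hkε)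

end IsNearMeanField

end Wasserstein

/-! ### Passage to continuous time -/

section Limit

/-- Continuity lets the bounds along grids pass to the limit, where the normalized time also varies
with the mesh. -/
theorem continuousAt_mfTail (k : ℕ) {x : ℝ} (hx : 0 < x) : ContinuousAt (mfTail k) x := by
  have h : LipschitzOnWith (k.choose 2 : ℝ≥0) (mfTail k) (Ici 0) := by
    refine LipschitzOnWith.of_dist_le_mul fun u hu v hv => ?_
    rw [Real.dist_eq, Real.dist_eq]
    rcases le_total u v with huv | huv
    · have := mfTail_lipschitz k (u := u) (s := v - u) hu (by linarith)
      rw [add_sub_cancel] at this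
      rw [abs_sub_comm, abs_sub_comm u v, abs_of_nonneg (by linarith : 0 ≤ v - u)]
      exact this
    · have := mfTail_lipschitz k (u := v) (s := u - v) hv (by linarith)
      rw [add_sub_cancel] at this
      rw [abs_of_nonneg (by linarith : 0 ≤ u - v)]
      exact this
  exact h.continuousOn.continuousAt (Ici_mem_nhds hx)

theorem exists_dyadic_between {s t : ℝ} (hs : 0 ≤ s) (h : s < t) :
    ∃ a b : ℕ, s < ((a * mesh b : ℝ≥0) : ℝ) ∧ ((a * mesh b : ℝ≥0) : ℝ) < t := by
  lift s to ℝ≥0 using hs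
  lift t to ℝ≥0 using s.coe_nonneg.trans h.le
  obtain ⟨a, b, h1, h2⟩ := exists_mesh_mul_between (NNReal.coe_lt_coe.1 h)
  exact ⟨a, b, NNReal.coe_lt_coe.2 h1, NNReal.coe_lt_coe.2 h2⟩

variable {V : Type*} [Fintype V] [DecidableEq V] [Nonempty V] {q : V → V → ℝ≥0}
  {P : V → Measure (StepPath V)} {π : V → ℝ}

theorem one_le_card_mul_iSup (hπ : π ∈ stdSimplex ℝ V) : 1 ≤ Fintype.card V * ⨆ x, π x := by
  calc (1 : ℝ) = ∑ y, π y := hπ.2.symm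
    _ ≤ ∑ _y : V, ⨆ x, π x := Finset.sum_le_sum fun y _ => le_ciSup (finite_range π).bddAbove y
    _ = _ := by simp

theorem iSup_pos (hπ : π ∈ stdSimplex ℝ V) : 0 < ⨆ x, π x := by
  by_contra h
  have h1 := one_le_card_mul_iSup hπ
  have h2 : (Fintype.card V : ℝ) * ⨆ x, π x ≤ 0 :=
    mul_nonpos_of_nonneg_of_nonpos (Nat.cast_nonneg _) (not_lt.1 h)
  linarith

theorem log_two_le_log_inv {α : ℝ} (h0 : 0 < α) (h : α ≤ 1 / 2) : Real.log 2 ≤ Real.log (1 / α) :=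
  Real.log_le_log (by norm_num) (by rw [le_div_iff₀ h0]; linarith)

theorem smallParameters (hM : IsMixing P π) (hα : alpha q P π ≤ 1 / 2)
    (hε : errorTerm q P π ≤ 1 / 10 ^ 4) :
    SmallParameters (alpha q P π * Real.log (1 / alpha q P π)) (errorTerm q P π)
      (Real.log (Fintype.card V)) := by
  have hπ := hM.stationary.1
  have hpm := iSup_pos hπ
  have hpα := iSup_le_alpha q P hπ
  have hα0 := hpm.trans_le hpα
  have hL := log_two_le_log_inv hα0 hα
  have h2 := Real.log_two_gt_d9
  have hL0 : 0 < Real.log (1 / alpha q P π) := by linarith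
  have hN : (2 : ℝ) ≤ Fintype.card V := by
    have h1 := one_le_card_mul_iSup hπ
    have h3 : (Fintype.card V : ℝ) * ⨆ x, π x ≤ Fintype.card V * (1 / 2) :=
      mul_le_mul_of_nonneg_left (hpα.trans hα) (Nat.cast_nonneg _)
    linarith
  have hℓ : 69 / 100 ≤ Real.log (Fintype.card V) := by
    have := Real.log_le_log (by norm_num) hN
    linarith
  have hX : 0 < alpha q P π * Real.log (1 / alpha q P π) * Real.log (Fintype.card V) ^ 4 := by
    have : 0 < Real.log (Fintype.card V) := by linarith
    positivity
  refine ⟨Real.rpow_pos_of_pos hX _, hε, hℓ, by positivity, ?_⟩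
  rw [errorTerm, ← Real.rpow_natCast (_ ^ (1 / 6 : ℝ)), ← Real.rpow_mul hX.le]
  norm_num

/-- `n` is `log₂ (1 / α)` rounded up; this number of mixing periods produces the factor `log (1 /
α)` in the error term. -/
theorem exists_half_pow_le {α : ℝ} (h0 : 0 < α) (h : α ≤ 1 / 2) :
    ∃ n : ℕ, 1 ≤ n ∧ (1 / 2 : ℝ) ^ n ≤ α ∧ (n : ℝ) ≤ 3 * Real.log (1 / α) := by
  have hL := log_two_le_log_inv h0 h
  have h2 := Real.log_two_gt_d9
  set L := Real.log (1 / α) with hLdef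
  have hl : 0 < Real.log 2 := by linarith
  have h1 : 1 ≤ L / Real.log 2 := (one_le_div hl).2 hL
  refine ⟨⌈L / Real.log 2⌉₊, Nat.one_le_ceil_iff.2 (by linarith), ?_, ?_⟩
  · have h3 := Nat.le_ceil (L / Real.log 2)
    rw [div_le_iff₀ hl] at h3
    rw [← Real.exp_log h0, ← Real.exp_log (by norm_num : (0 : ℝ) < 1 / 2), ← Real.exp_nat_mul]
    refine Real.exp_le_exp.2 ?_
    rw [one_div, Real.log_inv]
    have h4 : L = -Real.log α := by rw [hLdef, one_div, Real.log_inv]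
    linarith
  · have h3 : ((⌈L / Real.log 2⌉₊ : ℕ) : ℝ) < L / Real.log 2 + 1 :=
      Nat.ceil_lt_add_one (by linarith)
    have h4 : L / Real.log 2 ≤ 3 / 2 * L := by
      rw [div_le_iff₀ hl]
      nlinarith
    linarith

/-! ### Limits of the discrete bounds along dyadic grids -/

section Chain

variable (hP : IsMarkovChain q P) (hM : IsMixing P π) (hα : alpha q P π ≤ 1 / 2)
include hP hM hα

/-- With `n` from `exists_half_pow_le`, `3 * n * α ≤ 9 * α * log (1 / α)`, and `(1 / 2) ^ n ≤ α ≤ 2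
* α * log (1 / α)` because `log 2 > 1 / 2`. -/
theorem IsMarkovChain.eventually_kernel :
    ∀ᶠ j in atTop, ∃ (ρ δ : ℝ) (R : ℕ),
      IsMixingKernel (stepKernel P (mesh j)) π (⨆ x, π x) ρ δ R ∧ 1 ≤ R ∧
      (⨆ x, π x) * (1 + 2 * ρ * R) ≤ 9 * (alpha q P π * Real.log (1 / alpha q P π)) ∧
      0 ≤ δ ∧ δ ≤ 2 * (alpha q P π * Real.log (1 / alpha q P π)) := by
  have hπ := hM.stationary.1
  have hα0 := (iSup_pos hπ).trans_le (iSup_le_alpha q P hπ)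
  obtain ⟨n, hn1, hn2, hn3⟩ := exists_half_pow_le hα0 hα
  have hL := log_two_le_log_inv hα0 hα
  have h2 := Real.log_two_gt_d9
  filter_upwards [hP.eventually_isMixingKernel hM hn1] with j hj
  obtain ⟨ρ, R, hC, hR, hβ⟩ := hj
  refine ⟨ρ, _, R, hC, hR, hβ.trans ?_, by positivity, hn2.trans ?_⟩
  · have := mul_le_mul_of_nonneg_right hn3 hα0.le
    linarith
  · nlinarith

theorem IsMarkovChain.meanMeetingTime_lt_top_and_tendsto
    (hε : errorTerm q P π ≤ 1 / 10 ^ 4) :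
    meanMeetingTime P π < ∞ ∧
    Tendsto (fun j => mesh j * meanMeet (stepKernel P (mesh j)) π) atTop
      (𝓝 (meanMeetingTime P π).toReal) := by
  have hs := smallParameters hM hα hε
  obtain ⟨j₀, hj₀⟩ := eventually_atTop.1 (hP.eventually_kernel hM hα)
  refine hP.tendsto_meanMeet hM.stationary.1 (j₀ := j₀) fun j hj => ?_
  obtain ⟨ρ, δ, R, hC, hR, hβ, hδ0, hδ⟩ := hj₀ j hj
  have ha := hs.le_pow
  have h6 := hs.pow_le_sq (n := 6) (by norm_num)
  have h2 : errorTerm q P π ^ 2 ≤ 1 := by nlinarith [hs.pos, hs.small]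
  norm_num at h6
  exact hC.summable_surv (by linarith)

/-- Two stationary walks start apart with probability at least `1 / 2`, since the largest mass of
`π` is at most `α ≤ 1 / 2`. By right continuity, paths that start apart have a positive meeting
time. -/
theorem IsMarkovChain.meanMeetingTime_pos : 0 < meanMeetingTime P π := by
  have hπ := hM.stationary.1
  have h0 := hP.isProbabilityMeasure_startFrom hπ
  have hmeas : Measurable fun w : StepPath V × StepPath V => meetingTime w.1 w.2 :=
    measurable_of_tendsto_metrizable
      (fun j => measurable_gridMeetingTime (mesh_pos j))
      (tendsto_pi_nhds.2 fun w => tendsto_gridMeetingTime w.1 w.2)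
  rw [meanMeetingTime, lintegral_pos_iff_support hmeas]
  have h1 : apart V 1 0 ⊆ Function.support fun w : StepPath V × StepPath V =>
      meetingTime w.1 w.2 := by
    intro w hw h
    obtain ⟨D, hD, hc⟩ := exists_constOff ![w.1, w.2]
    have hp : ConstOff D fun t => w.1 t = w.2 t := fun s t hst hd => by
      have h0 := hc 0 hst hd
      have h1 := hc 1 hst hd
      simp only [Matrix.cons_val_zero, Matrix.cons_val_one] at h0 h1
      simp only [h0, h1]
    have h2 : firstTime (fun t => w.1 t = w.2 t) ≤ ((0 : ℝ≥0) : ℝ≥0∞) := le_of_eq h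
    obtain ⟨s, hs, he⟩ := (hD.firstTime_le_iff hp).1 h2
    have h3 := hw 0 le_rfl
    rw [Nat.cast_zero, zero_mul] at h3
    rw [le_antisymm hs zero_le] at he
    exact h3 he
  refine lt_of_lt_of_le ?_ (measure_mono h1)
  rw [pos_iff_ne_zero]
  intro hz
  have h2 := hP.prod_startFrom_real hπ hπ (measurableSet_apart (V := V) 1 0)
  rw [Measure.real, hz, ENNReal.toReal_zero] at h2
  simp_rw [hP.prod_apart] at h2
  have h3 : ∀ a, 1 / 2 ≤ ∑ b, π b * surv (stepKernel P 1) 0 a b := by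
    intro a
    have h4 : ∑ b, π b * surv (stepKernel P 1) 0 a b = 1 - π a := by
      have h5 : ∀ b, π b * surv (stepKernel P 1) 0 a b = π b - if a = b then π b else 0 := by
        intro b
        simp only [surv]
        split_ifs <;> simp
      simp_rw [h5]
      rw [Finset.sum_sub_distrib, hπ.2]
      simp
    rw [h4]
    have h6 := le_ciSup (finite_range π).bddAbove a
    have h7 := iSup_le_alpha q P hπ
    linarith
  have h4 : 1 / 2 ≤ pairAvg π π fun x y => surv (stepKernel P 1) 0 x y := by
    rw [pairAvg_apply]
    calc (1 / 2 : ℝ) = ∑ a, π a * (1 / 2) := by rw [← Finset.sum_mul, hπ.2, one_mul]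
      _ ≤ _ := Finset.sum_le_sum fun a _ => mul_le_mul_of_nonneg_left (h3 a) (hπ.1 a)
  linarith

variable (hε : errorTerm q P π ≤ 1 / 10 ^ 4)
include hε

theorem IsMarkovChain.toReal_meanMeetingTime_pos : 0 < (meanMeetingTime P π).toReal :=
  ENNReal.toReal_pos (hP.meanMeetingTime_pos hM hα).ne'
    (hP.meanMeetingTime_lt_top_and_tendsto hM hα hε).1.ne

/-- The number of steps up to a fixed dyadic time, divided by the mean meeting time in steps, is a
ratio of physical times, as the mesh cancels. -/
theorem IsMarkovChain.tendsto_ratio (a b : ℕ) :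
    Tendsto (fun j => ((a * 2 ^ j : ℕ) : ℝ) / meanMeet (stepKernel P (mesh (j + b))) π) atTop
      (𝓝 (((a * mesh b : ℝ≥0) : ℝ) / (meanMeetingTime P π).toReal)) := by
  have hm := hP.toReal_meanMeetingTime_pos hM hα hε
  have h1 := (hP.meanMeetingTime_lt_top_and_tendsto hM hα hε).2
  have h2 := (tendsto_const_nhds (x := ((a * mesh b : ℝ≥0) : ℝ))).div
    (h1.comp (tendsto_add_atTop_nat b)) hm.ne'
  refine h2.congr fun j => ?_
  have h3 : (mesh (j + b) : ℝ) ≠ 0 := by exact_mod_cast (mesh_pos (j + b)).ne'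
  rw [Pi.div_apply, Function.comp_apply, mesh_mul_eq a b j, NNReal.coe_mul, NNReal.coe_natCast,
    mul_comm, mul_div_mul_left _ _ h3]

variable (x : Fin (Fintype.card V) ≃ V)

theorem IsMarkovChain.mfTail_sub_le (a b : ℕ) (hab : (0 : ℝ) < (a * mesh b : ℝ≥0)) :
    mfTail (2 * bigBang (errorTerm q P π) (Real.log (Fintype.card V)))
        (((a * mesh b : ℝ≥0) : ℝ) / (meanMeetingTime P π).toReal)
      - 200000 * errorTerm q P π ^ 2 * (1 + ((a * mesh b : ℝ≥0) : ℝ) / (meanMeetingTime P π).toReal)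
      ≤ (walksLaw P x).real {w | ((a * mesh b : ℝ≥0) : ℝ≥0∞) < coalescenceTime w} := by
  have hm := hP.toReal_meanMeetingTime_pos hM hα hε
  have hr := hP.tendsto_ratio hM hα hε a b
  refine le_of_tendsto_of_tendsto (((continuousAt_mfTail _ (div_pos hab hm)).tendsto.comp hr).sub
    ((hr.const_add 1).const_mul _)) (hP.tendsto_flowOp_pow x a b) ?_
  filter_upwards [(tendsto_add_atTop_nat b).eventually (hP.eventually_kernel hM hα)] with j hj
  obtain ⟨ρ, δ, R, hC, hR, hβ, hδ0, hδ⟩ := hj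
  exact hC.mfTail_sub_le (smallParameters hM hα hε) hR hβ hδ0 hδ _

theorem IsMarkovChain.le_mfTail_add (a b : ℕ) (hab : 140 * errorTerm q P π
      < ((a * mesh b : ℝ≥0) : ℝ) / (meanMeetingTime P π).toReal) :
    (walksLaw P x).real {w | ((a * mesh b : ℝ≥0) : ℝ≥0∞) < coalescenceTime w}
      ≤ mfTail (2 * bigBang (errorTerm q P π) (Real.log (Fintype.card V)))
        (((a * mesh b : ℝ≥0) : ℝ) / (meanMeetingTime P π).toReal - 140 * errorTerm q P π)
      + 200000 * errorTerm q P π ^ 2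
        * (1 + ((a * mesh b : ℝ≥0) : ℝ) / (meanMeetingTime P π).toReal) := by
  have hr := hP.tendsto_ratio hM hα hε a b
  refine le_of_tendsto_of_tendsto (hP.tendsto_flowOp_pow x a b)
    (((continuousAt_mfTail _ (sub_pos.2 hab)).tendsto.comp (hr.sub_const _)).add
    ((hr.const_add 1).const_mul _)) ?_
  filter_upwards [(tendsto_add_atTop_nat b).eventually (hP.eventually_kernel hM hα),
    hr.eventually_const_lt hab] with j hj hlt
  obtain ⟨ρ, δ, R, hC, hR, hβ, hδ0, hδ⟩ := hj
  exact hC.flowOp_pow_le_mfTail (smallParameters hM hα hε) hR hβ hδ0 hδ _ hlt.le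

theorem IsMarkovChain.le_half_pow (a b i : ℕ) (hab : 8 * i
      < ((a * mesh b : ℝ≥0) : ℝ) / (meanMeetingTime P π).toReal) :
    (walksLaw P x).real {w | ((a * mesh b : ℝ≥0) : ℝ≥0∞) < coalescenceTime w}
      ≤ (1 / 2) ^ i := by
  have hr := hP.tendsto_ratio hM hα hε a b
  refine le_of_tendsto (hP.tendsto_flowOp_pow x a b) ?_
  filter_upwards [(tendsto_add_atTop_nat b).eventually (hP.eventually_kernel hM hα),
    hr.eventually_const_lt hab] with j hj hlt
  obtain ⟨ρ, δ, R, hC, hR, hβ, hδ0, hδ⟩ := hj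
  exact hC.flowOp_pow_le_half_pow (smallParameters hM hα hε) hR hβ hδ0 hδ _ _ hlt.le

/-- The exponential bound at dyadic times leaves no mass at infinity. This makes the passage to real
values by `toReal` harmless. -/
theorem IsMarkovChain.ae_coalescenceTime_lt_top :
    ∀ᵐ w ∂(walksLaw P x), coalescenceTime w < ∞ := by
  have hpr := hP.isProbabilityMeasure_walksLaw x
  have hm := hP.toReal_meanMeetingTime_pos hM hα hε
  have h1 : ∀ i : ℕ, (walksLaw P x).real {w | ¬ coalescenceTime w < ∞} ≤ (1 / 2) ^ i := by
    intro i
    obtain ⟨a, b, h2, -⟩ := exists_dyadic_between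
      (s := 8 * i * (meanMeetingTime P π).toReal) (by positivity) (lt_add_one _)
    refine le_trans (measureReal_mono fun w hw => ?_)
      (hP.le_half_pow hM hα hε x a b i ((lt_div_iff₀ hm).2 h2))
    have : coalescenceTime w = ∞ := not_lt_top_iff.1 hw
    change _ < coalescenceTime w
    rw [this]
    exact ENNReal.coe_lt_top
  have h2 : (walksLaw P x).real {w | ¬ coalescenceTime w < ∞} ≤ 0 :=
    ge_of_tendsto' (tendsto_pow_atTop_nhds_zero_of_lt_one (by norm_num) (by norm_num)) h1
  have h3 := le_antisymm h2 measureReal_nonneg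
  exact ae_iff.2 ((measureReal_eq_zero_iff (measure_ne_top _ _)).1 h3)

/-- The tail of the rescaled coalescence time is close to the mean-field tail. -/
theorem IsMarkovChain.isNearMeanField :
    IsNearMeanField (fun y => ((walksLaw P x).map fun w =>
        (coalescenceTime w).toReal / (meanMeetingTime P π).toReal).real (Ioi y))
      (2 * bigBang (errorTerm q P π) (Real.log (Fintype.card V))) (errorTerm q P π) := by
  have hpr := hP.isProbabilityMeasure_walksLaw x
  have hm := hP.toReal_meanMeetingTime_pos hM hα hε
  have hs := smallParameters hM hα hε
  have hpos := hs.pos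
  set m := (meanMeetingTime P π).toReal with hmdef
  set ε := errorTerm q P π with hεdef
  have hmeas : Measurable fun w : Fin (Fintype.card V) → StepPath V =>
      (coalescenceTime w).toReal / m := (measurable_coalescenceTime.ennreal_toReal).div_const m
  have hpr' : IsProbabilityMeasure ((walksLaw P x).map fun w => (coalescenceTime w).toReal / m) :=
    Measure.isProbabilityMeasure_map hmeas.aemeasurable
  have hE : ∀ y, ((walksLaw P x).map fun w => (coalescenceTime w).toReal / m).real (Ioi y)
      = (walksLaw P x).real {w | y < (coalescenceTime w).toReal / m} := fun y => by
    rw [Measure.real, Measure.map_apply hmeas measurableSet_Ioi]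
    rfl
  have hfin := hP.ae_coalescenceTime_lt_top hM hα hε x
  have hup : ∀ (y : ℝ) (a b : ℕ), ((a * mesh b : ℝ≥0) : ℝ) ≤ y * m →
      ((walksLaw P x).map fun w => (coalescenceTime w).toReal / m).real (Ioi y)
        ≤ (walksLaw P x).real {w | ((a * mesh b : ℝ≥0) : ℝ≥0∞) < coalescenceTime w} := by
    intro y a b hab
    rw [hE]
    refine ENNReal.toReal_mono (measure_ne_top _ _) (measure_mono_ae ?_)
    filter_upwards [hfin] with w hw hy
    have h1 : y * m < (coalescenceTime w).toReal := (lt_div_iff₀ hm).1 hy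
    change _ < coalescenceTime w
    rw [← ENNReal.toReal_lt_toReal ENNReal.coe_ne_top hw.ne]
    exact hab.trans_lt h1
  have hlow : ∀ (y : ℝ) (a b : ℕ), y * m ≤ ((a * mesh b : ℝ≥0) : ℝ) →
      (walksLaw P x).real {w | ((a * mesh b : ℝ≥0) : ℝ≥0∞) < coalescenceTime w}
        ≤ ((walksLaw P x).map fun w => (coalescenceTime w).toReal / m).real (Ioi y) := by
    intro y a b hab
    rw [hE]
    refine ENNReal.toReal_mono (measure_ne_top _ _) (measure_mono_ae ?_)
    filter_upwards [hfin] with w hw hy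
    change ((a * mesh b : ℝ≥0) : ℝ≥0∞) < coalescenceTime w at hy
    rw [← ENNReal.toReal_lt_toReal ENNReal.coe_ne_top hw.ne] at hy
    exact (lt_div_iff₀ hm).2 (hab.trans_lt hy)
  refine ⟨fun _ => measureReal_nonneg, fun _ => measureReal_le_one,
    fun y z h => measureReal_mono (Ioi_subset_Ioi h), fun y hy => ?_, fun y hy => ?_,
    fun y hy => ?_, fun i y hy => ?_⟩
  · have h1 : {w : Fin (Fintype.card V) → StepPath V | y < (coalescenceTime w).toReal / m}
        = univ := by
      refine eq_univ_of_forall fun w => hy.trans_le ?_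
      positivity
    rw [hE, h1, probReal_univ]
  -- The bounds are available at dyadic times only. A dyadic time within `ε * m` of the required one
  -- costs a further shift by `ε`, which is why `141` replaces `140` in the upper bound.
  · obtain ⟨a, b, h1, h2⟩ := exists_dyadic_between (s := y * m) (t := (y + ε) * m) (by positivity)
      (mul_lt_mul_of_pos_right (by linarith) hm)
    refine le_trans ?_ (hlow y a b h1.le)
    refine le_trans ?_ (hP.mfTail_sub_le hM hα hε x a b ((by positivity : 0 ≤ y * m).trans_lt h1))
    rw [← hmdef, ← hεdef]
    set s := ((a * mesh b : ℝ≥0) : ℝ) / m with hsdef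
    have h3 : s ≤ y + ε := (div_le_iff₀ hm).2 h2.le
    have h4 := mfTail_antitone (2 * bigBang ε (Real.log (Fintype.card V))) h3
    have h5 : 200000 * ε ^ 2 * (1 + s) ≤ 200000 * ε ^ 2 * (2 + y) :=
      mul_le_mul_of_nonneg_left (by linarith [hs.small]) (by positivity)
    linarith
  · obtain ⟨a, b, h1, h2⟩ := exists_dyadic_between (s := (y - ε) * m) (t := y * m)
      (mul_nonneg (by linarith) hm.le) (mul_lt_mul_of_pos_right (by linarith) hm)
    refine (hup y a b h2.le).trans ?_
    have h3 : y - ε < ((a * mesh b : ℝ≥0) : ℝ) / m := (lt_div_iff₀ hm).2 h1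
    refine (hP.le_mfTail_add hM hα hε x a b (by rw [← hmdef, ← hεdef]; linarith)).trans ?_
    rw [← hmdef, ← hεdef]
    set s := ((a * mesh b : ℝ≥0) : ℝ) / m with hsdef
    have h6 : s ≤ y := (div_le_iff₀ hm).2 h2.le
    have h4 := mfTail_antitone (2 * bigBang ε (Real.log (Fintype.card V)))
      (show y - 141 * ε ≤ s - 140 * ε by linarith)
    have h5 : 200000 * ε ^ 2 * (1 + s) ≤ 200000 * ε ^ 2 * (2 + y) :=
      mul_le_mul_of_nonneg_left (by linarith) (by positivity)
    linarith
  · obtain ⟨a, b, h1, h2⟩ := exists_dyadic_between (s := 8 * i * m) (t := y * m)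
      (by positivity) (mul_lt_mul_of_pos_right hy hm)
    exact (hup y a b h2.le).trans (hP.le_half_pow hM hα hε x a b i ((lt_div_iff₀ hm).2 h1))

/-- The layer-cake formula after rescaling; the exponential tail makes the integral on the right a
genuine one. -/
theorem IsMarkovChain.lintegral_coalescenceTime :
    ∫⁻ w, coalescenceTime w ∂(walksLaw P x)
      = ENNReal.ofReal ((meanMeetingTime P π).toReal * ∫ y in Ioi 0, ((walksLaw P x).map fun w =>
        (coalescenceTime w).toReal / (meanMeetingTime P π).toReal).real (Ioi y)) := by
  have hpr := hP.isProbabilityMeasure_walksLaw x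
  have hm := hP.toReal_meanMeetingTime_pos hM hα hε
  have hnear := hP.isNearMeanField hM hα hε x
  set m := (meanMeetingTime P π).toReal with hmdef
  have hmeas : Measurable fun w : Fin (Fintype.card V) → StepPath V =>
      (coalescenceTime w).toReal / m := (measurable_coalescenceTime.ennreal_toReal).div_const m
  have hpr' : IsProbabilityMeasure ((walksLaw P x).map fun w => (coalescenceTime w).toReal / m) :=
    Measure.isProbabilityMeasure_map hmeas.aemeasurable
  have h1 : ∫⁻ w, coalescenceTime w ∂(walksLaw P x)
      = ENNReal.ofReal m * ∫⁻ w, ENNReal.ofReal ((coalescenceTime w).toReal / m)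
        ∂(walksLaw P x) := by
    rw [← lintegral_const_mul _ hmeas.ennreal_ofReal]
    refine lintegral_congr_ae ?_
    filter_upwards [hP.ae_coalescenceTime_lt_top hM hα hε x] with w hw
    rw [← ENNReal.ofReal_mul hm.le, mul_div_cancel₀ _ hm.ne', ENNReal.ofReal_toReal hw.ne]
  rw [h1, lintegral_eq_lintegral_meas_lt _ (Eventually.of_forall fun w => by positivity)
    hmeas.aemeasurable, ENNReal.ofReal_mul hm.le]
  congr 1
  rw [ofReal_integral_eq_lintegral_ofReal hnear.integrableOn
    (Eventually.of_forall fun y => measureReal_nonneg)]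
  refine lintegral_congr fun y => ?_
  rw [ofReal_measureReal, Measure.map_apply hmeas measurableSet_Ioi]
  rfl

theorem two_div_bigBang_le : 2 / ((2 * bigBang (errorTerm q P π)
    (Real.log (Fintype.card V)) : ℕ) : ℝ) ≤ 2 * errorTerm q P π := by
  have hs := smallParameters hM hα hε
  have h1 := hs.bigBang_ge
  rw [div_le_iff₀ hs.pos] at h1
  have h2 := hs.three_le_bigBang
  have h3 : (0 : ℝ) < bigBang (errorTerm q P π) (Real.log (Fintype.card V)) := by
    exact_mod_cast (by omega : 0 < bigBang (errorTerm q P π) (Real.log (Fintype.card V)))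
  push_cast
  rw [div_le_iff₀ (by positivity)]
  linarith [hs.log_large]

end Chain

end Limit

end CoalescingWalks

end

theorem theorem2 :
    ∃ C ξ : ℝ, 0 < C ∧ 0 < ξ ∧
      ∀ (V : Type*) [Fintype V] [DecidableEq V] [Nonempty V] (q : V → V → ℝ≥0)
        (P : V → Measure (StepPath V)) (π : V → ℝ),
        IsMarkovChain q P → IsMixing P π → alpha q P π ≤ 1 / 2 → errorTerm q P π ≤ ξ →
        -- one walker starts from each element of `V`
        ∀ x : Fin (Fintype.card V) ≃ V,
          0 < meanMeetingTime P π ∧ meanMeetingTime P π < ∞ ∧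
          ∫⁻ w, coalescenceTime w ∂(walksLaw P x) < ∞ ∧
          wassersteinDist
              ((walksLaw P x).map fun w =>
                (coalescenceTime w).toReal / (meanMeetingTime P π).toReal)
              meanFieldLaw
            ≤ ENNReal.ofReal (C * errorTerm q P π) ∧
          |(∫⁻ w, coalescenceTime w ∂(walksLaw P x)).toReal
              - 2 * (meanMeetingTime P π).toReal|
            ≤ C * errorTerm q P π * (meanMeetingTime P π).toReal := by
  -- The first constant is that of `setIntegral_abs_sub_le`, and the second is the smallness
  -- demanded by `SmallParameters`.
  refine ⟨260000, 1 / 10 ^ 4, by norm_num, by norm_num, ?_⟩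
  intro V _ _ _ q P π hP hM hα hε x
  have hs := smallParameters hM hα hε
  have hm := hP.toReal_meanMeetingTime_pos hM hα hε
  have hnear := hP.isNearMeanField hM hα hε x
  have hk : 1 ≤ 2 * bigBang (errorTerm q P π) (Real.log (Fintype.card V)) := by
    have := hs.three_le_bigBang
    omega
  have hkε := two_div_bigBang_le hP hM hα hε
  have hEC := hP.lintegral_coalescenceTime hM hα hε x
  refine ⟨hP.meanMeetingTime_pos hM hα, (hP.meanMeetingTime_lt_top_and_tendsto hM hα hε).1, ?_,
    hnear.lintegral_abs_sub_le hs.pos hk hkε, ?_⟩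
  · rw [hEC]
    exact ENNReal.ofReal_lt_top
  · have h1 := hnear.abs_setIntegral_sub_le hs.pos hk hkε
    rw [hEC, ENNReal.toReal_ofReal (mul_nonneg hm.le (integral_nonneg hnear.nonneg)),
      mul_comm (2 : ℝ), ← mul_sub, abs_mul, abs_of_pos hm, mul_comm]
    exact mul_le_mul_of_nonneg_right h1 hm.le
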